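/- Let $\mathcal H\neq\{0\}$ be a finite-dimensional complex Hilbert space, $\mathcal S(\mathcal H)$ the set of density operators on $\mathcal H$ (positive semidefinite operators of trace one), $\mathcal X$ an arbitrary set, and $W:\mathcal X\to\mathcal S(\mathcal H)$ an arbitrary map (a classical-quantum channel). For positive definite operators $\varrho,\sigma$ and $\alpha>0$ put $$Q_\alpha(\varrho\|\sigma)=\operatorname{Tr}\varrho^\alpha\sigma^{1-\alpha},\qquad Q^*_\alpha(\varrho\|\sigma)=\operatorname{Tr}\bigl(\varrho^{1/2}\sigma^{\frac{1-\alpha}{\alpha}}\varrho^{1/2}\bigr)^\alpha,\qquad Q^\flat_\alpha(\varrho\|\sigma)=\operatorname{Tr}e^{\alpha\log\varrho+(1-\alpha)\log\sigma}$$ (the Petz, sandwiched and $\flat$ versions). For nonzero positive semidefinite $\varrho,\sigma$ and each version $(t)$ put $Q^{(t)}_\alpha(\varrho\|\sigma)=\lim_{\varepsilon\searrow0}Q^{(t)}_\alpha(\varrho+\varepsilon I\|\sigma+\varepsilon I)\in[0,+\infty]$ and, for $\alpha\neq1$, $$D^{(t)}_\alpha(\varrho\|\sigma)=\frac{1}{\alpha-1}\bigl(\log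 Q^{(t)}_\alpha(\varrho\|\sigma)-\log\operatorname{Tr}\varrho\bigr),\qquad \log0=-\infty,\quad\log(+\infty)=+\infty,$$ while for $\alpha=1$, $D^{(t)}_1(\varrho\|\sigma)=D(\varrho\|\sigma)/\operatorname{Tr}\varrho$, where the relative entropy is $D(\varrho\|\sigma)=\operatorname{Tr}\varrho(\log\varrho-\log\sigma)$ if $\operatorname{supp}\varrho\subseteq\operatorname{supp}\sigma$ (logarithms being $0$ on the kernels) and $D(\varrho\|\sigma)=+\infty$ otherwise. Let $\mathcal P_f(\mathcal X)$ be the set of finitely supported probability distributions on $\mathcal X$. For $P\in\mathcal P_f(\mathcal X)$ let $|x\rangle$, $x\in\operatorname{supp}P$, be an orthonormal basis of an auxiliary Hilbert space, and put $$\chi^{(t)}_{\alpha,1}(W,P)=\inf_{\sigma\in\mathcal S(\mathcal H)}D^{(t)}_\alpha\Bigl(\sum_xP(x)|x\rangle\langle x|\otimes W(x)\Big\|\sum_xP(x)|x\rangle\langle x|\otimes\sigma\Bigr),\qquad \chi^{(t)}_{\alpha,2}(W,P)=\inf_{\sigma\in\mathcal S(\mathcal H)}\sum_xP(x)D^{(t)}_\alpha(W(x)\|\sigma),$$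 where the sums run over $x\in\operatorname{supp}P$. Let $$\chi^{(t)}_\alpha(W)=\sup_{P\in\mathcal P_f(\mathcal X)}\chi^{(t)}_{\alpha,1}(W,P),\qquad R^{(t)}_\alpha(W)=\inf_{\sigma\in\mathcal S(\mathcal H)}\sup_{x\in\mathcal X}D^{(t)}_\alpha(W(x)\|\sigma).$$ Infima and suprema are taken in $[-\infty,+\infty]$, with $\sup\emptyset=-\infty$. **Proposition.** For the Petz version with $\alpha\in(0,2]$, for the sandwiched version with $\alpha\in[1/2,+\infty)$, and for the $\flat$ version with $\alpha\in(1,+\infty)$, $$R^{(t)}_\alpha(W)=\sup_{\varepsilon>0}\inf_{\sigma\in\mathcal S(\mathcal H)}\sup_{x\in\mathcal X}D^{(t)}_\alpha(W(x)\|\sigma+\varepsilon I)=\sup_{P\in\mathcal P_f(\mathcal X)}\chi^{(t)}_{\alpha,2}(W,P)=\sup_{P\in\mathcal P_f(\mathcal X)}\chi^{(t)}_{\alpha,1}(W,P)=\chi^{(t)}_\alpha(W).$$ Moreover, for the $\flat$ version and $\alpha\in(0,1)$, $$\sup_{P\in\mathcal P_f(\mathcal X)}\chi^{\flat}_{\alpha,2}(W,P)=\sup_{P\in\mathcal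 P_f(\mathcal X)}\chi^{\flat}_{\alpha,1}(W,P).$$ -/

import Mathlib

open scoped Kronecker ComplexOrder

noncomputable section

/-- The density operators (states) on the finite-dimensional Hilbert space with orthonormal basis
indexed by `n`: positive semidefinite operators of trace one. -/
def DensityMatrix (n : Type*) [Fintype n] : Type _ :=
  {ρ : Matrix n n ℂ // ρ.PosSemidef ∧ ρ.trace = 1}

/-- The underlying matrix of a density operator. -/
def DensityMatrix.mat {n : Type*} [Fintype n] (ρ : DensityMatrix n) : Matrix n n ℂ := ρ.1

/-- The three families of quantum Rényi divergences: Petz type (empty superscript), sandwiched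
(superscript star) and log-Euclidean (superscript flat). -/
inductive RenyiFamily : Type
  | petz : RenyiFamily
  | sandwiched : RenyiFamily
  | flat : RenyiFamily

/-- The real power `A ^ p` of a positive definite operator, by functional calculus. -/
def matPow {n : Type*} [Fintype n] [DecidableEq n] (A : Matrix n n ℂ) (p : ℝ) : Matrix n n ℂ :=
  cfc (fun x : ℝ => x ^ p) A

/-- The logarithm of a positive semidefinite operator, by functional calculus, with the convention
`log 0 = 0` (the convention of `Real.log`) on the kernel. -/
def matLog {n : Type*} [Fintype n] [DecidableEq n] (A : Matrix n n ℂ) : Matrix n n ℂ :=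
  cfc Real.log A

/-- The exponential of a self-adjoint operator, by functional calculus. -/
def matExp {n : Type*} [Fintype n] [DecidableEq n] (A : Matrix n n ℂ) : Matrix n n ℂ :=
  cfc Real.exp A

/-- The quantities `Q_α^{(t)}(ρ‖σ)` for positive definite `ρ` and `σ`:
`Tr ρ^α σ^(1-α)`, `Tr (ρ^(1/2) σ^((1-α)/α) ρ^(1/2))^α` and `Tr exp (α log ρ + (1-α) log σ)`. -/
def renyiQPosDef {n : Type*} [Fintype n] [DecidableEq n] (t : RenyiFamily) (α : ℝ)
    (ρ σ : Matrix n n ℂ) : ℝ :=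
  match t with
  | RenyiFamily.petz => (matPow ρ α * matPow σ (1 - α)).trace.re
  | RenyiFamily.sandwiched =>
      (matPow (matPow ρ (1 / 2) * matPow σ ((1 - α) / α) * matPow ρ (1 / 2)) α).trace.re
  | RenyiFamily.flat => (matExp (α • matLog ρ + (1 - α) • matLog σ)).trace.re

/-- The extension of `Q_α^{(t)}` to positive semidefinite operators,
`Q_α^{(t)}(ρ‖σ) = lim_{ε ↘ 0} Q_α^{(t)}(ρ + ε I‖σ + ε I)`, with values in `[0, +∞]`. -/
def renyiQ {n : Type*} [Fintype n] [DecidableEq n] (t : RenyiFamily) (α : ℝ)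
    (ρ σ : Matrix n n ℂ) : ENNReal :=
  Filter.limUnder (nhdsWithin (0 : ℝ) (Set.Ioi 0)) fun ε : ℝ =>
    ENNReal.ofReal
      (renyiQPosDef t α (ρ + ε • (1 : Matrix n n ℂ)) (σ + ε • (1 : Matrix n n ℂ)))

open scoped Classical in
/-- The relative entropy `D(ρ‖σ) = Tr ρ (log ρ - log σ)` if the support of `ρ` is contained in
the support of `σ`, and `+∞` otherwise. The support of a self-adjoint operator is its range. -/
def relEntropy {n : Type*} [Fintype n] [DecidableEq n] (ρ σ : Matrix n n ℂ) : EReal :=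
  if LinearMap.range ρ.mulVecLin ≤ LinearMap.range σ.mulVecLin then
    (((ρ * (matLog ρ - matLog σ)).trace.re : ℝ) : EReal)
  else ⊤

open scoped Classical in
/-- The quantum Rényi divergence `D_α^{(t)}(ρ‖σ)` of nonzero positive semidefinite operators:
`(log Q_α^{(t)}(ρ‖σ) - log Tr ρ) / (α - 1)` if `α ≠ 1`, and `D(ρ‖σ) / Tr ρ` if `α = 1`.
Here `ENNReal.log` has the values `log 0 = -∞` and `log (+∞) = +∞`. -/
def renyiDiv {n : Type*} [Fintype n] [DecidableEq n] (t : RenyiFamily) (α : ℝ)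
    (ρ σ : Matrix n n ℂ) : EReal :=
  if α = 1 then (((ρ.trace.re)⁻¹ : ℝ) : EReal) * relEntropy ρ σ
  else (((α - 1)⁻¹ : ℝ) : EReal) *
    (ENNReal.log (renyiQ t α ρ σ) - ENNReal.log (ENNReal.ofReal ρ.trace.re))

/-- The finitely supported probability distributions on `X`. -/
def FinProb (X : Type*) : Type _ :=
  {P : X →₀ ℝ // (∀ x, 0 ≤ P x) ∧ P.sum (fun _ p => p) = 1}

/-- The finite support of a finitely supported probability distribution. -/
def FinProb.supp {X : Type*} (P : FinProb X) : Finset X := P.1.support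

/-- The probability `P(x)`. -/
def FinProb.prob {X : Type*} (P : FinProb X) (x : X) : ℝ := P.1 x

open scoped Classical in
/-- The classical state `∑ x, P(x) |x⟩⟨x|` of the input, on the finite-dimensional auxiliary
Hilbert space with orthonormal basis `|x⟩`, where `x` runs over the support of `P`. -/
def inputState {X : Type*} (P : FinProb X) : Matrix P.supp P.supp ℂ :=
  ∑ x : P.supp, (P.prob x) • Matrix.single x x (1 : ℂ)

open scoped Classical in
/-- The classical-quantum state `∑ x, P(x) |x⟩⟨x| ⊗ W(x)`, the output of the lifted channel. -/
def liftedState {X n : Type*} [Fintype n] (W : X → DensityMatrix n) (P : FinProb X) :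
    Matrix (P.supp × n) (P.supp × n) ℂ :=
  ∑ x : P.supp, (P.prob x) • (Matrix.single x x (1 : ℂ) ⊗ₖ (W x).mat)

open scoped Classical in
/-- The generalized Holevo quantity
`χ_{α,1}^{(t)}(W,P) = inf_σ D_α^{(t)}(∑ x, P(x) |x⟩⟨x| ⊗ W(x) ‖ P ⊗ σ)`. -/
def chiOne {X n : Type*} [Fintype n] [DecidableEq n] (t : RenyiFamily) (α : ℝ)
    (W : X → DensityMatrix n) (P : FinProb X) : EReal :=
  ⨅ σ : DensityMatrix n, renyiDiv t α (liftedState W P) (inputState P ⊗ₖ σ.mat)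

/-- The variant `χ_{α,2}^{(t)}(W,P) = inf_σ ∑ x, P(x) D_α^{(t)}(W(x)‖σ)`. -/
def chiTwo {X n : Type*} [Fintype n] [DecidableEq n] (t : RenyiFamily) (α : ℝ)
    (W : X → DensityMatrix n) (P : FinProb X) : EReal :=
  ⨅ σ : DensityMatrix n, ∑ x ∈ P.supp, (P.prob x : EReal) * renyiDiv t α (W x).mat σ.mat

/-- The Rényi capacity `χ_α^{(t)}(W) = sup_P χ_{α,1}^{(t)}(W,P)`. -/
def renyiCapacity {X n : Type*} [Fintype n] [DecidableEq n] (t : RenyiFamily) (α : ℝ)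
    (W : X → DensityMatrix n) : EReal :=
  ⨆ P : FinProb X, chiOne t α W P

/-- The Rényi divergence radius `R_α^{(t)}(W) = inf_σ sup_x D_α^{(t)}(W(x)‖σ)`. -/
def renyiRadius {X n : Type*} [Fintype n] [DecidableEq n] (t : RenyiFamily) (α : ℝ)
    (W : X → DensityMatrix n) : EReal :=
  ⨅ σ : DensityMatrix n, ⨆ x : X, renyiDiv t α (W x).mat σ.mat

end

/-! The proof is a minimax argument. If a real `c` lies below the radius, then every state `σ`
admits some `x` with `D_α(W(x)‖σ) > c`. The divergence at `σ` is a supremum of regularised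
quantities in `σ + εI`, continuous in `σ`, which grow as `ε` decreases. Compactness of the state
space therefore gives one `ε` and finitely many `x` that work for all `σ`. This already yields the
formula with the supremum over `ε`. If the regularised quantities are convex in `σ`, a Hahn–Banach
separation in finite dimension replaces the maximum over these `x` by an average with fixed weights,
that is, by an input distribution `P`.

For `α ≥ 1` the argument runs on `D_α` itself and bounds the radius by `sup χ_{α,2}`. For `α < 1` it
runs on `-Q_α` and bounds the radius by `sup χ_{α,1}`, because the classical-quantum state is a
direct sum and so `χ_{α,1}` is the scaled logarithm of an average of `Q_α`. Jensen's inequality for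
the logarithm orders `χ_{α,1}` and `χ_{α,2}` (its direction depends on the sign of `α - 1`), and an
average is at most a supremum. The chain of inequalities then closes. At `α = 1` the two quantities
coincide.

The analytic input is the behaviour of `Q_α` in `σ`: monotone and concave for `α < 1`
(`renyiQPosDef_mono_right`, `renyiQPosDef_concave`), antitone and log-convex for `α > 1`
(`renyiQPosDef_antitone_right`, `log_renyiQPosDef_convex`). These follow from variational formulas
(Klein, Hölder, Gibbs, Peierls–Bogoliubov), from operator monotonicity and concavity of powers and
of the logarithm, and, for the flat version with `α < 1`, from joint convexity of the relative
entropy. Continuity in `σ` comes from order and scaling alone. Singular operators are handled by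
filling the kernel of `σ` when the supports are nested; for `α > 1` a relative entropy bound shows
`Q_α = +∞` when they are not. -/

/-! ### Functional calculus of Hermitian matrices, intertwining, and Klein's inequality -/

section FunctionalCalculus

set_option linter.unusedSectionVars false

open scoped MatrixOrder Matrix.Norms.L2Operator

variable {n m : Type*} [Fintype n] [DecidableEq n] [Fintype m] [DecidableEq m]

/-- Both spectra are finite, so one interpolation polynomial through the union of the eigenvalues
serves both matrices. Having the same polynomial on both sides is what carries algebraic relations
over to `cfc`. -/
theorem exists_polynomial_cfc_eq {A : Matrix m m ℂ} {B : Matrix n n ℂ} (hA : A.IsHermitian)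
    (hB : B.IsHermitian) (f : ℝ → ℝ) :
    ∃ p : Polynomial ℝ, cfc f A = Polynomial.aeval A p ∧ cfc f B = Polynomial.aeval B p := by
  classical
  let s : Finset ℝ := Finset.univ.image hA.eigenvalues ∪ Finset.univ.image hB.eigenvalues
  have hp : ∀ x ∈ s, (Lagrange.interpolate s id f).eval x = f x := fun x hx => by
    simpa using Lagrange.eval_interpolate_at_node (v := id) f Function.injective_id.injOn hx
  refine ⟨Lagrange.interpolate s id f, ?_, ?_⟩
  · rw [← cfc_polynomial _ A hA]
    refine cfc_congr fun x hx => (hp x ?_).symm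
    rw [hA.spectrum_real_eq_range_eigenvalues] at hx
    obtain ⟨i, rfl⟩ := hx
    simp [s]
  · rw [← cfc_polynomial _ B hB]
    refine cfc_congr fun x hx => (hp x ?_).symm
    rw [hB.spectrum_real_eq_range_eigenvalues] at hx
    obtain ⟨i, rfl⟩ := hx
    simp [s]

/-- Functional calculus preserves intertwining relations. -/
theorem cfc_intertwine {A : Matrix m m ℂ} {B : Matrix n n ℂ} (hA : A.IsHermitian)
    (hB : B.IsHermitian) {X : Matrix m n ℂ} (h : A * X = X * B) (f : ℝ → ℝ) :
    cfc f A * X = X * cfc f B := by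
  obtain ⟨p, hpA, hpB⟩ := exists_polynomial_cfc_eq hA hB f
  rw [hpA, hpB]
  clear hpA hpB
  induction p using Polynomial.induction_on' with
  | add p q hp hq => simp only [map_add, Matrix.add_mul, Matrix.mul_add, hp, hq]
  | monomial k a =>
    have hk : A ^ k * X = X * B ^ k := by
      induction k with
      | zero => simp
      | succ k ih => rw [pow_succ, Matrix.mul_assoc, h, ← Matrix.mul_assoc, ih, Matrix.mul_assoc,
        ← pow_succ]
    simp [Polynomial.aeval_monomial, Algebra.algebraMap_eq_smul_one, hk]

/-- The real part of the trace. -/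
noncomputable def reTrace : Matrix n n ℂ →ₗ[ℝ] ℝ where
  toFun A := A.trace.re
  map_add' A B := by simp
  map_smul' c A := by simp

theorem reTrace_apply (A : Matrix n n ℂ) : reTrace A = A.trace.re := rfl

theorem reTrace_mul_comm (A : Matrix m n ℂ) (B : Matrix n m ℂ) :
    reTrace (A * B) = reTrace (B * A) := by
  rw [reTrace_apply, reTrace_apply, Matrix.trace_mul_comm]

theorem reTrace_one : reTrace (1 : Matrix n n ℂ) = Fintype.card n := by
  simp [reTrace_apply]

theorem reTrace_nonneg {A : Matrix n n ℂ} (hA : 0 ≤ A) : 0 ≤ reTrace A :=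
  (Complex.le_def.1 (Matrix.nonneg_iff_posSemidef.1 hA).trace_nonneg).1

theorem reTrace_mono {A B : Matrix n n ℂ} (h : A ≤ B) : reTrace A ≤ reTrace B := by
  have := reTrace_nonneg (sub_nonneg.2 h)
  rw [map_sub] at this
  linarith

theorem reTrace_mul_nonneg {A B : Matrix n n ℂ} (hA : 0 ≤ A) (hB : 0 ≤ B) :
    0 ≤ reTrace (A * B) := by
  obtain ⟨C, rfl⟩ := CStarAlgebra.nonneg_iff_eq_star_mul_self.1 hA
  rw [mul_assoc, reTrace_mul_comm]
  exact reTrace_nonneg (by simpa [mul_assoc] using star_right_conjugate_nonneg hB C)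

theorem reTrace_mul_mono_right {K A B : Matrix n n ℂ} (hK : 0 ≤ K) (h : A ≤ B) :
    reTrace (K * A) ≤ reTrace (K * B) := by
  have := reTrace_mul_nonneg hK (sub_nonneg.2 h)
  rw [mul_sub, map_sub] at this
  linarith

theorem reTrace_pos {A : Matrix n n ℂ} (hA : 0 ≤ A) (h : A ≠ 0) : 0 < reTrace A := by
  refine lt_of_le_of_ne (reTrace_nonneg hA) fun h0 => h ?_
  have hA' := Matrix.nonneg_iff_posSemidef.1 hA
  rw [← hA'.trace_eq_zero_iff]
  have := Complex.le_def.1 hA'.trace_nonneg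
  exact Complex.ext h0.symm this.2.symm

theorem Matrix.PosDef.smul_one_le [Nonempty n] {A : Matrix n n ℂ} (hA : A.PosDef) :
    ∃ c : ℝ, 0 < c ∧ c • (1 : Matrix n n ℂ) ≤ A := by
  obtain ⟨i, hi⟩ := Finite.exists_min hA.1.eigenvalues
  refine ⟨hA.1.eigenvalues i, hA.eigenvalues_pos i, ?_⟩
  rw [← Algebra.algebraMap_eq_smul_one, algebraMap_le_iff_le_spectrum (ha := hA.1)]
  intro x hx
  rw [hA.1.spectrum_real_eq_range_eigenvalues] at hx
  obtain ⟨j, rfl⟩ := hx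
  exact hi j

theorem reTrace_mul_pos [Nonempty n] {A B : Matrix n n ℂ} (hA : 0 ≤ A) (h0 : A ≠ 0)
    (hB : B.PosDef) : 0 < reTrace (A * B) := by
  obtain ⟨c, hc, hcB⟩ := hB.smul_one_le
  have := reTrace_mul_mono_right hA hcB
  simp only [mul_smul_comm, mul_one, map_smul, smul_eq_mul] at this
  exact lt_of_lt_of_le (mul_pos hc (reTrace_pos hA h0)) this

/-- The squared overlaps of the eigenbases of two Hermitian matrices. -/
noncomputable def eigenOverlap {A B : Matrix n n ℂ} (hA : A.IsHermitian) (hB : B.IsHermitian)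
    (i j : n) : ℝ :=
  Complex.normSq ((star (hA.eigenvectorUnitary : Matrix n n ℂ) * hB.eigenvectorUnitary) i j)

/-- The weights are nonnegative, so every two-variable scalar inequality between sums of products `f
a * g b` becomes a trace inequality. -/
theorem reTrace_cfc_mul_cfc {A B : Matrix n n ℂ} (hA : A.IsHermitian) (hB : B.IsHermitian)
    (f g : ℝ → ℝ) :
    reTrace (cfc f A * cfc g B) = ∑ i, ∑ j, eigenOverlap hA hB i j *
      (f (hA.eigenvalues i) * g (hB.eigenvalues j)) := by
  rw [hA.cfc_eq, hB.cfc_eq, Matrix.IsHermitian.cfc, Matrix.IsHermitian.cfc,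
    Unitary.conjStarAlgAut_apply, Unitary.conjStarAlgAut_apply]
  set U : Matrix n n ℂ := (hA.eigenvectorUnitary : Matrix n n ℂ)
  set V : Matrix n n ℂ := (hB.eigenvectorUnitary : Matrix n n ℂ)
  set D := Matrix.diagonal (RCLike.ofReal (K := ℂ) ∘ f ∘ hA.eigenvalues)
  set E := Matrix.diagonal (RCLike.ofReal (K := ℂ) ∘ g ∘ hB.eigenvalues)
  have : reTrace (U * D * star U * (V * E * star V)) =
      reTrace (D * (star U * V) * E * star (star U * V)) := by
    rw [show U * D * star U * (V * E * star V) = U * (D * star U * (V * E * star V)) by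
      simp only [mul_assoc], reTrace_mul_comm]
    simp only [mul_assoc, star_mul, star_star]
  rw [this, reTrace_apply, Matrix.trace, Complex.re_sum]
  refine Finset.sum_congr rfl fun i _ => ?_
  rw [Matrix.diag_apply, Matrix.mul_apply, Complex.re_sum]
  refine Finset.sum_congr rfl fun j _ => ?_
  rw [Matrix.mul_diagonal, Matrix.diagonal_mul, eigenOverlap, Matrix.star_apply]
  simp only [Function.comp_apply, Complex.normSq_apply]
  simp
  ring

/-- Klein's inequality. -/
theorem reTrace_klein {A B : Matrix n n ℂ} (hA : A.IsHermitian) (hB : B.IsHermitian)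
    (f₁ f₂ f₃ g₁ g₂ g₃ : ℝ → ℝ)
    (h : ∀ a ∈ spectrum ℝ A, ∀ b ∈ spectrum ℝ B, 0 ≤ f₁ a * g₁ b + f₂ a * g₂ b + f₃ a * g₃ b) :
    0 ≤ reTrace (cfc f₁ A * cfc g₁ B) + reTrace (cfc f₂ A * cfc g₂ B) +
      reTrace (cfc f₃ A * cfc g₃ B) := by
  simp_rw [reTrace_cfc_mul_cfc hA hB, ← Finset.sum_add_distrib, ← mul_add]
  exact Finset.sum_nonneg fun i _ => Finset.sum_nonneg fun j _ =>
    mul_nonneg (Complex.normSq_nonneg _)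
      (h _ (hA.eigenvalues_mem_spectrum_real i) _ (hB.eigenvalues_mem_spectrum_real j))

end FunctionalCalculus

/-! ### Matrix powers, logarithms and exponentials; operator monotonicity and concavity -/

section MatrixPowers

set_option linter.unusedSectionVars false

open scoped MatrixOrder

variable {n : Type*} [Fintype n] [DecidableEq n]

theorem Matrix.continuousOn_spectrum (f : ℝ → ℝ) (A : Matrix n n ℂ) :
    ContinuousOn f (spectrum ℝ A) :=
  (Matrix.finite_real_spectrum (A := A)).continuousOn f

theorem Matrix.PosDef.spectrum_pos {A : Matrix n n ℂ} (hA : A.PosDef) {x : ℝ}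
    (hx : x ∈ spectrum ℝ A) : 0 < x := by
  rw [hA.1.spectrum_real_eq_range_eigenvalues] at hx
  obtain ⟨i, rfl⟩ := hx
  exact hA.eigenvalues_pos i

theorem Matrix.spectrum_nonneg {A : Matrix n n ℂ} (hA : 0 ≤ A) {x : ℝ}
    (hx : x ∈ spectrum ℝ A) : 0 ≤ x := spectrum_nonneg_of_nonneg hA hx

theorem Matrix.isHermitian_cfc (f : ℝ → ℝ) (A : Matrix n n ℂ) : (cfc f A).IsHermitian :=
  cfc_predicate f A

theorem Matrix.posDef_cfc {A : Matrix n n ℂ} (hA : A.IsHermitian) {f : ℝ → ℝ}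
    (h : ∀ x ∈ spectrum ℝ A, 0 < f x) : (cfc f A).PosDef := by
  rw [← Matrix.isStrictlyPositive_iff_posDef]
  exact (cfc_isStrictlyPositive_iff f A (A.continuousOn_spectrum f) hA.isSelfAdjoint).2 h

theorem Matrix.PosDef.posDef_of_le {A B : Matrix n n ℂ} (hA : A.PosDef) (h : A ≤ B) :
    B.PosDef := by
  have := hA.add_posSemidef (Matrix.le_iff.1 h)
  rwa [add_sub_cancel] at this

theorem Matrix.PosDef.nonneg {A : Matrix n n ℂ} (hA : A.PosDef) : 0 ≤ A :=
  Matrix.nonneg_iff_posSemidef.2 hA.posSemidef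

theorem Matrix.posDef_add_smul_one {A : Matrix n n ℂ} (hA : 0 ≤ A) {ε : ℝ} (hε : 0 < ε) :
    (A + ε • (1 : Matrix n n ℂ)).PosDef := by
  have h1 : (ε • (1 : Matrix n n ℂ)).PosDef := Matrix.PosDef.one.smul hε
  exact h1.posDef_of_le (le_add_of_nonneg_left hA)

theorem Matrix.cfc_smul_one (f : ℝ → ℝ) (c : ℝ) :
    cfc f (c • (1 : Matrix n n ℂ)) = f c • (1 : Matrix n n ℂ) := by
  rw [← Algebra.algebraMap_eq_smul_one, cfc_algebraMap, Algebra.algebraMap_eq_smul_one]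

theorem matPow_smul_one (c p : ℝ) :
    matPow (c • (1 : Matrix n n ℂ)) p = (c ^ p) • (1 : Matrix n n ℂ) :=
  Matrix.cfc_smul_one _ _

theorem matLog_smul_one (c : ℝ) :
    matLog (c • (1 : Matrix n n ℂ)) = Real.log c • (1 : Matrix n n ℂ) :=
  Matrix.cfc_smul_one _ _

theorem matExp_smul_one (c : ℝ) :
    matExp (c • (1 : Matrix n n ℂ)) = Real.exp c • (1 : Matrix n n ℂ) :=
  Matrix.cfc_smul_one _ _

theorem isHermitian_matPow (A : Matrix n n ℂ) (p : ℝ) : (matPow A p).IsHermitian :=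
  Matrix.isHermitian_cfc _ _

theorem isHermitian_matLog (A : Matrix n n ℂ) : (matLog A).IsHermitian :=
  Matrix.isHermitian_cfc _ _

theorem posDef_matPow {A : Matrix n n ℂ} (hA : A.PosDef) (p : ℝ) : (matPow A p).PosDef :=
  Matrix.posDef_cfc hA.1 fun _ hx => Real.rpow_pos_of_pos (hA.spectrum_pos hx) p

theorem posDef_matExp {A : Matrix n n ℂ} (hA : A.IsHermitian) : (matExp A).PosDef :=
  Matrix.posDef_cfc hA fun _ _ => Real.exp_pos _

theorem matPow_mul_matPow {A : Matrix n n ℂ} (hA : A.PosDef) (p q : ℝ) :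
    matPow A p * matPow A q = matPow A (p + q) := by
  rw [matPow, matPow, matPow, ← cfc_mul _ _ A (A.continuousOn_spectrum _)
    (A.continuousOn_spectrum _)]
  exact cfc_congr fun x hx => (Real.rpow_add (hA.spectrum_pos hx) p q).symm

theorem matPow_zero {A : Matrix n n ℂ} (hA : A.IsHermitian) : matPow A 0 = 1 := by
  simp only [matPow, Real.rpow_zero]
  exact cfc_const_one ℝ A hA

theorem matPow_one {A : Matrix n n ℂ} (hA : A.IsHermitian) : matPow A 1 = A := by
  simp only [matPow, Real.rpow_one]
  exact cfc_id' ℝ A hA.isSelfAdjoint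

theorem matPow_matPow {A : Matrix n n ℂ} (hA : A.PosDef) (p q : ℝ) :
    matPow (matPow A p) q = matPow A (p * q) := by
  rw [matPow, matPow, matPow, ← cfc_comp' _ _ A ?_ (A.continuousOn_spectrum _) hA.1.isSelfAdjoint]
  · exact cfc_congr fun x hx => (Real.rpow_mul (hA.spectrum_pos hx).le p q).symm
  · exact ((Matrix.finite_real_spectrum (A := A)).image _).continuousOn _

theorem matPow_smul {A : Matrix n n ℂ} (hA : A.PosDef) {c : ℝ} (hc : 0 < c) (p : ℝ) :
    matPow (c • A) p = c ^ p • matPow A p := by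
  rw [matPow, matPow, ← cfc_smul _ _ A (A.continuousOn_spectrum _), ← cfc_comp_smul c _ A ?_ hA.1.isSelfAdjoint]
  · exact cfc_congr fun x hx => Real.mul_rpow hc.le (hA.spectrum_pos hx).le
  · exact ((Matrix.finite_real_spectrum (A := A)).image _).continuousOn _

theorem matLog_smul {A : Matrix n n ℂ} (hA : A.PosDef) {c : ℝ} (hc : 0 < c) :
    matLog (c • A) = Real.log c • 1 + matLog A := by
  rw [matLog, matLog, ← Algebra.algebraMap_eq_smul_one,
    ← cfc_const_add _ _ A (A.continuousOn_spectrum _) hA.1.isSelfAdjoint, ← cfc_comp_smul c _ A ?_ hA.1.isSelfAdjoint]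
  · exact cfc_congr fun x hx => Real.log_mul hc.ne' (hA.spectrum_pos hx).ne'
  · exact ((Matrix.finite_real_spectrum (A := A)).image _).continuousOn _

theorem matExp_smul_one_add {A : Matrix n n ℂ} (hA : A.IsHermitian) (c : ℝ) :
    matExp (c • 1 + A) = Real.exp c • matExp A := by
  have h : c • 1 + A = cfc (fun x : ℝ => c + x) A := by
    rw [cfc_const_add c (fun x => x) A (A.continuousOn_spectrum _) hA.isSelfAdjoint, cfc_id' ℝ A hA.isSelfAdjoint,
      Algebra.algebraMap_eq_smul_one]
  rw [h, matExp, matExp, ← cfc_smul _ _ A (A.continuousOn_spectrum _),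
    ← cfc_comp' _ _ A ?_ (A.continuousOn_spectrum _) hA.isSelfAdjoint]
  · exact cfc_congr fun x hx => Real.exp_add c x
  · exact ((Matrix.finite_real_spectrum (A := A)).image _).continuousOn _

theorem matLog_matExp {A : Matrix n n ℂ} (hA : A.IsHermitian) : matLog (matExp A) = A := by
  rw [matLog, matExp, ← cfc_comp' _ _ A ?_ (A.continuousOn_spectrum _) hA.isSelfAdjoint]
  · simpa using cfc_id' ℝ A hA.isSelfAdjoint
  · exact ((Matrix.finite_real_spectrum (A := A)).image _).continuousOn _

open scoped Matrix.Norms.L2Operator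

theorem matPow_eq_rpow {A : Matrix n n ℂ} (hA : 0 ≤ A) (p : ℝ) : matPow A p = A ^ p := by
  rw [CFC.rpow_eq_cfc_real]; rfl

theorem matPow_le_matPow {A B : Matrix n n ℂ} (hA : 0 ≤ A) (h : A ≤ B) {p : ℝ} (hp : 0 ≤ p)
    (hp1 : p ≤ 1) : matPow A p ≤ matPow B p := by
  rw [matPow_eq_rpow hA, matPow_eq_rpow (hA.trans h)]
  exact CFC.monotone_rpow ⟨hp, hp1⟩ h

theorem matPow_concave {A B : Matrix n n ℂ} (hA : 0 ≤ A) (hB : 0 ≤ B) {p : ℝ} (hp : 0 ≤ p)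
    (hp1 : p ≤ 1) {a b : ℝ} (ha : 0 ≤ a) (hb : 0 ≤ b) (hab : a + b = 1) :
    a • matPow A p + b • matPow B p ≤ matPow (a • A + b • B) p := by
  rw [matPow_eq_rpow hA, matPow_eq_rpow hB,
    matPow_eq_rpow (add_nonneg (smul_nonneg ha hA) (smul_nonneg hb hB))]
  exact (CFC.concaveOn_rpow (A := Matrix n n ℂ) ⟨hp, hp1⟩).2 hA hB ha hb hab

theorem matLog_le_matLog {A B : Matrix n n ℂ} (hA : A.PosDef) (h : A ≤ B) :
    matLog A ≤ matLog B :=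
  CFC.log_le_log h hA.isStrictlyPositive

theorem matLog_concave {A B : Matrix n n ℂ} (hA : A.PosDef) (hB : B.PosDef) {a b : ℝ}
    (ha : 0 ≤ a) (hb : 0 ≤ b) (hab : a + b = 1) :
    a • matLog A + b • matLog B ≤ matLog (a • A + b • B) :=
  (CFC.concaveOn_log (A := Matrix n n ℂ)).2 hA.isStrictlyPositive hB.isStrictlyPositive ha hb hab

theorem Matrix.PosDef.convex_combination {A B : Matrix n n ℂ} (hA : A.PosDef) (hB : B.PosDef)
    {a b : ℝ} (ha : 0 ≤ a) (hb : 0 ≤ b) (hab : a + b = 1) : (a • A + b • B).PosDef := by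
  have := (CFC.concaveOn_log (A := Matrix n n ℂ)).1 hA.isStrictlyPositive hB.isStrictlyPositive
    ha hb hab
  exact Matrix.isStrictlyPositive_iff_posDef.1 this

/-- The trace of `f (T T*)` equals the trace of `f (T* T)` for square `T`. -/
theorem reTrace_cfc_mul_star {T : Matrix n n ℂ} (hT : IsUnit T) (f : ℝ → ℝ) :
    reTrace (cfc f (T * star T)) = reTrace (cfc f (star T * T)) := by
  -- `T` intertwines `T* T` with `T T*`; being invertible, it makes the two functional calculi
  -- similar, hence of equal trace.
  have h := cfc_intertwine (A := T * star T) (B := star T * T) (X := T)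
    (IsSelfAdjoint.mul_star_self T) (IsSelfAdjoint.star_mul_self T) (mul_assoc _ _ _) f
  obtain ⟨u, rfl⟩ := hT
  have h2 : cfc f ((u : Matrix n n ℂ) * star (u : Matrix n n ℂ)) =
      u * (cfc f (star (u : Matrix n n ℂ) * u) * (↑u⁻¹ : Matrix n n ℂ)) := by
    rw [← mul_assoc, ← h, mul_assoc, Units.mul_inv, mul_one]
  rw [h2, reTrace_mul_comm, mul_assoc, Units.inv_mul, mul_one]

end MatrixPowers

/-! ### Variational trace inequalities -/

section TraceInequalities

set_option linter.unusedSectionVars false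

open scoped MatrixOrder

variable {n : Type*} [Fintype n] [DecidableEq n]

theorem Matrix.cfc_const_mul_fun (c : ℝ) (A : Matrix n n ℂ) (f : ℝ → ℝ) :
    cfc (fun x => c * f x) A = c • cfc f A :=
  cfc_const_mul c f A (A.continuousOn_spectrum f)

theorem Matrix.cfc_one_fun {A : Matrix n n ℂ} (hA : A.IsHermitian) :
    cfc (fun _ : ℝ => (1 : ℝ)) A = 1 := cfc_const_one ℝ A hA.isSelfAdjoint

theorem Matrix.cfc_id_fun {A : Matrix n n ℂ} (hA : A.IsHermitian) :
    cfc (fun x : ℝ => x) A = A := cfc_id' ℝ A hA.isSelfAdjoint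

theorem Matrix.cfc_const_mul_id {A : Matrix n n ℂ} (hA : A.IsHermitian) (c : ℝ) :
    cfc (fun x : ℝ => c * x) A = c • A := by
  rw [Matrix.cfc_const_mul_fun c A fun x => x, Matrix.cfc_id_fun hA]

theorem Matrix.cfc_mul_fun {A : Matrix n n ℂ} (f g : ℝ → ℝ) :
    cfc (fun x : ℝ => f x * g x) A = cfc f A * cfc g A :=
  cfc_mul f g A (A.continuousOn_spectrum f) (A.continuousOn_spectrum g)

theorem Matrix.cfc_add_fun {A : Matrix n n ℂ} (f g : ℝ → ℝ) :
    cfc (fun x : ℝ => f x + g x) A = cfc f A + cfc g A :=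
  cfc_add A f g (A.continuousOn_spectrum f) (A.continuousOn_spectrum g)

/-- Weighted arithmetic-geometric mean applied to `a * b ^ (α - 1)` and `b ^ α`. Equality holds at
`B = A`, so `Tr A ^ α` is a minimum of functions affine in `A`; monotonicity and concavity arguments
below use this form. -/
theorem reTrace_matPow_le {α : ℝ} (h0 : 0 < α) (h1 : α < 1) {A B : Matrix n n ℂ}
    (hA : A.PosDef) (hB : B.PosDef) :
    reTrace (matPow A α) ≤ α * reTrace (A * matPow B (α - 1)) +
      (1 - α) * reTrace (matPow B α) := by
  have h := reTrace_klein hA.1 hB.1 (fun a => (-1) * a ^ α) (fun a => α * a) (fun _ => 1)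
    (fun _ => 1) (fun b => b ^ (α - 1)) (fun b => (1 - α) * b ^ α) fun a ha b hb => by
      have ha := hA.spectrum_pos ha
      have hb := hB.spectrum_pos hb
      have := Real.geom_mean_le_arith_mean2_weighted (w₁ := α) (w₂ := 1 - α)
        (p₁ := a * b ^ (α - 1)) (p₂ := b ^ α) h0.le (by linarith) (by positivity) (by positivity)
        (by ring)
      rw [Real.mul_rpow ha.le (by positivity), ← Real.rpow_mul hb.le, ← Real.rpow_mul hb.le,
        mul_assoc, ← Real.rpow_add hb, show (α - 1) * α + α * (1 - α) = 0 by ring,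
        Real.rpow_zero] at this
      linarith
  rw [Matrix.cfc_const_mul_id hA.1] at h
  simp only [Matrix.cfc_const_mul_fun, Matrix.cfc_one_fun hA.1, Matrix.cfc_one_fun hB.1,
    mul_one, one_mul, map_smul, smul_eq_mul, smul_mul_assoc] at h
  change 0 ≤ -1 * reTrace (matPow A α) + α * reTrace (A * matPow B (α - 1)) +
    (1 - α) * reTrace (matPow B α) at h
  linarith

/-- Bernoulli's inequality for `(a / b) ^ α`. Equality holds at `B = A`, so `Tr A ^ α` is a maximum
of functions affine in `A`. -/
theorem le_reTrace_matPow {α : ℝ} (h1 : 1 < α) {A B : Matrix n n ℂ}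
    (hA : A.PosDef) (hB : B.PosDef) :
    α * reTrace (A * matPow B (α - 1)) - (α - 1) * reTrace (matPow B α) ≤
      reTrace (matPow A α) := by
  have h := reTrace_klein hA.1 hB.1 (fun a => a ^ α) (fun a => (-α) * a) (fun _ => 1)
    (fun _ => 1) (fun b => b ^ (α - 1)) (fun b => (α - 1) * b ^ α) fun a ha b hb => by
      have ha := hA.spectrum_pos ha
      have hb := hB.spectrum_pos hb
      have := one_add_mul_self_le_rpow_one_add (s := a / b - 1)
        (by have := div_pos ha hb; linarith) h1.le
      rw [add_sub_cancel, Real.div_rpow ha.le hb.le, le_div_iff₀ (by positivity)] at this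
      have hb2 : b ^ α = b ^ (α - 1) * b := by
        rw [← Real.rpow_add_one hb.ne']; ring_nf
      have e : (1 + α * (a / b - 1)) * b ^ α = α * a * b ^ (α - 1) - (α - 1) * b ^ α := by
        rw [hb2]; field_simp; ring
      rw [e] at this
      linarith
  rw [Matrix.cfc_const_mul_id hA.1] at h
  simp only [Matrix.cfc_const_mul_fun, Matrix.cfc_one_fun hA.1, Matrix.cfc_one_fun hB.1,
    mul_one, one_mul, map_smul, smul_eq_mul, smul_mul_assoc] at h
  change 0 ≤ reTrace (matPow A α) + -α * reTrace (A * matPow B (α - 1)) +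
    (α - 1) * reTrace (matPow B α) at h
  linarith

/-- Multiplicative (Hölder) form of the variational bound for `Tr A ^ α`, `α > 1`. -/
theorem log_le_log_reTrace_matPow [Nonempty n] {α : ℝ} (h1 : 1 < α) {A B : Matrix n n ℂ}
    (hA : A.PosDef) (hB : B.PosDef) :
    α * Real.log (reTrace (A * matPow B (α - 1))) - (α - 1) * Real.log (reTrace (matPow B α)) ≤
      Real.log (reTrace (matPow A α)) := by
  set u := reTrace (A * matPow B (α - 1)) with hu
  set v := reTrace (matPow B α) with hv
  have hu0 : 0 < u := reTrace_mul_pos hA.nonneg hA.isUnit.ne_zero (posDef_matPow hB _)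
  have hv0 : 0 < v := reTrace_pos (posDef_matPow hB _).nonneg (posDef_matPow hB _).isUnit.ne_zero
  -- Rescaling `B` by `c` turns the affine bound into `α c^(α-1) u - (α-1) c^α v`, which is largest
  -- at `c = u / v`.
  have hc : 0 < u / v := div_pos hu0 hv0
  have h := le_reTrace_matPow h1 hA (hB.smul hc)
  rw [matPow_smul hB hc, matPow_smul hB hc, mul_smul_comm, map_smul, map_smul, smul_eq_mul,
    smul_eq_mul, ← hu, ← hv] at h
  have e : α * ((u / v) ^ (α - 1) * u) - (α - 1) * ((u / v) ^ α * v) =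
      (u / v) ^ (α - 1) * u := by
    have : (u / v) ^ α = (u / v) ^ (α - 1) * (u / v) := by
      rw [← Real.rpow_add_one hc.ne']; ring_nf
    rw [this]; field_simp; ring
  rw [e] at h
  have h2 := Real.log_le_log (by positivity) h
  rw [Real.log_mul (by positivity) hu0.ne', Real.log_rpow hc, Real.log_div hu0.ne' hv0.ne'] at h2
  linarith

theorem reTrace_mul_matLog {T : Matrix n n ℂ} (hT : T.IsHermitian) :
    reTrace (T * matLog T) = reTrace (cfc (fun t : ℝ => t * Real.log t) T) := by
  rw [Matrix.cfc_mul_fun (fun t => t) Real.log, Matrix.cfc_id_fun hT, matLog]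

/-- Gibbs variational principle. -/
theorem le_reTrace_matExp {K T : Matrix n n ℂ} (hK : K.IsHermitian) (hT : T.PosDef) :
    reTrace T + reTrace (T * K) - reTrace (T * matLog T) ≤ reTrace (matExp K) := by
  -- The scalar inequality is `e^k - t k + t log t - t ≥ 0`, that is, `e^y ≥ 1 + y` at `y = k - log
  -- t`, multiplied by `t`.
  have h := reTrace_klein hT.1 hK (fun _ => 1) (fun t => (-1) * t)
    (fun t => t * Real.log t + (-1) * t)
    Real.exp (fun k => k) (fun _ => 1) fun t ht k hk => by
      have ht := hT.spectrum_pos ht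
      have := Real.add_one_le_exp (k - Real.log t)
      rw [Real.exp_sub, Real.exp_log ht, le_div_iff₀ ht] at this
      linarith
  rw [Matrix.cfc_add_fun (fun t => t * Real.log t)] at h
  rw [Matrix.cfc_const_mul_id hT.1] at h
  simp only [Matrix.cfc_one_fun hT.1, Matrix.cfc_one_fun hK,
    Matrix.cfc_id_fun hK, mul_one, one_mul, map_smul, smul_eq_mul,
    smul_mul_assoc, map_add, ← reTrace_mul_matLog hT.1] at h
  change 0 ≤ reTrace (matExp K) + _ + _ at h
  linarith

/-- The Peierls–Bogoliubov inequality. -/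
theorem peierls_bogoliubov [Nonempty n] {K K' : Matrix n n ℂ} (hK : K.IsHermitian)
    (hK' : K'.IsHermitian) :
    reTrace (matExp K * (K' - K)) / reTrace (matExp K) ≤
      Real.log (reTrace (matExp K')) - Real.log (reTrace (matExp K)) := by
  set Z := reTrace (matExp K) with hZ
  set u := reTrace (matExp K * (K' - K)) with hu
  have hZ0 : 0 < Z := reTrace_pos (posDef_matExp hK).nonneg (posDef_matExp hK).isUnit.ne_zero
  -- The trial operator in the Gibbs principle is `c • matExp K`; the bound is maximal at `log c = u
  -- / Z`, where it equals `c Z`.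
  have hc := Real.exp_pos (u / Z)
  have h := le_reTrace_matExp hK' ((posDef_matExp hK).smul hc)
  rw [matLog_smul (posDef_matExp hK) hc, matLog_matExp hK, Real.log_exp] at h
  simp only [smul_mul_assoc, mul_add, mul_smul_comm, map_add, map_smul, smul_eq_mul, mul_one,
    ← hZ] at h
  have hu' : u = reTrace (matExp K * K') - reTrace (matExp K * K) := by rw [hu, mul_sub, map_sub]
  have e : Real.exp (u / Z) * Z ≤ reTrace (matExp K') := by
    refine le_trans (le_of_eq ?_) h
    have : u / Z * Z = u := div_mul_cancel₀ _ hZ0.ne'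
    linear_combination Real.exp (u / Z) * (this + hu')
  have h2 := Real.log_le_log (by positivity) e
  rw [Real.log_mul hc.ne' hZ0.ne', Real.log_exp] at h2
  linarith

theorem reTrace_matExp_mono [Nonempty n] {K K' : Matrix n n ℂ} (hK : K.IsHermitian)
    (hK' : K'.IsHermitian) (h : K ≤ K') : reTrace (matExp K) ≤ reTrace (matExp K') := by
  have h1 := peierls_bogoliubov hK hK'
  have hp := posDef_matExp hK
  have hp' := posDef_matExp hK'
  have h2 : 0 ≤ reTrace (matExp K * (K' - K)) / reTrace (matExp K) :=
    div_nonneg (reTrace_mul_nonneg hp.nonneg (sub_nonneg.2 h)) (reTrace_nonneg hp.nonneg)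
  refine (Real.log_le_log_iff (reTrace_pos hp.nonneg hp.isUnit.ne_zero)
    (reTrace_pos hp'.nonneg hp'.isUnit.ne_zero)).1 (by linarith)

/-- Expand `(X⁻¹ - Y) X (X⁻¹ - Y) ≥ 0`. Since `Y = X⁻¹` gives equality, the inverse is a maximum of
expressions affine in `X`. -/
theorem two_smul_sub_le_matPow_neg_one {X Y : Matrix n n ℂ} (hX : X.PosDef) (hY : Y.IsHermitian) :
    (2 : ℝ) • Y - Y * X * Y ≤ matPow X (-1) := by
  have h1 : matPow X (-1) * X = 1 := by
    conv_lhs => rw [← matPow_one hX.1, matPow_matPow hX, matPow_mul_matPow hX]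
    norm_num [matPow_zero hX.1]
  have h2 : X * matPow X (-1) = 1 := by
    conv_lhs => rw [← matPow_one hX.1, matPow_matPow hX, matPow_mul_matPow hX]
    norm_num [matPow_zero hX.1]
  have h := star_right_conjugate_nonneg hX.nonneg (matPow X (-1) - Y)
  have hs : star (matPow X (-1) - Y) = matPow X (-1) - Y :=
    (isHermitian_matPow X (-1)).sub hY
  have e : (matPow X (-1) - Y) * X * (matPow X (-1) - Y) =
      matPow X (-1) - ((2 : ℝ) • Y - Y * X * Y) := by
    rw [sub_mul, h1, mul_sub, sub_mul, sub_mul, one_mul, one_mul, mul_assoc Y X, h2, mul_one,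
      two_smul]
    abel
  rw [hs, e] at h
  exact sub_nonneg.1 h

theorem matPow_neg_eq {A : Matrix n n ℂ} (hA : A.PosDef) (s : ℝ) :
    matPow A (-s) = matPow (matPow A s) (-1) := by
  rw [matPow_matPow hA]; simp

/-- Test the bound for the inverse of `A ^ s` with `Y = B ^ (-s)`: since `A ^ s ≤ B ^ s`, the term
`Y A^s Y` is at most `Y B^s Y = Y`. -/
theorem matPow_neg_antitone {A B : Matrix n n ℂ} (hA : A.PosDef) (h : A ≤ B) {s : ℝ}
    (h0 : 0 ≤ s) (h1 : s ≤ 1) : matPow B (-s) ≤ matPow A (-s) := by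
  have hB := hA.posDef_of_le h
  have h2 := two_smul_sub_le_matPow_neg_one (posDef_matPow hA s) (isHermitian_matPow B (-s))
  rw [← matPow_neg_eq hA] at h2
  have h3 := star_right_conjugate_le_conjugate (matPow_le_matPow hA.nonneg h h0 h1)
    (matPow B (-s))
  have hs : star (matPow B (-s)) = matPow B (-s) := isHermitian_matPow B (-s)
  rw [hs, matPow_mul_matPow hB, matPow_mul_matPow hB] at h3
  simp only [neg_add_cancel, zero_add] at h3
  refine le_trans ?_ h2
  rw [two_smul, add_sub_assoc]
  exact le_add_of_nonneg_right (sub_nonneg.2 h3)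

/-- Log-convexity of `A ↦ Tr K A ^ (-s)` for `0 ≤ s ≤ 1`. -/
theorem log_reTrace_mul_matPow_neg_convex [Nonempty n] {K A B : Matrix n n ℂ} (hK : 0 ≤ K)
    (hK0 : K ≠ 0) (hA : A.PosDef) (hB : B.PosDef) {s : ℝ} (h0 : 0 ≤ s) (h1 : s ≤ 1) {a b : ℝ}
    (ha : 0 ≤ a) (hb : 0 ≤ b) (hab : a + b = 1) :
    Real.log (reTrace (K * matPow (a • A + b • B) (-s))) ≤
      a * Real.log (reTrace (K * matPow A (-s))) + b * Real.log (reTrace (K * matPow B (-s))) := by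
  have hC := hA.convex_combination hB ha hb hab
  set C := a • A + b • B with hCdef
  set Y := matPow C (-s) with hY
  have hYp : Y.PosDef := posDef_matPow hC _
  set t := reTrace (K * Y) with ht
  have ht0 : 0 < t := reTrace_mul_pos hK hK0 hYp
  have hs : star Y = Y := hYp.1
  set K' := Y * K * Y with hK'
  have hK'p : 0 ≤ K' := by simpa [hs] using star_right_conjugate_nonneg hK Y
  have hK'0 : K' ≠ 0 := by
    intro h
    apply hK0
    have := hYp.isUnit.mul_left_eq_zero.1 h
    exact hYp.isUnit.mul_right_eq_zero.1 this
  -- Testing the inverse of `D ^ s` with `r • Y` gives `2 r t - r² w`, maximal at `r = t / w` with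
  -- value `t² / w`. Optimising over `r` is what gives convexity of the logarithm rather than mere
  -- convexity.
  have key : ∀ D : Matrix n n ℂ, D.PosDef → 2 * Real.log t - Real.log (reTrace (K' * matPow D s)) ≤
      Real.log (reTrace (K * matPow D (-s))) := by
    intro D hD
    set w := reTrace (K' * matPow D s) with hw
    have hw0 : 0 < w := reTrace_mul_pos hK'p hK'0 (posDef_matPow hD s)
    have h2 := reTrace_mul_mono_right hK (two_smul_sub_le_matPow_neg_one (posDef_matPow hD s)
      (hYp.smul (div_pos ht0 hw0)).1)
    rw [← matPow_neg_eq hD] at h2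
    have e : reTrace (K * (Y * matPow D s * Y)) = w := by
      rw [hw, hK', ← mul_assoc, reTrace_mul_comm, ← mul_assoc, ← mul_assoc]
    simp only [mul_sub, mul_smul_comm, smul_mul_assoc, map_sub, map_smul, smul_eq_mul, e,
      ← ht] at h2
    have h3 : t ^ 2 / w ≤ reTrace (K * matPow D (-s)) := by
      refine le_trans (le_of_eq ?_) h2
      field_simp; ring
    have h4 := Real.log_le_log (by positivity) h3
    rwa [Real.log_div (by positivity) hw0.ne', Real.log_pow, Nat.cast_ofNat] at h4
  have hA1 := key A hA
  have hB1 := key B hB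
  set u := reTrace (K' * matPow A s)
  set v := reTrace (K' * matPow B s)
  have hu0 : 0 < u := reTrace_mul_pos hK'p hK'0 (posDef_matPow hA s)
  have hv0 : 0 < v := reTrace_mul_pos hK'p hK'0 (posDef_matPow hB s)
  -- At `D = C` the quantity `w` would be `t` itself, because `C^(-s) C^s C^(-s) = C^(-s)`;
  -- concavity of the power `s` compares the mixture with it.
  have h5 : a * u + b * v ≤ t := by
    have := reTrace_mul_mono_right hK'p
      (matPow_concave hA.nonneg hB.nonneg h0 h1 ha hb hab)
    rw [mul_add, mul_smul_comm, mul_smul_comm, map_add, map_smul, map_smul] at this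
    refine this.trans (le_of_eq ?_)
    rw [ht, hK', mul_assoc, hY, matPow_mul_matPow hC, neg_add_cancel, matPow_zero hC.1, mul_one,
      reTrace_mul_comm]
  have h6 : a * Real.log u + b * Real.log v ≤ Real.log t := by
    have := strictConcaveOn_log_Ioi.concaveOn.2 hu0 hv0 ha hb hab
    simp only [smul_eq_mul] at this
    refine this.trans (Real.log_le_log ?_ h5)
    rcases ha.eq_or_lt with rfl | ha'
    · have : b = 1 := by linarith
      simp [this, hv0]
    · have := mul_pos ha' hu0
      have := mul_nonneg hb hv0.le
      linarith
  have h7 := mul_le_mul_of_nonneg_left hA1 ha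
  have h8 := mul_le_mul_of_nonneg_left hB1 hb
  have h9 : Real.log t = a * Real.log t + b * Real.log t := by rw [← add_mul, hab, one_mul]
  linarith

end TraceInequalities

/-! ### Joint convexity of the relative entropy through resolvents -/

section JointConvexity

set_option linter.unusedSectionVars false

open scoped MatrixOrder

variable {n : Type*} [Fintype n] [DecidableEq n]

/-- The linear functional of `(τ, σ)` whose supremum over `X` is `∑ t² / (s + l t)`. -/
noncomputable def resolventForm (X τ σ : Matrix n n ℂ) (l : ℝ) : ℝ :=
  2 * reTrace (star X * τ) - reTrace (X * σ * star X) - l * reTrace (star X * τ * X)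

/-- The resolvent term in the integral representation of the relative entropy. -/
noncomputable def resolventSum {τ σ : Matrix n n ℂ} (hτ : τ.IsHermitian) (hσ : σ.IsHermitian)
    (l : ℝ) : ℝ :=
  ∑ i, ∑ j, eigenOverlap hτ hσ i j *
    (hτ.eigenvalues i ^ 2 / (hσ.eigenvalues j + l * hτ.eigenvalues i))

/-- In the coordinates given by the two eigenbases the form decouples into one scalar quadratic for
each matrix entry. -/
theorem resolventForm_eq {τ σ : Matrix n n ℂ} (hτ : τ.IsHermitian) (hσ : σ.IsHermitian) (l : ℝ)
    (x : Matrix n n ℂ) :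
    resolventForm ((hτ.eigenvectorUnitary : Matrix n n ℂ) * x *
      star (hσ.eigenvectorUnitary : Matrix n n ℂ)) τ σ l =
    ∑ i, ∑ j, (2 * hτ.eigenvalues i * (star (x i j) *
      (star (hτ.eigenvectorUnitary : Matrix n n ℂ) * hσ.eigenvectorUnitary) i j).re
      - (hσ.eigenvalues j + l * hτ.eigenvalues i) * Complex.normSq (x i j)) := by
  have e1 := hτ.spectral_theorem
  have e2 := hσ.spectral_theorem
  rw [Unitary.conjStarAlgAut_apply] at e1 e2
  have hU := Unitary.coe_star_mul_self hτ.eigenvectorUnitary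
  have hV := Unitary.coe_star_mul_self hσ.eigenvectorUnitary
  set U : Matrix n n ℂ := (hτ.eigenvectorUnitary : Matrix n n ℂ)
  set V : Matrix n n ℂ := (hσ.eigenvectorUnitary : Matrix n n ℂ)
  set D := Matrix.diagonal (RCLike.ofReal (K := ℂ) ∘ hτ.eigenvalues) with hD
  set E := Matrix.diagonal (RCLike.ofReal (K := ℂ) ∘ hσ.eigenvalues) with hE
  have h1 : reTrace (star (U * x * star V) * τ) = reTrace (star x * D * (star U * V)) := by
    rw [e1, reTrace_apply, reTrace_apply]
    congr 1
    rw [star_mul, star_mul, star_star, Matrix.trace_mul_comm (star x * D)]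
    calc (V * (star x * star U) * (U * D * star U)).trace
        = (V * star x * (star U * U) * D * star U).trace := by simp only [mul_assoc]
      _ = (star U * (V * star x * D)).trace := by
          rw [hU, mul_one, Matrix.trace_mul_comm (star U)]
      _ = _ := by simp only [mul_assoc]
  have h2 : reTrace (U * x * star V * σ * star (U * x * star V)) = reTrace (star x * x * E) := by
    rw [e2, reTrace_apply, reTrace_apply]
    congr 1
    rw [star_mul, star_mul, star_star]
    calc (U * x * star V * (V * E * star V) * (V * (star x * star U))).trace
        = (U * (x * (star V * V) * E * (star V * V) * star x * star U)).trace := by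
          simp only [mul_assoc]
      _ = (x * E * star x * (star U * U)).trace := by
          rw [hV, Matrix.trace_mul_comm U]; simp only [mul_assoc, mul_one]
      _ = _ := by rw [hU, mul_one, Matrix.trace_mul_comm, ← mul_assoc]
  have h3 : reTrace (star (U * x * star V) * τ * (U * x * star V)) = reTrace (star x * D * x) := by
    rw [e1, reTrace_apply, reTrace_apply]
    congr 1
    rw [star_mul, star_mul, star_star]
    calc (V * (star x * star U) * (U * D * star U) * (U * x * star V)).trace
        = (V * (star x * (star U * U) * D * (star U * U) * x * star V)).trace := by
          simp only [mul_assoc]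
      _ = (star x * D * x * (star V * V)).trace := by
          rw [hU, Matrix.trace_mul_comm V]; simp only [mul_assoc, mul_one]
      _ = _ := by rw [hV, mul_one]
  rw [resolventForm, h1, h2, h3]
  have t1 : reTrace (star x * D * (star U * V)) =
      ∑ i, ∑ j, hτ.eigenvalues i * (star (x i j) * (star U * V) i j).re := by
    rw [mul_assoc, reTrace_mul_comm, reTrace_apply, Matrix.trace, Complex.re_sum]
    refine Finset.sum_congr rfl fun i _ => ?_
    rw [Matrix.diag_apply, Matrix.mul_apply, Complex.re_sum]
    refine Finset.sum_congr rfl fun j _ => ?_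
    rw [hD, Matrix.diagonal_mul, Matrix.star_apply]
    simp
    ring
  have t2 : reTrace (star x * x * E) = ∑ i, ∑ j, hσ.eigenvalues j * Complex.normSq (x i j) := by
    rw [mul_assoc, reTrace_mul_comm, reTrace_apply, Matrix.trace, Complex.re_sum]
    refine Finset.sum_congr rfl fun i _ => ?_
    rw [Matrix.diag_apply, Matrix.mul_apply, Complex.re_sum]
    refine Finset.sum_congr rfl fun j _ => ?_
    rw [hE, Matrix.mul_diagonal, Matrix.star_apply, Complex.normSq_apply]
    simp
    ring
  have t3 : reTrace (star x * D * x) = ∑ i, ∑ j, hτ.eigenvalues i * Complex.normSq (x i j) := by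
    rw [mul_assoc, reTrace_mul_comm, reTrace_apply, Matrix.trace, Complex.re_sum]
    refine Finset.sum_congr rfl fun i _ => ?_
    rw [Matrix.diag_apply, Matrix.mul_apply, Complex.re_sum]
    refine Finset.sum_congr rfl fun j _ => ?_
    rw [hD, Matrix.diagonal_mul, Matrix.star_apply, Complex.normSq_apply]
    simp
    ring
  rw [t1, t2, t3]
  simp only [Finset.mul_sum, ← Finset.sum_sub_distrib]
  refine Finset.sum_congr rfl fun i _ => Finset.sum_congr rfl fun j _ => ?_
  ring

/-- Complete the square entrywise: the defect is `|(s + l t) x - t m|² / (s + l t)`. -/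
theorem resolventForm_le {τ σ : Matrix n n ℂ} (hτ : τ.PosDef) (hσ : σ.PosDef) {l : ℝ}
    (hl : 0 ≤ l) (X : Matrix n n ℂ) :
    resolventForm X τ σ l ≤ resolventSum hτ.1 hσ.1 l := by
  have hU := Unitary.mul_star_self_of_mem hτ.1.eigenvectorUnitary.2
  have hV := Unitary.mul_star_self_of_mem hσ.1.eigenvectorUnitary.2
  set U : Matrix n n ℂ := (hτ.1.eigenvectorUnitary : Matrix n n ℂ) with hUd
  set V : Matrix n n ℂ := (hσ.1.eigenvectorUnitary : Matrix n n ℂ) with hVd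
  have hX : X = U * (star U * X * V) * star V := by
    calc X = (U * star U) * X * (V * star V) := by rw [hU, hV, one_mul, mul_one]
      _ = _ := by simp only [mul_assoc]
  rw [hX, hUd, hVd, resolventForm_eq, resolventSum]
  refine Finset.sum_le_sum fun i _ => Finset.sum_le_sum fun j _ => ?_
  rw [eigenOverlap]
  set t := hτ.1.eigenvalues i with ht
  set s := hσ.1.eigenvalues j with hs
  generalize (star U * X * V) i j = x
  generalize (star U * V) i j = m
  have ht0 : 0 < t := hτ.eigenvalues_pos i
  have hs0 : 0 < s := hσ.eigenvalues_pos j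
  have hd : 0 < s + l * t := by positivity
  have h := Complex.normSq_nonneg ((s + l * t : ℝ) * x - (t : ℝ) * m)
  rw [← sub_nonneg]
  have e : Complex.normSq m * (t ^ 2 / (s + l * t)) - (2 * t * (star x * m).re -
      (s + l * t) * Complex.normSq x) =
      Complex.normSq ((s + l * t : ℝ) * x - (t : ℝ) * m) / (s + l * t) := by
    rw [eq_div_iff hd.ne']
    simp only [Complex.normSq_apply, Complex.sub_re, Complex.sub_im, Complex.ofReal_re, Complex.ofReal_im,
      Complex.mul_im, Complex.mul_re, Complex.star_def, Complex.conj_re, Complex.conj_im]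
    field_simp
    ring
  rw [e]
  positivity

theorem exists_resolventForm_eq {τ σ : Matrix n n ℂ} (hτ : τ.PosDef) (hσ : σ.PosDef) {l : ℝ}
    (hl : 0 ≤ l) : ∃ X, resolventForm X τ σ l = resolventSum hτ.1 hσ.1 l := by
  -- The maximiser has entries `t m / (s + l t)`, where every completed square vanishes.
  refine ⟨_, (resolventForm_eq hτ.1 hσ.1 l (Matrix.of fun i j =>
    ((hτ.1.eigenvalues i / (hσ.1.eigenvalues j + l * hτ.1.eigenvalues i) : ℝ) : ℂ) *
      (star (hτ.1.eigenvectorUnitary : Matrix n n ℂ) * hσ.1.eigenvectorUnitary) i j)).trans ?_⟩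
  rw [resolventSum]
  refine Finset.sum_congr rfl fun i _ => Finset.sum_congr rfl fun j _ => ?_
  rw [eigenOverlap, Matrix.of_apply]
  have ht0 := hτ.eigenvalues_pos i
  have hs0 := hσ.eigenvalues_pos j
  generalize hτ.1.eigenvalues i = t at *
  generalize hσ.1.eigenvalues j = s at *
  generalize (star (hτ.1.eigenvectorUnitary : Matrix n n ℂ) *
    (hσ.1.eigenvectorUnitary : Matrix n n ℂ)) i j = m
  have hd : 0 < s + l * t := by positivity
  simp only [Complex.normSq_apply, Complex.ofReal_re, Complex.ofReal_im,
      Complex.mul_im, Complex.mul_re, Complex.star_def, Complex.conj_re, Complex.conj_im]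
  field_simp
  ring

/-- A maximum of functions linear in the pair `(τ, σ)` is jointly convex: take the `X` that is
optimal for the mixture and use it at both endpoints. -/
theorem resolventSum_convex {τ₁ σ₁ τ₂ σ₂ : Matrix n n ℂ} (hτ₁ : τ₁.PosDef) (hσ₁ : σ₁.PosDef)
    (hτ₂ : τ₂.PosDef) (hσ₂ : σ₂.PosDef) {a b : ℝ} (ha : 0 ≤ a) (hb : 0 ≤ b) (hab : a + b = 1)
    {l : ℝ} (hl : 0 ≤ l) :
    resolventSum (hτ₁.convex_combination hτ₂ ha hb hab).1
      (hσ₁.convex_combination hσ₂ ha hb hab).1 l ≤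
    a * resolventSum hτ₁.1 hσ₁.1 l + b * resolventSum hτ₂.1 hσ₂.1 l := by
  obtain ⟨X, hX⟩ := exists_resolventForm_eq (hτ₁.convex_combination hτ₂ ha hb hab)
    (hσ₁.convex_combination hσ₂ ha hb hab) hl
  rw [← hX]
  refine le_trans (le_of_eq ?_) (add_le_add
    (mul_le_mul_of_nonneg_left (resolventForm_le hτ₁ hσ₁ hl X) ha)
    (mul_le_mul_of_nonneg_left (resolventForm_le hτ₂ hσ₂ hl X) hb))
  simp only [resolventForm, mul_add, add_mul, mul_smul_comm, smul_mul_assoc, map_add, map_smul,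
    smul_eq_mul]
  ring

/-- The truncated relative entropy obtained by integrating the resolvent terms. -/
noncomputable def truncatedEntropy {τ σ : Matrix n n ℂ} (hτ : τ.IsHermitian) (hσ : σ.IsHermitian)
    (l : ℝ) : ℝ :=
  ∑ i, ∑ j, eigenOverlap hτ hσ i j * (hτ.eigenvalues i *
    (Real.log (hσ.eigenvalues j + l * hτ.eigenvalues i) - Real.log (hσ.eigenvalues j)))

theorem hasDerivAt_truncatedEntropy {τ σ : Matrix n n ℂ} (hτ : τ.PosDef) (hσ : σ.PosDef)
    {l : ℝ} (hl : 0 ≤ l) :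
    HasDerivAt (truncatedEntropy hτ.1 hσ.1) (resolventSum hτ.1 hσ.1 l) l := by
  unfold truncatedEntropy resolventSum
  refine HasDerivAt.fun_sum fun i _ => HasDerivAt.fun_sum fun j _ => HasDerivAt.const_mul _ ?_
  have ht0 := hτ.eigenvalues_pos i
  have hs0 := hσ.eigenvalues_pos j
  generalize hτ.1.eigenvalues i = t at *
  generalize hσ.1.eigenvalues j = s at *
  have hd : 0 < s + l * t := by positivity
  have h := ((((hasDerivAt_id l).mul_const t).const_add s).log hd.ne').sub_const (Real.log s)
  have h2 := h.const_mul t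
  refine h2.congr_deriv ?_
  simp only [one_mul, id]
  ring

/-- The convexity defect vanishes at `l = 0`, and its derivative in `l` is the nonnegative convexity
defect of the resolvent sums. -/
theorem truncatedEntropy_convex {τ₁ σ₁ τ₂ σ₂ : Matrix n n ℂ} (hτ₁ : τ₁.PosDef) (hσ₁ : σ₁.PosDef)
    (hτ₂ : τ₂.PosDef) (hσ₂ : σ₂.PosDef) {a b : ℝ} (ha : 0 ≤ a) (hb : 0 ≤ b) (hab : a + b = 1)
    {l : ℝ} (hl : 0 ≤ l) :
    truncatedEntropy (hτ₁.convex_combination hτ₂ ha hb hab).1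
      (hσ₁.convex_combination hσ₂ ha hb hab).1 l ≤
    a * truncatedEntropy hτ₁.1 hσ₁.1 l + b * truncatedEntropy hτ₂.1 hσ₂.1 l := by
  have hder := fun (x : ℝ) (hx : 0 ≤ x) =>
    (((hasDerivAt_truncatedEntropy hτ₁ hσ₁ hx).const_mul a).add
      ((hasDerivAt_truncatedEntropy hτ₂ hσ₂ hx).const_mul b)).sub
      (hasDerivAt_truncatedEntropy (hτ₁.convex_combination hτ₂ ha hb hab)
        (hσ₁.convex_combination hσ₂ ha hb hab) hx)
  have hmono := monotoneOn_of_deriv_nonneg (convex_Ici (0 : ℝ))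
    (fun x hx => (hder x hx).continuousAt.continuousWithinAt)
    (fun x hx => by
      rw [interior_Ici] at hx
      exact (hder x hx.le).differentiableAt.differentiableWithinAt)
    (fun x hx => by
      rw [interior_Ici] at hx
      rw [(hder x hx.le).deriv]
      exact sub_nonneg.2 (resolventSum_convex hτ₁ hσ₁ hτ₂ hσ₂ ha hb hab hx.le))
  have h := hmono (Set.mem_Ici.2 le_rfl) hl hl
  simp only [Pi.sub_apply, Pi.add_apply, truncatedEntropy, zero_mul, add_zero, sub_self, mul_zero,
    Finset.sum_const_zero] at h
  simp only [truncatedEntropy]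
  linarith

/-- The relative entropy of positive definite matrices. -/
noncomputable def relEntropyPosDef (τ σ : Matrix n n ℂ) : ℝ :=
  reTrace (τ * matLog τ) - reTrace (τ * matLog σ)

/-- Write `log (s + l t) = log l + log (t + s / l)`. The diverging part is `log l` times `Tr τ`,
linear in `τ`, so subtracting it does not disturb convexity. -/
theorem tendsto_truncatedEntropy {τ σ : Matrix n n ℂ} (hτ : τ.PosDef) (hσ : σ.PosDef) :
    Filter.Tendsto (fun l : ℝ => truncatedEntropy hτ.1 hσ.1 l - Real.log l * reTrace τ)
      Filter.atTop (nhds (relEntropyPosDef τ σ)) := by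
  have e1 : reTrace τ = ∑ i, ∑ j, eigenOverlap hτ.1 hσ.1 i j * hτ.1.eigenvalues i := by
    have := reTrace_cfc_mul_cfc hτ.1 hσ.1 (fun x => x) (fun _ => 1)
    simpa only [Matrix.cfc_id_fun hτ.1, Matrix.cfc_one_fun hσ.1, mul_one] using this
  have e2 : relEntropyPosDef τ σ = ∑ i, ∑ j, eigenOverlap hτ.1 hσ.1 i j * (hτ.1.eigenvalues i *
      (Real.log (hτ.1.eigenvalues i) - Real.log (hσ.1.eigenvalues j))) := by
    have h1 := reTrace_cfc_mul_cfc hτ.1 hσ.1 (fun x => x * Real.log x) (fun _ => 1)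
    have h2 := reTrace_cfc_mul_cfc hτ.1 hσ.1 (fun x => x) Real.log
    rw [Matrix.cfc_one_fun hσ.1, mul_one] at h1
    rw [Matrix.cfc_id_fun hτ.1] at h2
    rw [relEntropyPosDef, reTrace_mul_matLog hτ.1, h1]
    change _ - reTrace (τ * cfc Real.log σ) = _
    rw [h2]
    simp only [← Finset.sum_sub_distrib]
    refine Finset.sum_congr rfl fun i _ => Finset.sum_congr rfl fun j _ => ?_
    ring
  rw [e1, e2]
  simp only [truncatedEntropy, Finset.mul_sum, ← Finset.sum_sub_distrib]
  refine tendsto_finsetSum _ fun i _ => tendsto_finsetSum _ fun j _ => ?_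
  have ht0 := hτ.eigenvalues_pos i
  have hs0 := hσ.eigenvalues_pos j
  generalize eigenOverlap hτ.1 hσ.1 i j = w
  generalize hτ.1.eigenvalues i = t at *
  generalize hσ.1.eigenvalues j = s at *
  have h1 : Filter.Tendsto (fun l : ℝ => s / l + t) Filter.atTop (nhds (0 + t)) :=
    (Filter.Tendsto.div_atTop tendsto_const_nhds Filter.tendsto_id).add_const t
  rw [zero_add] at h1
  have h2 := ((((h1.log ht0.ne').sub_const (Real.log s)).const_mul t).const_mul w)
  refine h2.congr' ?_
  filter_upwards [Filter.eventually_gt_atTop 0] with l hl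
  have : s + l * t = l * (s / l + t) := by field_simp
  rw [this, Real.log_mul hl.ne' (by positivity)]
  ring

/-- Joint convexity of the relative entropy. -/
theorem relEntropyPosDef_convex {τ₁ σ₁ τ₂ σ₂ : Matrix n n ℂ} (hτ₁ : τ₁.PosDef) (hσ₁ : σ₁.PosDef)
    (hτ₂ : τ₂.PosDef) (hσ₂ : σ₂.PosDef) {a b : ℝ} (ha : 0 ≤ a) (hb : 0 ≤ b) (hab : a + b = 1) :
    relEntropyPosDef (a • τ₁ + b • τ₂) (a • σ₁ + b • σ₂) ≤
      a * relEntropyPosDef τ₁ σ₁ + b * relEntropyPosDef τ₂ σ₂ := by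
  refine le_of_tendsto_of_tendsto
    (tendsto_truncatedEntropy (hτ₁.convex_combination hτ₂ ha hb hab)
      (hσ₁.convex_combination hσ₂ ha hb hab))
    (((tendsto_truncatedEntropy hτ₁ hσ₁).const_mul a).add
      ((tendsto_truncatedEntropy hτ₂ hσ₂).const_mul b)) ?_
  filter_upwards [Filter.eventually_ge_atTop 0] with l hl
  have := truncatedEntropy_convex hτ₁ hσ₁ hτ₂ hσ₂ ha hb hab hl
  simp only [map_add, map_smul, smul_eq_mul]
  linarith

end JointConvexity

/-! ### Algebraic properties of `Q_α` on positive definite operators -/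

section RenyiPosDef

set_option linter.unusedSectionVars false

open scoped MatrixOrder

variable {n m : Type*} [Fintype n] [DecidableEq n] [Fintype m] [DecidableEq m]

/-- The matrix whose trace is `renyiQPosDef`. -/
noncomputable def renyiMat (t : RenyiFamily) (α : ℝ) (ρ σ : Matrix n n ℂ) : Matrix n n ℂ :=
  match t with
  | RenyiFamily.petz => matPow ρ α * matPow σ (1 - α)
  | RenyiFamily.sandwiched =>
      matPow (matPow ρ (1 / 2) * matPow σ ((1 - α) / α) * matPow ρ (1 / 2)) α
  | RenyiFamily.flat => matExp (α • matLog ρ + (1 - α) • matLog σ)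

theorem renyiQPosDef_eq (t : RenyiFamily) (α : ℝ) (ρ σ : Matrix n n ℂ) :
    renyiQPosDef t α ρ σ = reTrace (renyiMat t α ρ σ) := by
  cases t <;> rfl

theorem isHermitian_sandwich (ρ X : Matrix n n ℂ) (hX : X.IsHermitian) :
    (matPow ρ (1 / 2) * X * matPow ρ (1 / 2)).IsHermitian := by
  have := Matrix.isHermitian_conjTranspose_mul_mul (matPow ρ (1 / 2)) hX
  rwa [(isHermitian_matPow ρ (1 / 2)).eq] at this

theorem isHermitian_logSum (α : ℝ) (ρ σ : Matrix n n ℂ) :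
    (α • matLog ρ + (1 - α) • matLog σ).IsHermitian := by
  have h : ∀ (c : ℝ) (A : Matrix n n ℂ), A.IsHermitian → (c • A).IsHermitian := fun c A hA => by
    rw [Matrix.IsHermitian, Matrix.conjTranspose_smul, hA.eq]; simp
  exact (h _ _ (isHermitian_matLog ρ)).add (h _ _ (isHermitian_matLog σ))

theorem sandwich_smul_one_le {ρ X : Matrix n n ℂ} (hρ : ρ.PosDef) {c : ℝ}
    (h : c • (1 : Matrix n n ℂ) ≤ X) : c • ρ ≤ matPow ρ (1 / 2) * X * matPow ρ (1 / 2) := by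
  have := star_right_conjugate_le_conjugate h (matPow ρ (1 / 2))
  rw [(isHermitian_matPow ρ (1 / 2)).star_eq, mul_smul_comm, mul_one, smul_mul_assoc,
    matPow_mul_matPow hρ] at this
  norm_num at this
  rwa [matPow_one hρ.1] at this

theorem posDef_sandwich [Nonempty n] {ρ X : Matrix n n ℂ} (hρ : ρ.PosDef) (hX : X.PosDef) :
    (matPow ρ (1 / 2) * X * matPow ρ (1 / 2)).PosDef := by
  obtain ⟨c, hc, h⟩ := hX.smul_one_le
  exact (hρ.smul hc).posDef_of_le (sandwich_smul_one_le hρ h)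

theorem reTrace_sandwich_mul (ρ X Y : Matrix n n ℂ) :
    reTrace (matPow ρ (1 / 2) * X * matPow ρ (1 / 2) * Y) =
      reTrace (matPow ρ (1 / 2) * Y * matPow ρ (1 / 2) * X) := by
  rw [mul_assoc _ _ Y, reTrace_mul_comm (matPow ρ (1 / 2) * X), ← mul_assoc, mul_assoc _ Y,
    mul_assoc]

/-- All three versions are built from functional calculus, sums and products. Choosing `X` as a
projection reduces to a common invariant subspace; choosing it as a block inclusion computes `Q_α`
on direct sums. -/
theorem renyiMat_intertwine (t : RenyiFamily) (α : ℝ) {ρ σ : Matrix m m ℂ} {ρ' σ' : Matrix n n ℂ}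
    (hρ : ρ.IsHermitian) (hσ : σ.IsHermitian) (hρ' : ρ'.IsHermitian) (hσ' : σ'.IsHermitian)
    {X : Matrix m n ℂ} (h1 : ρ * X = X * ρ') (h2 : σ * X = X * σ') :
    renyiMat t α ρ σ * X = X * renyiMat t α ρ' σ' := by
  have hp := fun p : ℝ => cfc_intertwine hρ hρ' h1 (fun x => x ^ p)
  have hs := fun p : ℝ => cfc_intertwine hσ hσ' h2 (fun x => x ^ p)
  cases t with
  | petz =>
    change matPow ρ α * matPow σ (1 - α) * X = X * (matPow ρ' α * matPow σ' (1 - α))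
    unfold matPow
    rw [Matrix.mul_assoc, hs, ← Matrix.mul_assoc, hp, Matrix.mul_assoc]
  | sandwiched =>
    refine cfc_intertwine (isHermitian_sandwich _ _ (isHermitian_matPow _ _))
      (isHermitian_sandwich _ _ (isHermitian_matPow _ _)) ?_ _
    unfold matPow
    rw [Matrix.mul_assoc, hp, ← Matrix.mul_assoc, Matrix.mul_assoc _ _ X, hs, ← Matrix.mul_assoc,
      hp]
    simp only [Matrix.mul_assoc]
  | flat =>
    refine cfc_intertwine (isHermitian_logSum _ _ _) (isHermitian_logSum _ _ _) ?_ _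
    unfold matLog
    rw [Matrix.add_mul, Matrix.mul_add, Matrix.smul_mul, Matrix.smul_mul, Matrix.mul_smul,
      Matrix.mul_smul, cfc_intertwine hρ hρ' h1, cfc_intertwine hσ hσ' h2]

theorem renyiMat_smul_one (t : RenyiFamily) {α : ℝ} (hα : 0 < α) {a b : ℝ} (ha : 0 < a)
    (hb : 0 < b) : renyiMat t α (a • (1 : Matrix n n ℂ)) (b • (1 : Matrix n n ℂ)) =
      (a ^ α * b ^ (1 - α)) • (1 : Matrix n n ℂ) := by
  cases t with
  | petz => simp [renyiMat, matPow_smul_one, smul_smul, mul_comm]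
  | sandwiched =>
    simp only [renyiMat, matPow_smul_one, mul_smul_comm, mul_one, smul_smul]
    congr 1
    rw [mul_left_comm, ← Real.rpow_add ha]
    norm_num
    rw [Real.mul_rpow (by positivity) ha.le, ← Real.rpow_mul hb.le, div_mul_cancel₀ _ hα.ne',
      mul_comm]
  | flat =>
    simp only [renyiMat, matLog_smul_one, smul_smul, ← add_smul, matExp_smul_one]
    congr 1
    rw [Real.exp_add, Real.rpow_def_of_pos ha, Real.rpow_def_of_pos hb]
    ring_nf

theorem renyiQPosDef_smul_right [Nonempty n] (t : RenyiFamily) {α : ℝ} (hα : 0 < α)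
    {ρ σ : Matrix n n ℂ} (hρ : ρ.PosDef) (hσ : σ.PosDef) {c : ℝ} (hc : 0 < c) :
    renyiQPosDef t α ρ (c • σ) = c ^ (1 - α) * renyiQPosDef t α ρ σ := by
  rw [renyiQPosDef_eq, renyiQPosDef_eq, ← smul_eq_mul, ← map_smul]
  congr 1
  cases t with
  | petz => simp only [renyiMat, matPow_smul hσ hc, mul_smul_comm]
  | sandwiched =>
    simp only [renyiMat]
    rw [matPow_smul hσ hc, mul_smul_comm, smul_mul_assoc,
      matPow_smul (posDef_sandwich hρ (posDef_matPow hσ _)) (by positivity), ← Real.rpow_mul hc.le,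
      div_mul_cancel₀ _ hα.ne']
  | flat =>
    simp only [renyiMat]
    rw [matLog_smul hσ hc, smul_add, add_left_comm, smul_smul,
      matExp_smul_one_add (isHermitian_logSum _ _ _), Real.rpow_def_of_pos hc, mul_comm (1 - α)]

theorem renyiQPosDef_smul_left [Nonempty n] (t : RenyiFamily) {α : ℝ}
    {ρ σ : Matrix n n ℂ} (hρ : ρ.PosDef) (hσ : σ.PosDef) {c : ℝ} (hc : 0 < c) :
    renyiQPosDef t α (c • ρ) σ = c ^ α * renyiQPosDef t α ρ σ := by
  rw [renyiQPosDef_eq, renyiQPosDef_eq, ← smul_eq_mul, ← map_smul]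
  congr 1
  cases t with
  | petz => simp only [renyiMat, matPow_smul hρ hc, smul_mul_assoc]
  | sandwiched =>
    simp only [renyiMat]
    rw [matPow_smul hρ hc, mul_smul_comm, smul_mul_assoc, smul_mul_assoc, smul_smul,
      ← Real.rpow_add hc]
    norm_num
    have := posDef_sandwich hρ (posDef_matPow hσ ((1 - α) / α))
    norm_num at this
    rw [matPow_smul this hc]
  | flat =>
    simp only [renyiMat]
    rw [matLog_smul hρ hc, smul_add, add_assoc, smul_smul,
      matExp_smul_one_add (isHermitian_logSum _ _ _), Real.rpow_def_of_pos hc, mul_comm α]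

theorem renyiQPosDef_smul [Nonempty n] (t : RenyiFamily) {α : ℝ} (hα : 0 < α)
    {ρ σ : Matrix n n ℂ} (hρ : ρ.PosDef) (hσ : σ.PosDef) {c : ℝ} (hc : 0 < c) :
    renyiQPosDef t α (c • ρ) (c • σ) = c * renyiQPosDef t α ρ σ := by
  rw [renyiQPosDef_smul_left t hρ (hσ.smul hc) hc, renyiQPosDef_smul_right t hα hρ hσ hc,
    ← mul_assoc, ← Real.rpow_add hc]
  norm_num

theorem renyiQPosDef_pos [Nonempty n] (t : RenyiFamily) (α : ℝ)
    {ρ σ : Matrix n n ℂ} (hρ : ρ.PosDef) (hσ : σ.PosDef) : 0 < renyiQPosDef t α ρ σ := by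
  rw [renyiQPosDef_eq]
  have h : ∀ A : Matrix n n ℂ, A.PosDef → 0 < reTrace A := fun A hA =>
    reTrace_pos hA.nonneg hA.isUnit.ne_zero
  cases t with
  | petz =>
    exact reTrace_mul_pos (posDef_matPow hρ _).nonneg (posDef_matPow hρ _).isUnit.ne_zero
      (posDef_matPow hσ _)
  | sandwiched => exact h _ (posDef_matPow (posDef_sandwich hρ (posDef_matPow hσ _)) _)
  | flat => exact h _ (posDef_matExp (isHermitian_logSum _ _ _))

theorem mul_matPow_sub_one {A : Matrix n n ℂ} (hA : A.PosDef) (α : ℝ) :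
    A * matPow A (α - 1) = matPow A α := by
  conv_lhs => rw [← matPow_one hA.1, matPow_matPow hA, matPow_mul_matPow hA]
  ring_nf

/-- Powers above one are not operator monotone, but their traces are monotone. The affine bound is
taken at `B` when `α < 1` and at `A` when `α > 1`, so that the comparison operator already has the
exponent wanted. -/
theorem reTrace_matPow_mono {α : ℝ} (hα : 0 < α) {A B : Matrix n n ℂ} (hA : A.PosDef)
    (h : A ≤ B) : reTrace (matPow A α) ≤ reTrace (matPow B α) := by
  have hB := hA.posDef_of_le h
  rcases lt_trichotomy α 1 with h1 | rfl | h1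
  · have h2 := reTrace_matPow_le hα h1 hA hB
    have h3 := reTrace_mul_mono_right (posDef_matPow hB (α - 1)).nonneg h
    have h4 := mul_matPow_sub_one hB α
    rw [reTrace_mul_comm, reTrace_mul_comm _ B, h4] at h3
    nlinarith
  · rw [matPow_one hA.1, matPow_one hB.1]
    exact reTrace_mono h
  · have h2 := le_reTrace_matPow h1 hB hA
    have h3 := reTrace_mul_mono_right (posDef_matPow hA (α - 1)).nonneg h
    have h4 := mul_matPow_sub_one hA α
    rw [reTrace_mul_comm, reTrace_mul_comm _ B, h4] at h3
    nlinarith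

theorem sandwich_mono (ρ : Matrix n n ℂ) {X Y : Matrix n n ℂ} (h : X ≤ Y) :
    matPow ρ (1 / 2) * X * matPow ρ (1 / 2) ≤ matPow ρ (1 / 2) * Y * matPow ρ (1 / 2) := by
  have := star_right_conjugate_le_conjugate h (matPow ρ (1 / 2))
  rwa [(isHermitian_matPow ρ (1 / 2)).star_eq] at this

/-- Apply the identity for `T T*` and `T* T` to `T = ρ^(1/2) X^(1/2)`. This moves `ρ` to the middle,
where the order in `ρ` can be used. -/
theorem reTrace_sandwich_comm {ρ X : Matrix n n ℂ} (hρ : ρ.PosDef) (hX : X.PosDef) (α : ℝ) :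
    reTrace (matPow (matPow ρ (1 / 2) * X * matPow ρ (1 / 2)) α) =
      reTrace (matPow (matPow X (1 / 2) * ρ * matPow X (1 / 2)) α) := by
  have h := reTrace_cfc_mul_star (T := matPow ρ (1 / 2) * matPow X (1 / 2))
    ((posDef_matPow hρ _).isUnit.mul (posDef_matPow hX _).isUnit) (fun x => x ^ α)
  have hr : ∀ A : Matrix n n ℂ, A.PosDef → matPow A (1 / 2) * matPow A (1 / 2) = A :=
    fun A hA => by rw [matPow_mul_matPow hA]; norm_num [matPow_one hA.1]
  rw [star_mul, (isHermitian_matPow ρ (1 / 2)).star_eq, (isHermitian_matPow X (1 / 2)).star_eq,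
    show matPow ρ (1 / 2) * matPow X (1 / 2) * (matPow X (1 / 2) * matPow ρ (1 / 2)) =
      matPow ρ (1 / 2) * (matPow X (1 / 2) * matPow X (1 / 2)) * matPow ρ (1 / 2) by
      simp only [mul_assoc], hr X hX,
    show matPow X (1 / 2) * matPow ρ (1 / 2) * (matPow ρ (1 / 2) * matPow X (1 / 2)) =
      matPow X (1 / 2) * (matPow ρ (1 / 2) * matPow ρ (1 / 2)) * matPow X (1 / 2) by
      simp only [mul_assoc], hr ρ hρ] at h
  exact h

end RenyiPosDef

/-! ### Monotonicity, concavity, log-convexity and lower bounds for `Q_α` -/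

section RenyiPosDefOrder

set_option linter.unusedSectionVars false

open scoped MatrixOrder

variable {n : Type*} [Fintype n] [DecidableEq n] [Nonempty n]

theorem logSum_mono {α β : ℝ} (hα : 0 ≤ α) (hβ : 0 ≤ β) {A A' B B' : Matrix n n ℂ} (hA : A ≤ A')
    (hB : B ≤ B') : α • A + β • B ≤ α • A' + β • B' :=
  add_le_add (smul_le_smul_of_nonneg_left hA hα) (smul_le_smul_of_nonneg_left hB hβ)

theorem renyiQPosDef_mono_right {t : RenyiFamily} {α : ℝ} (h0 : 0 < α) (h1 : α < 1)
    (hs : t = RenyiFamily.sandwiched → 1 / 2 ≤ α) {ρ σ σ' : Matrix n n ℂ} (hρ : ρ.PosDef)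
    (hσ : σ.PosDef) (h : σ ≤ σ') : renyiQPosDef t α ρ σ ≤ renyiQPosDef t α ρ σ' := by
  rw [renyiQPosDef_eq, renyiQPosDef_eq]
  have hσ' := hσ.posDef_of_le h
  cases t with
  | petz =>
    exact reTrace_mul_mono_right (posDef_matPow hρ _).nonneg
      (matPow_le_matPow hσ.nonneg h (by linarith) (by linarith))
  | sandwiched =>
    have hs := hs rfl
    refine reTrace_matPow_mono h0 (posDef_sandwich hρ (posDef_matPow hσ _)) (sandwich_mono ρ ?_)
    -- The exponent `(1 - α) / α` is at most one exactly because `α ≥ 1 / 2`.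
    exact matPow_le_matPow hσ.nonneg h (div_nonneg (by linarith) h0.le)
      ((div_le_one h0).2 (by linarith))
  | flat =>
    exact reTrace_matExp_mono (isHermitian_logSum _ _ _) (isHermitian_logSum _ _ _)
      (logSum_mono h0.le (by linarith) le_rfl (matLog_le_matLog hσ h))

theorem renyiQPosDef_mono_left {t : RenyiFamily} {α : ℝ} (h0 : 0 < α) (h1 : α < 1)
    {ρ ρ' σ : Matrix n n ℂ} (hρ : ρ.PosDef) (hσ : σ.PosDef) (h : ρ ≤ ρ') :
    renyiQPosDef t α ρ σ ≤ renyiQPosDef t α ρ' σ := by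
  rw [renyiQPosDef_eq, renyiQPosDef_eq]
  have hρ' := hρ.posDef_of_le h
  cases t with
  | petz =>
    simp only [renyiMat]
    rw [reTrace_mul_comm, reTrace_mul_comm (matPow ρ' α)]
    exact reTrace_mul_mono_right (posDef_matPow hσ _).nonneg
      (matPow_le_matPow hρ.nonneg h h0.le h1.le)
  | sandwiched =>
    have hX := posDef_matPow hσ ((1 - α) / α)
    simp only [renyiMat]
    rw [reTrace_sandwich_comm hρ hX, reTrace_sandwich_comm hρ' hX]
    exact reTrace_matPow_mono h0 (posDef_sandwich hX hρ) (sandwich_mono _ h)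
  | flat =>
    exact reTrace_matExp_mono (isHermitian_logSum _ _ _) (isHermitian_logSum _ _ _)
      (logSum_mono h0.le (by linarith) (matLog_le_matLog hρ h) le_rfl)

theorem renyiQPosDef_concave {t : RenyiFamily} {α : ℝ} (h0 : 0 < α) (h1 : α < 1)
    (hs : t = RenyiFamily.sandwiched → 1 / 2 ≤ α) {ρ σ₁ σ₂ : Matrix n n ℂ} (hρ : ρ.PosDef)
    (hσ₁ : σ₁.PosDef) (hσ₂ : σ₂.PosDef) {a b : ℝ} (ha : 0 ≤ a) (hb : 0 ≤ b) (hab : a + b = 1) :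
    a * renyiQPosDef t α ρ σ₁ + b * renyiQPosDef t α ρ σ₂ ≤
      renyiQPosDef t α ρ (a • σ₁ + b • σ₂) := by
  simp only [renyiQPosDef_eq]
  have hσ := hσ₁.convex_combination hσ₂ ha hb hab
  cases t with
  | petz =>
    have := reTrace_mul_mono_right (posDef_matPow hρ α).nonneg
      (matPow_concave hσ₁.nonneg hσ₂.nonneg (p := 1 - α) (by linarith) (by linarith) ha hb hab)
    simpa only [renyiMat, mul_add, mul_smul_comm, map_add, map_smul, smul_eq_mul] using this
  | sandwiched =>
    have hs := hs rfl
    simp only [renyiMat]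
    set r := (1 - α) / α
    have hr0 : 0 ≤ r := div_nonneg (by linarith) h0.le
    have hr1 : r ≤ 1 := (div_le_one h0).2 (by linarith)
    -- With the trial operator fixed as the sandwich of the mixture, the upper bounds at `σ₁` and
    -- `σ₂` are affine in `σᵢ ^ r`, and concavity of the power `r` finishes.
    set B := matPow ρ (1 / 2) * matPow (a • σ₁ + b • σ₂) r * matPow ρ (1 / 2) with hB
    have hBp : B.PosDef := posDef_sandwich hρ (posDef_matPow hσ _)
    have k1 := reTrace_matPow_le h0 h1 (posDef_sandwich hρ (posDef_matPow hσ₁ r)) hBp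
    have k2 := reTrace_matPow_le h0 h1 (posDef_sandwich hρ (posDef_matPow hσ₂ r)) hBp
    have k3 := reTrace_mul_mono_right (posDef_sandwich hρ (posDef_matPow hBp (α - 1))).nonneg
      (matPow_concave hσ₁.nonneg hσ₂.nonneg hr0 hr1 ha hb hab)
    rw [← reTrace_sandwich_mul ρ (matPow (a • σ₁ + b • σ₂) r), ← hB, mul_matPow_sub_one hBp] at k3
    simp only [mul_add, mul_smul_comm, map_add, map_smul, smul_eq_mul] at k3
    rw [reTrace_sandwich_mul] at k1 k2
    have e1 := mul_le_mul_of_nonneg_left k1 ha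
    have e2 := mul_le_mul_of_nonneg_left k2 hb
    have e3 := mul_le_mul_of_nonneg_left k3 h0.le
    have e4 : reTrace (matPow B α) = a * reTrace (matPow B α) + b * reTrace (matPow B α) := by
      rw [← add_mul, hab, one_mul]
    nlinarith
  | flat =>
    simp only [renyiMat]
    have hK := isHermitian_logSum α ρ (a • σ₁ + b • σ₂)
    have t1 := posDef_matExp (isHermitian_logSum α ρ σ₁)
    have t2 := posDef_matExp (isHermitian_logSum α ρ σ₂)
    have l1 := matLog_matExp (isHermitian_logSum α ρ σ₁)
    have l2 := matLog_matExp (isHermitian_logSum α ρ σ₂)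
    generalize matExp (α • matLog ρ + (1 - α) • matLog σ₁) = τ₁ at *
    generalize matExp (α • matLog ρ + (1 - α) • matLog σ₂) = τ₂ at *
    -- By the Gibbs principle the flat `Q_α` is the maximum over `τ` of `Tr τ - α D(τ‖ρ) - (1 - α)
    -- D(τ‖σ)`. The mixture of the two maximisers is a trial operator, and joint convexity of `D`
    -- bounds its value from below.
    have k := le_reTrace_matExp hK (t1.convex_combination t2 ha hb hab)
    have j1 := relEntropyPosDef_convex t1 hσ₁ t2 hσ₂ ha hb hab
    -- With second argument `1` the relative entropy is `Tr τ log τ`, whose convexity handles the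
    -- `α` part.
    have j2 := relEntropyPosDef_convex t1 Matrix.PosDef.one t2 Matrix.PosDef.one ha hb hab
    have m1 : reTrace (τ₁ * matLog τ₁) =
        α * reTrace (τ₁ * matLog ρ) + (1 - α) * reTrace (τ₁ * matLog σ₁) := by
      rw [l1]; simp only [mul_add, mul_smul_comm, map_add, map_smul, smul_eq_mul]
    have m2 : reTrace (τ₂ * matLog τ₂) =
        α * reTrace (τ₂ * matLog ρ) + (1 - α) * reTrace (τ₂ * matLog σ₂) := by
      rw [l2]; simp only [mul_add, mul_smul_comm, map_add, map_smul, smul_eq_mul]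
    have hl1 : matLog (1 : Matrix n n ℂ) = 0 := by
      have := matLog_smul_one (n := n) 1
      simpa using this
    rw [← add_smul, hab, one_smul] at j2
    simp only [relEntropyPosDef, hl1, mul_zero, map_zero, sub_zero] at j1 j2
    have e1 := mul_le_mul_of_nonneg_left j1 (by linarith : 0 ≤ 1 - α)
    have e2 := mul_le_mul_of_nonneg_left j2 h0.le
    set τ := a • τ₁ + b • τ₂ with hτ
    have e3 : reTrace τ = a * reTrace τ₁ + b * reTrace τ₂ := by
      simp only [hτ, map_add, map_smul, smul_eq_mul]
    have e4 : reTrace (τ * matLog ρ) =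
        a * reTrace (τ₁ * matLog ρ) + b * reTrace (τ₂ * matLog ρ) := by
      simp only [hτ, add_mul, smul_mul_assoc, map_add, map_smul, smul_eq_mul]
    simp only [mul_add τ, mul_smul_comm, map_add, map_smul, smul_eq_mul] at k
    rw [e3, e4] at k
    rw [m1, m2] at e1 e2
    linarith

/-- The power of `σ` is `-(α - 1)` for Petz, which needs `α ≤ 2` to stay within `[-1, 0]`, and `-(α
- 1) / α` for the sandwiched version, which always does. The flat version only uses monotonicity of
the logarithm. -/
theorem renyiQPosDef_antitone_right {t : RenyiFamily} {α : ℝ} (h1 : 1 < α)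
    (hp : t = RenyiFamily.petz → α ≤ 2) {ρ σ σ' : Matrix n n ℂ} (hρ : ρ.PosDef)
    (hσ : σ.PosDef) (h : σ ≤ σ') : renyiQPosDef t α ρ σ' ≤ renyiQPosDef t α ρ σ := by
  rw [renyiQPosDef_eq, renyiQPosDef_eq]
  have hσ' := hσ.posDef_of_le h
  have h0 : 0 < α := by linarith
  cases t with
  | petz =>
    have hp := hp rfl
    refine reTrace_mul_mono_right (posDef_matPow hρ _).nonneg ?_
    rw [← neg_sub α 1]
    exact matPow_neg_antitone hσ h (by linarith) (by linarith)
  | sandwiched =>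
    refine reTrace_matPow_mono h0 (posDef_sandwich hρ (posDef_matPow hσ' _)) (sandwich_mono ρ ?_)
    rw [← neg_sub α 1, neg_div]
    exact matPow_neg_antitone hσ h (div_nonneg (by linarith) h0.le)
      ((div_le_one h0).2 (by linarith))
  | flat =>
    refine reTrace_matExp_mono (isHermitian_logSum _ _ _) (isHermitian_logSum _ _ _)
      (add_le_add le_rfl ?_)
    have := smul_le_smul_of_nonneg_left (matLog_le_matLog hσ h) (by linarith : 0 ≤ α - 1)
    rw [← neg_sub α 1, neg_smul, neg_smul]
    exact neg_le_neg this

theorem add_smul_one_mono (ρ : Matrix n n ℂ) {δ δ' : ℝ} (h : δ ≤ δ') :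
    ρ + δ • (1 : Matrix n n ℂ) ≤ ρ + δ' • (1 : Matrix n n ℂ) :=
  add_le_add le_rfl (smul_le_smul_of_nonneg_right h zero_le_one)

/-- The two shifted operators commute, so scalar monotonicity suffices and exponents above one are
allowed. -/
theorem matPow_add_smul_one_mono {ρ : Matrix n n ℂ} (hρ : 0 ≤ ρ) {δ δ' α : ℝ} (hδ : 0 < δ)
    (h : δ ≤ δ') (hα : 0 ≤ α) :
    matPow (ρ + δ • (1 : Matrix n n ℂ)) α ≤ matPow (ρ + δ' • (1 : Matrix n n ℂ)) α := by
  have hρ' : IsSelfAdjoint ρ := IsSelfAdjoint.of_nonneg hρ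
  have e : ∀ d : ℝ, matPow (ρ + d • (1 : Matrix n n ℂ)) α = cfc (fun x : ℝ => (x + d) ^ α) ρ := by
    intro d
    have e1 : ρ + d • (1 : Matrix n n ℂ) = cfc (fun x : ℝ => x + d) ρ := by
      rw [Matrix.cfc_add_fun (fun x => x) (fun _ => d), Matrix.cfc_id_fun hρ',
        cfc_const d ρ hρ', Algebra.algebraMap_eq_smul_one]
    rw [e1, matPow, ← cfc_comp' _ _ ρ ?_ (ρ.continuousOn_spectrum _) hρ']
    exact ((Matrix.finite_real_spectrum (A := ρ)).image _).continuousOn _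
  rw [e, e]
  refine cfc_mono (fun x hx => ?_) (ρ.continuousOn_spectrum _) (ρ.continuousOn_spectrum _)
  have := Matrix.spectrum_nonneg hρ hx
  exact Real.rpow_le_rpow (by linarith) (by linarith) hα

theorem renyiQPosDef_add_smul_one_mono (t : RenyiFamily) {α : ℝ} (h0 : 0 < α)
    {ρ σ : Matrix n n ℂ} (hρ : 0 ≤ ρ) (hσ : σ.PosDef) {δ δ' : ℝ} (hδ : 0 < δ) (h : δ ≤ δ') :
    renyiQPosDef t α (ρ + δ • (1 : Matrix n n ℂ)) σ ≤
      renyiQPosDef t α (ρ + δ' • (1 : Matrix n n ℂ)) σ := by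
  rw [renyiQPosDef_eq, renyiQPosDef_eq]
  have h1 := Matrix.posDef_add_smul_one hρ hδ
  have h2 := h1.posDef_of_le (add_smul_one_mono ρ h)
  cases t with
  | petz =>
    simp only [renyiMat]
    rw [reTrace_mul_comm, reTrace_mul_comm (matPow (ρ + δ' • 1) α)]
    exact reTrace_mul_mono_right (posDef_matPow hσ _).nonneg
      (matPow_add_smul_one_mono hρ hδ h h0.le)
  | sandwiched =>
    have hX := posDef_matPow hσ ((1 - α) / α)
    simp only [renyiMat]
    rw [reTrace_sandwich_comm h1 hX, reTrace_sandwich_comm h2 hX]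
    exact reTrace_matPow_mono h0 (posDef_sandwich hX h1) (sandwich_mono _ (add_smul_one_mono ρ h))
  | flat =>
    exact reTrace_matExp_mono (isHermitian_logSum _ _ _) (isHermitian_logSum _ _ _)
      (add_le_add (smul_le_smul_of_nonneg_left
        (matLog_le_matLog h1 (add_smul_one_mono ρ h)) h0.le) le_rfl)

/-- Log-convexity, not just convexity, is required because `D_α` is `log Q_α / (α - 1)` for
normalised `ρ`. For the sandwiched version the Hölder bound reduces to `Tr K σ^(-s)` with `K` fixed
by the mixture; for the flat version Peierls–Bogoliubov linearises around the mixture and concavity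
of the logarithm finishes. -/
theorem log_renyiQPosDef_convex {t : RenyiFamily} {α : ℝ} (h1 : 1 < α)
    (hp : t = RenyiFamily.petz → α ≤ 2) {ρ σ₁ σ₂ : Matrix n n ℂ} (hρ : ρ.PosDef)
    (hσ₁ : σ₁.PosDef) (hσ₂ : σ₂.PosDef) {a b : ℝ} (ha : 0 ≤ a) (hb : 0 ≤ b) (hab : a + b = 1) :
    Real.log (renyiQPosDef t α ρ (a • σ₁ + b • σ₂)) ≤
      a * Real.log (renyiQPosDef t α ρ σ₁) + b * Real.log (renyiQPosDef t α ρ σ₂) := by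
  simp only [renyiQPosDef_eq]
  have h0 : 0 < α := by linarith
  have hσ := hσ₁.convex_combination hσ₂ ha hb hab
  cases t with
  | petz =>
    have hp := hp rfl
    simp only [renyiMat]
    rw [← neg_sub α 1]
    exact log_reTrace_mul_matPow_neg_convex (posDef_matPow hρ α).nonneg
      (posDef_matPow hρ α).isUnit.ne_zero hσ₁ hσ₂ (by linarith) (by linarith) ha hb hab
  | sandwiched =>
    simp only [renyiMat]
    rw [← neg_sub α 1, neg_div]
    set s := (α - 1) / α
    have hs0 : 0 ≤ s := div_nonneg (by linarith) h0.le
    have hs1 : s ≤ 1 := (div_le_one h0).2 (by linarith)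
    set B := matPow ρ (1 / 2) * matPow (a • σ₁ + b • σ₂) (-s) * matPow ρ (1 / 2) with hB
    have hBp : B.PosDef := posDef_sandwich hρ (posDef_matPow hσ _)
    have k1 := log_le_log_reTrace_matPow h1 (posDef_sandwich hρ (posDef_matPow hσ₁ (-s))) hBp
    have k2 := log_le_log_reTrace_matPow h1 (posDef_sandwich hρ (posDef_matPow hσ₂ (-s))) hBp
    have hK := posDef_sandwich hρ (posDef_matPow hBp (α - 1))
    have k3 := log_reTrace_mul_matPow_neg_convex hK.nonneg hK.isUnit.ne_zero hσ₁ hσ₂ hs0 hs1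
      ha hb hab
    rw [← reTrace_sandwich_mul ρ (matPow (a • σ₁ + b • σ₂) (-s)), ← hB,
      mul_matPow_sub_one hBp] at k3
    rw [reTrace_sandwich_mul] at k1 k2
    have e1 := mul_le_mul_of_nonneg_left k1 ha
    have e2 := mul_le_mul_of_nonneg_left k2 hb
    have e3 := mul_le_mul_of_nonneg_left k3 h0.le
    have e4 : Real.log (reTrace (matPow B α)) =
        a * Real.log (reTrace (matPow B α)) + b * Real.log (reTrace (matPow B α)) := by
      rw [← add_mul, hab, one_mul]
    nlinarith
  | flat =>
    simp only [renyiMat]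
    have hK := isHermitian_logSum α ρ (a • σ₁ + b • σ₂)
    have hT := posDef_matExp hK
    have k1 := peierls_bogoliubov hK (isHermitian_logSum α ρ σ₁)
    have k2 := peierls_bogoliubov hK (isHermitian_logSum α ρ σ₂)
    have k3 := reTrace_mul_mono_right hT.nonneg (matLog_concave hσ₁ hσ₂ ha hb hab)
    have hZ := reTrace_pos hT.nonneg hT.isUnit.ne_zero
    set L := Real.log (reTrace (matExp (α • matLog ρ + (1 - α) • matLog (a • σ₁ + b • σ₂))))
    generalize matExp (α • matLog ρ + (1 - α) • matLog (a • σ₁ + b • σ₂)) = T at *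
    rw [add_sub_add_left_eq_sub, ← smul_sub] at k1 k2
    simp only [mul_add, mul_sub, mul_smul_comm, map_add, map_sub, map_smul, smul_eq_mul]
      at k1 k2 k3
    have e1 := mul_le_mul_of_nonneg_left k1 ha
    have e2 := mul_le_mul_of_nonneg_left k2 hb
    set x := reTrace (T * matLog (a • σ₁ + b • σ₂))
    have e3 : 0 ≤ a * ((1 - α) * (reTrace (T * matLog σ₁) - x) / reTrace T) +
        b * ((1 - α) * (reTrace (T * matLog σ₂) - x) / reTrace T) := by
      have e : a * ((1 - α) * (reTrace (T * matLog σ₁) - x) / reTrace T) +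
        b * ((1 - α) * (reTrace (T * matLog σ₂) - x) / reTrace T) =
        (α - 1) * ((a + b) * x - (a * reTrace (T * matLog σ₁) + b * reTrace (T * matLog σ₂))) /
          reTrace T := by ring
      rw [e, hab, one_mul]
      exact div_nonneg (mul_nonneg (by linarith) (by linarith)) hZ.le
    have e4 : L = a * L + b * L := by rw [← add_mul, hab, one_mul]
    rw [mul_sub (1 - α), mul_sub (1 - α)] at e3
    linarith

theorem neg_card_le_reTrace_mul_matLog {ρ : Matrix n n ℂ} (hρ : ρ.PosDef) :
    reTrace ρ - Fintype.card n ≤ reTrace (ρ * matLog ρ) := by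
  have h := reTrace_klein hρ.1 hρ.1 (fun r => r * Real.log r + (-1) * r) (fun _ => 1)
    (fun _ => 0) (fun _ => 1) (fun _ => 1) (fun _ => 1) fun r hr b _ => by
      have hr := hρ.spectrum_pos hr
      have h1 := Real.one_sub_inv_le_log_of_pos hr
      have h2 := mul_le_mul_of_nonneg_left h1 hr.le
      rw [mul_sub, mul_inv_cancel₀ hr.ne'] at h2
      linarith
  have hz : cfc (fun _ : ℝ => (0 : ℝ)) ρ = 0 := cfc_const_zero ℝ ρ
  rw [Matrix.cfc_add_fun (fun r => r * Real.log r), Matrix.cfc_const_mul_id hρ.1, hz,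
    Matrix.cfc_one_fun hρ.1] at h
  simp only [mul_one, map_add, map_smul, smul_eq_mul, ← reTrace_mul_matLog hρ.1, map_zero,
    reTrace_one] at h
  linarith

/-- A lower bound for all three families in terms of the relative entropy. -/
theorem neg_reTrace_mul_matLog_le_renyiQPosDef (t : RenyiFamily) {α : ℝ} (h1 : 1 < α)
    {ρ σ : Matrix n n ℂ} (hρ : ρ.PosDef) (hσ : σ.PosDef) :
    -(α - 1) * (reTrace (ρ * matLog σ) + Fintype.card n) ≤ renyiQPosDef t α ρ σ := by
  rw [renyiQPosDef_eq]
  have h0 : 0 < α := by linarith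
  have hlog : ∀ r : ℝ, 0 < r → r - 1 ≤ r * Real.log r := fun r hr => by
    have h2 := mul_le_mul_of_nonneg_left (Real.one_sub_inv_le_log_of_pos hr) hr.le
    rwa [mul_sub, mul_inv_cancel₀ hr.ne', mul_one] at h2
  cases t with
  | petz =>
    have h := reTrace_klein hρ.1 hσ.1 (fun r => r ^ α) (fun r => (α - 1) * r)
      (fun _ => 1) (fun x => x ^ (1 - α)) Real.log (fun x => (α - 1) * 1) fun r hr x hx => by
        have hr := hρ.spectrum_pos hr
        have hx := hσ.spectrum_pos hx
        -- After this rewriting, `e^y ≥ 1 + y` and `r log r ≥ r - 1` give the scalar inequality.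
        have e : r ^ α * x ^ (1 - α) = r * Real.exp ((α - 1) * (Real.log r - Real.log x)) := by
          rw [Real.rpow_def_of_pos hr, Real.rpow_def_of_pos hx, ← Real.exp_add]
          conv_rhs => rw [← Real.exp_log hr, ← Real.exp_add, Real.exp_log hr]
          ring_nf
        have h3 := mul_le_mul_of_nonneg_left
          (Real.add_one_le_exp ((α - 1) * (Real.log r - Real.log x))) hr.le
        have h4 := mul_le_mul_of_nonneg_left (hlog r hr) (by linarith : 0 ≤ α - 1)
        rw [e]
        nlinarith
    rw [Matrix.cfc_const_mul_id hρ.1, Matrix.cfc_const_mul_fun _ _ (fun _ => 1),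
      Matrix.cfc_one_fun hρ.1, Matrix.cfc_one_fun hσ.1] at h
    simp only [one_mul, smul_mul_assoc, map_smul, smul_eq_mul, reTrace_one] at h
    change 0 ≤ reTrace (renyiMat RenyiFamily.petz α ρ σ) + (α - 1) * reTrace (ρ * matLog σ) + _
      at h
    linarith
  | sandwiched =>
    have hA := posDef_sandwich hρ (posDef_matPow hσ ((1 - α) / α))
    -- The trial operator `1` bounds `Tr A ^ α` below by `α Tr A - (α - 1) dim`, where `Tr A = Tr ρ
    -- σ^((1-α)/α)`.
    have hb := le_reTrace_matPow h1 hA (Matrix.PosDef.one)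
    have hone : ∀ p : ℝ, matPow (1 : Matrix n n ℂ) p = 1 := fun p => by
      have := matPow_smul_one (n := n) 1 p
      simpa using this
    rw [hone, hone, reTrace_sandwich_mul, mul_one, matPow_mul_matPow hρ, reTrace_one] at hb
    norm_num at hb
    rw [matPow_one hρ.1] at hb
    have h := reTrace_klein hρ.1 hσ.1 (fun r => r) (fun r => ((α - 1) / α) * r)
      (fun _ => 1) (fun x => x ^ ((1 - α) / α)) Real.log (fun x => 0) fun r hr x hx => by
        have hr := hρ.spectrum_pos hr
        have hx := hσ.spectrum_pos hx
        have e : x ^ ((1 - α) / α) = Real.exp (-((α - 1) / α) * Real.log x) := by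
          rw [Real.rpow_def_of_pos hx]; ring_nf
        have h3 := mul_le_mul_of_nonneg_left
          (Real.add_one_le_exp (-((α - 1) / α) * Real.log x)) hr.le
        rw [e]
        nlinarith
    have hz : cfc (fun _ : ℝ => (0 : ℝ)) σ = 0 := cfc_const_zero ℝ σ
    rw [Matrix.cfc_const_mul_id hρ.1, hz, Matrix.cfc_id_fun hρ.1] at h
    simp only [mul_zero, smul_mul_assoc, map_smul, smul_eq_mul, map_zero, add_zero] at h
    change 0 ≤ reTrace (ρ * matPow σ ((1 - α) / α)) + (α - 1) / α * reTrace (ρ * matLog σ) at h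
    have h5 := mul_le_mul_of_nonneg_left h h0.le
    have e : α * (reTrace (ρ * matPow σ ((1 - α) / α)) + (α - 1) / α * reTrace (ρ * matLog σ)) =
      α * reTrace (ρ * matPow σ ((1 - α) / α)) + (α - 1) * reTrace (ρ * matLog σ) := by
      field_simp
    rw [e] at h5
    simp only [renyiMat]
    norm_num
    linarith
  | flat =>
    have h := le_reTrace_matExp (isHermitian_logSum α ρ σ) hρ
    simp only [mul_add, mul_smul_comm, map_add, map_smul, smul_eq_mul] at h
    have h2 := neg_card_le_reTrace_mul_matLog hρ
    have h3 := reTrace_nonneg hρ.nonneg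
    simp only [renyiMat]
    nlinarith

theorem Matrix.IsHermitian.exists_le_smul_one {A : Matrix n n ℂ} (hA : A.IsHermitian) :
    ∃ c : ℝ, 0 < c ∧ A ≤ c • (1 : Matrix n n ℂ) := by
  obtain ⟨i, hi⟩ := Finite.exists_max hA.eigenvalues
  refine ⟨max (hA.eigenvalues i) 1, by positivity, ?_⟩
  rw [← Algebra.algebraMap_eq_smul_one, le_algebraMap_iff_spectrum_le (ha := hA)]
  intro x hx
  rw [hA.spectrum_real_eq_range_eigenvalues] at hx
  obtain ⟨j, rfl⟩ := hx
  exact (hi j).trans (le_max_left _ _)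

/-- A positive lower bound, uniform over `ρ` of trace at least one. -/
theorem exists_pos_le_renyiQPosDef (t : RenyiFamily) {α : ℝ} (h1 : 1 < α)
    {σ : Matrix n n ℂ} (hσ : σ.PosDef) :
    ∃ κ : ℝ, 0 < κ ∧ ∀ ρ : Matrix n n ℂ, ρ.PosDef → 1 ≤ reTrace ρ →
      κ ≤ renyiQPosDef t α ρ σ := by
  obtain ⟨c, hc, hσc⟩ := hσ.1.exists_le_smul_one
  set d : ℝ := (Fintype.card n : ℝ) with hd
  -- This rescaling of `σ` forces `log σ ≤ -(d + 1)`, so the entropy bound becomes at least `α - 1`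
  -- when `Tr ρ ≥ 1`; the scaling law transports it back to `σ`.
  have he : 0 < Real.exp (-(d + 1)) / c := by positivity
  refine ⟨(α - 1) / (Real.exp (-(d + 1)) / c) ^ (1 - α),
    div_pos (by linarith) (Real.rpow_pos_of_pos he _), fun ρ hρ htr => ?_⟩
  rw [div_le_iff₀' (Real.rpow_pos_of_pos he _),
    ← renyiQPosDef_smul_right t (by linarith) hρ hσ he]
  refine le_trans ?_ (neg_reTrace_mul_matLog_le_renyiQPosDef t h1 hρ (hσ.smul he))
  have h2 : (Real.exp (-(d + 1)) / c) • σ ≤ Real.exp (-(d + 1)) • (1 : Matrix n n ℂ) := by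
    have := smul_le_smul_of_nonneg_left hσc he.le
    rwa [smul_smul, div_mul_cancel₀ _ hc.ne'] at this
  have h3 := reTrace_mul_mono_right hρ.nonneg (matLog_le_matLog (hσ.smul he) h2)
  rw [matLog_smul_one, Real.log_exp, mul_smul_comm, mul_one, map_smul, smul_eq_mul] at h3
  have hd0 : 0 ≤ d := Nat.cast_nonneg _
  nlinarith [mul_nonneg hd0 (sub_nonneg.2 htr)]

/-- On the common invariant subspace given by the projection `P`, adding `1 - P` to the second
argument changes `renyiQPosDef` by an arbitrarily small amount. -/
theorem renyiQPosDef_le_of_projection (t : RenyiFamily) {α : ℝ} (h0 : 0 < α)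
    {ρ σ P : Matrix n n ℂ} (hρ : 0 ≤ ρ) (hσ : 0 ≤ σ) (hP : P.IsHermitian) (hPP : P * P = P)
    (hρP : ρ * P = ρ) (hPρ : P * ρ = ρ) (hσP : σ * P = σ) (hPσ : P * σ = σ) {δ : ℝ} (hδ : 0 < δ) :
    renyiQPosDef t α (ρ + δ • (1 : Matrix n n ℂ)) (σ + δ • (1 : Matrix n n ℂ)) ≤
      renyiQPosDef t α (ρ + δ • (1 : Matrix n n ℂ)) (σ + (1 - P) + δ • (1 : Matrix n n ℂ)) +
        δ * Fintype.card n := by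
  have hQ : 0 ≤ 1 - P := by
    have : (1 - P) = star (1 - P) * (1 - P) := by
      have hs : star P = P := hP
      rw [star_sub, star_one, hs, sub_mul, mul_sub, mul_sub, hPP]; simp
    rw [this]; exact star_mul_self_nonneg _
  have hP0 : 0 ≤ P := by
    have : P = star P * P := by
      have hs : star P = P := hP
      rw [hs, hPP]
    rw [this]; exact star_mul_self_nonneg _
  have r1 := (Matrix.posDef_add_smul_one hρ hδ).1
  have s1 := (Matrix.posDef_add_smul_one hσ hδ).1
  have s2 := (Matrix.posDef_add_smul_one (add_nonneg hσ hQ) hδ).1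
  have d1 : (δ • (1 : Matrix n n ℂ)).IsHermitian := (Matrix.PosDef.one.smul hδ).1
  have d2 : ((1 + δ) • (1 : Matrix n n ℂ)).IsHermitian :=
    (Matrix.PosDef.one.smul (by linarith : 0 < 1 + δ)).1
  rw [renyiQPosDef_eq, renyiQPosDef_eq]
  -- On the range of `P` the two pairs of arguments agree, so both traces have the same part there.
  -- On the complement all operators are scalar and the contributions are explicit, `δ` per
  -- dimension for the unfilled pair.
  have i1 := renyiMat_intertwine t α r1 s1 r1 s2 (X := P)
    (by simp only [add_mul, mul_add, hρP, hPρ, smul_mul_assoc, mul_smul_comm, one_mul, mul_one])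
    (by simp only [add_mul, mul_add, hσP, hPσ, smul_mul_assoc, mul_smul_comm, one_mul, mul_one,
          mul_sub, hPP, sub_self, add_zero])
  have i2 := renyiMat_intertwine t α r1 s1 d1 d1 (X := 1 - P)
    (by simp only [add_mul, mul_sub, hρP, smul_mul_assoc, mul_smul_comm, one_mul, mul_one]
        module)
    (by simp only [add_mul, mul_sub, hσP, smul_mul_assoc, mul_smul_comm, one_mul, mul_one]
        module)
  have i3 := renyiMat_intertwine t α r1 s2 d1 d2 (X := 1 - P)
    (by simp only [add_mul, mul_sub, hρP, smul_mul_assoc, mul_smul_comm, one_mul, mul_one]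
        module)
    (by simp only [add_mul, mul_sub, sub_mul, hσP, hPP, sub_self, add_smul, smul_mul_assoc,
          mul_smul_comm, one_mul, mul_one, one_smul, mul_add]
        module)
  rw [renyiMat_smul_one t h0 hδ hδ, ← Real.rpow_add hδ, mul_smul_comm, mul_one] at i2
  rw [renyiMat_smul_one t h0 hδ (by linarith), mul_smul_comm, mul_one] at i3
  set G := renyiMat t α (ρ + δ • (1 : Matrix n n ℂ)) (σ + δ • (1 : Matrix n n ℂ))
  set G' := renyiMat t α (ρ + δ • (1 : Matrix n n ℂ)) (σ + (1 - P) + δ • (1 : Matrix n n ℂ))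
  have e1 : reTrace G = reTrace (G' * P) + δ * reTrace (1 - P) := by
    have : G = G * P + G * (1 - P) := by rw [← mul_add]; simp
    rw [this, map_add, i1, i2, reTrace_mul_comm]
    norm_num
  have e2 : reTrace G' = reTrace (G' * P) + (δ ^ α * (1 + δ) ^ (1 - α)) * reTrace (1 - P) := by
    have : G' = G' * P + G' * (1 - P) := by rw [← mul_add]; simp
    conv_lhs => rw [this, map_add, i3]
    simp
  have e3 : reTrace (1 - P) ≤ Fintype.card n := by
    rw [← reTrace_one (n := n)]
    exact reTrace_mono (sub_le_self _ hP0)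
  have e4 := reTrace_nonneg hQ
  have e5 : 0 ≤ (δ ^ α * (1 + δ) ^ (1 - α)) * reTrace (1 - P) := by positivity
  have e6 := mul_le_mul_of_nonneg_left e3 hδ.le
  linarith

end RenyiPosDefOrder

/-! ### Separation and compactness: the minimax core -/

section Minimax

/-- The vectors strictly dominating some `(g i σ)` form an open convex set disjoint from the orthant
`v ≤ c`. The separating functional, normalised, supplies the weights; no topology on `E` enters. -/
theorem exists_weights_of_forall_exists_lt {ι E : Type*} [Fintype ι] [AddCommGroup E] [Module ℝ E]
    {S : Set E} (hS : Convex ℝ S) (hne : S.Nonempty) {g : ι → E → ℝ}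
    (hg : ∀ i, ConvexOn ℝ S (g i)) {c : ℝ} (h : ∀ σ ∈ S, ∃ i, c < g i σ) :
    ∃ w : ι → ℝ, (∀ i, 0 ≤ w i) ∧ ∑ i, w i = 1 ∧ ∀ σ ∈ S, c ≤ ∑ i, w i * g i σ := by
  classical
  set C : Set (ι → ℝ) := {v | ∃ σ ∈ S, ∀ i, g i σ < v i} with hC
  set T : Set (ι → ℝ) := {v | ∀ i, v i ≤ c} with hT
  have hCconv : Convex ℝ C := by
    rintro v ⟨σ, hσ, hv⟩ v' ⟨σ', hσ', hv'⟩ a b ha hb hab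
    refine ⟨a • σ + b • σ', hS hσ hσ' ha hb hab, fun i => ?_⟩
    refine ((hg i).2 hσ hσ' ha hb hab).trans_lt ?_
    simp only [Pi.add_apply, Pi.smul_apply, smul_eq_mul]
    rcases ha.eq_or_lt with rfl | ha'
    · have : b = 1 := by linarith
      subst this
      simpa using hv' i
    · exact add_lt_add_of_lt_of_le (mul_lt_mul_of_pos_left (hv i) ha')
        (mul_le_mul_of_nonneg_left (hv' i).le hb)
  have hCopen : IsOpen C := by
    have : C = ⋃ σ ∈ S, ⋂ i, {v : ι → ℝ | g i σ < v i} := by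
      ext v; simp [hC]
    rw [this]
    exact isOpen_biUnion fun σ _ => isOpen_iInter_of_finite fun i =>
      isOpen_lt continuous_const (continuous_apply i)
  have hTconv : Convex ℝ T := by
    intro v hv v' hv' a b ha hb hab i
    have h1 := mul_le_mul_of_nonneg_left (hv i) ha
    have h2 := mul_le_mul_of_nonneg_left (hv' i) hb
    have h3 : a * c + b * c = c := by rw [← add_mul, hab, one_mul]
    simp only [Pi.add_apply, Pi.smul_apply, smul_eq_mul]
    linarith
  have hdisj : Disjoint C T := by
    rw [Set.disjoint_left]
    rintro v ⟨σ, hσ, hv⟩ hvT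
    obtain ⟨i, hi⟩ := h σ hσ
    exact absurd (hvT i) (not_le.2 (hi.trans (hv i)))
  obtain ⟨f, u, hfC, hfT⟩ := geometric_hahn_banach_open hCconv hCopen hTconv hdisj
  set φ : ι → ℝ := fun i => -f (Pi.single i 1) with hφ
  have hf : ∀ v, f v = -∑ i, φ i * v i := by
    intro v
    conv_lhs => rw [← Finset.univ_sum_single v, map_sum]
    rw [← Finset.sum_neg_distrib]
    refine Finset.sum_congr rfl fun i _ => ?_
    have : Pi.single i (v i) = v i • (Pi.single i 1 : ι → ℝ) := by
      rw [← Pi.single_smul, smul_eq_mul, mul_one]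
    rw [this, map_smul, smul_eq_mul, hφ]
    ring
  have hφ0 : ∀ i, 0 ≤ φ i := by
    intro i
    by_contra hi
    rw [not_le] at hi
    -- Were a coefficient negative, moving down the `i`-th axis by `M` would stay in the orthant
    -- while pushing `f` below the separating level `u`.
    set M : ℝ := (|u| + |f fun _ => c| + 1) / (-φ i) with hM
    have hM0 : 0 ≤ M := div_nonneg (by positivity) (by linarith)
    have h1 := hfT ((fun _ => c) - M • Pi.single i 1) fun j => by
      simp only [Pi.sub_apply, Pi.smul_apply, smul_eq_mul]
      have : 0 ≤ M * (Pi.single i (1 : ℝ) : ι → ℝ) j :=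
        mul_nonneg hM0 (by by_cases hj : j = i <;> simp [hj])
      linarith
    have h2 : M * (-φ i) = |u| + |f fun _ => c| + 1 := by
      rw [hM, div_mul_cancel₀ _ (by linarith : (-φ i) ≠ 0)]
    rw [map_sub, map_smul, smul_eq_mul] at h1
    have h3 : f (Pi.single i 1) = -φ i := by simp [hφ]
    rw [h3, h2] at h1
    have := neg_abs_le u
    have := le_abs_self (f fun _ => c)
    linarith
  obtain ⟨σ₀, hσ₀⟩ := hne
  have hmem : ∀ σ ∈ S, ∀ η : ℝ, 0 < η → (fun i => g i σ + η) ∈ C := fun σ hσ η hη =>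
    ⟨σ, hσ, fun i => by linarith⟩
  have hcT : (fun _ => c) ∈ T := fun i => le_rfl
  have hsum : 0 < ∑ i, φ i := by
    refine lt_of_le_of_ne (Finset.sum_nonneg fun i _ => hφ0 i) fun h0 => ?_
    have hz := (Finset.sum_eq_zero_iff_of_nonneg fun i _ => hφ0 i).1 h0.symm
    have h1 := hfC _ (hmem σ₀ hσ₀ 1 one_pos)
    have h2 := hfT _ hcT
    rw [hf] at h1 h2
    simp only [fun i => hz i (Finset.mem_univ i), zero_mul, Finset.sum_const_zero] at h1 h2
    linarith
  refine ⟨fun i => φ i / ∑ j, φ j, fun i => div_nonneg (hφ0 i) hsum.le, ?_, fun σ hσ => ?_⟩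
  · rw [← Finset.sum_div, div_self hsum.ne']
  · refine le_of_forall_pos_le_add fun η hη => ?_
    have h1 := hfC _ (hmem σ hσ η hη)
    have h2 := hfT _ hcT
    rw [hf] at h1 h2
    simp only [mul_add, Finset.sum_add_distrib, ← Finset.sum_mul] at h1 h2
    have h3 : ∑ i, φ i / (∑ j, φ j) * g i σ = (∑ i, φ i * g i σ) / ∑ j, φ j := by
      rw [Finset.sum_div]
      exact Finset.sum_congr rfl fun i _ => by ring
    rw [h3, ← sub_le_iff_le_add, le_div_iff₀ hsum]
    linarith

/-- The open conditions `c < g x ε` cover the compact set; monotonicity in `ε` lets the smallest of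
finitely many `ε` serve all of them. -/
theorem exists_finset_of_forall_exists_lt {X E : Type*} [TopologicalSpace E] {S : Set E}
    (hS : IsCompact S) {g : X → ℝ → E → ℝ} (hc : ∀ x, ∀ ε > 0, ContinuousOn (g x ε) S)
    (hmono : ∀ x, ∀ σ ∈ S, ∀ ε ε', 0 < ε → ε ≤ ε' → g x ε' σ ≤ g x ε σ) {c : ℝ}
    (h : ∀ σ ∈ S, ∃ x, ∃ ε > 0, c < g x ε σ) :
    ∃ ε > 0, ∃ F : Finset X, ∀ σ ∈ S, ∃ x ∈ F, c < g x ε σ := by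
  classical
  suffices ∃ ε > 0, ∃ F : Finset X, ∀ σ ∈ S, σ ∈ S → ∃ x ∈ F, c < g x ε σ by
    obtain ⟨ε, hε, F, hF⟩ := this
    exact ⟨ε, hε, F, fun σ hσ => hF σ hσ hσ⟩
  refine hS.induction_on
    (p := fun s => ∃ ε > 0, ∃ F : Finset X, ∀ σ ∈ s, σ ∈ S → ∃ x ∈ F, c < g x ε σ)
    ⟨1, one_pos, ∅, by simp⟩ ?_ ?_ ?_
  · rintro s t hst ⟨ε, hε, F, hF⟩
    exact ⟨ε, hε, F, fun σ hσ => hF σ (hst hσ)⟩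
  · rintro s t ⟨ε, hε, F, hF⟩ ⟨ε', hε', F', hF'⟩
    refine ⟨min ε ε', lt_min hε hε', F ∪ F', ?_⟩
    rintro σ (hσ | hσ) hσS
    · obtain ⟨x, hx, hcx⟩ := hF σ hσ hσS
      exact ⟨x, Finset.mem_union_left _ hx, hcx.trans_le
        (hmono x σ hσS _ _ (lt_min hε hε') (min_le_left _ _))⟩
    · obtain ⟨x, hx, hcx⟩ := hF' σ hσ hσS
      exact ⟨x, Finset.mem_union_right _ hx, hcx.trans_le
        (hmono x σ hσS _ _ (lt_min hε hε') (min_le_right _ _))⟩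
  · intro σ hσ
    obtain ⟨x, ε, hε, hx⟩ := h σ hσ
    exact ⟨_, (hc x ε hε σ hσ).eventually (lt_mem_nhds hx), ε, hε, {x}, fun τ hτ _ =>
      ⟨x, Finset.mem_singleton_self x, hτ⟩⟩

theorem exists_finProb_of_forall_exists_lt {X E : Type*} [AddCommGroup E] [Module ℝ E] {S : Set E}
    (hS : Convex ℝ S) (hne : S.Nonempty) {g : X → E → ℝ}
    (hg : ∀ x, ConvexOn ℝ S (g x)) {c : ℝ} {F : Finset X}
    (h : ∀ σ ∈ S, ∃ x ∈ F, c < g x σ) :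
    ∃ P : FinProb X, ∀ σ ∈ S, c ≤ ∑ x ∈ P.supp, P.prob x * g x σ := by
  classical
  obtain ⟨w, hw0, hw1, hw⟩ := exists_weights_of_forall_exists_lt hS hne (g := fun i : F => g i)
    (fun i => hg i) (c := c) (fun σ hσ => by
      obtain ⟨x, hx, hc⟩ := h σ hσ
      exact ⟨⟨x, hx⟩, hc⟩)
  set p : X → ℝ := fun x => if hx : x ∈ F then w ⟨x, hx⟩ else 0 with hp
  have hpF : ∀ x, p x ≠ 0 → x ∈ F := fun x hx => by
    by_contra h
    simp [hp, h] at hx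
  have hsum : ∀ k : X → ℝ, ∑ i : F, w i * k i = ∑ x ∈ F, p x * k x := fun k => by
    rw [← Finset.sum_coe_sort F]
    exact Finset.sum_congr rfl fun i _ => by simp [hp]
  refine ⟨⟨Finsupp.onFinset F p hpF, fun x => ?_, ?_⟩, fun σ hσ => (hw σ hσ).trans (le_of_eq ?_)⟩
  · simp only [Finsupp.onFinset_apply, hp]
    split_ifs
    exacts [hw0 _, le_rfl]
  · rw [Finsupp.onFinset_sum _ (by simp)]
    have := hsum fun _ => 1
    simp only [mul_one, hw1] at this
    exact this.symm
  · rw [hsum fun x => g x σ]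
    refine (Finset.sum_subset (Finsupp.support_onFinset_subset (hf := hpF)) fun x _ hx => ?_).symm
    have : p x = 0 := by simpa using hx
    rw [this, zero_mul]

end Minimax

/-! ### The compact convex set of states, and continuity from order -/

section States

open scoped MatrixOrder Matrix.Norms.L2Operator

variable {n : Type*} [Fintype n] [DecidableEq n]

/-- The set of density operators. -/
def stateSet (n : Type*) [Fintype n] : Set (Matrix n n ℂ) := {σ | σ.PosSemidef ∧ σ.trace = 1}

theorem convex_stateSet : Convex ℝ (stateSet n) := by
  rintro σ ⟨hσ, h1⟩ τ ⟨hτ, h2⟩ a b ha hb hab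
  rw [← Matrix.nonneg_iff_posSemidef] at hσ hτ
  refine ⟨Matrix.nonneg_iff_posSemidef.1 (add_nonneg (smul_nonneg ha hσ) (smul_nonneg hb hτ)), ?_⟩
  rw [Matrix.trace_add, Matrix.trace_smul, Matrix.trace_smul, h1, h2, ← add_smul, hab, one_smul]

theorem stateSet_nonempty [Nonempty n] : (stateSet n).Nonempty := by
  refine ⟨(Fintype.card n : ℝ)⁻¹ • 1, (Matrix.PosDef.one.smul (by
    have := Fintype.card_pos (α := n)
    positivity)).posSemidef, ?_⟩
  rw [Matrix.trace_smul, Matrix.trace_one]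
  have : (Fintype.card n : ℂ) ≠ 0 := Nat.cast_ne_zero.2 Fintype.card_ne_zero
  simp [this]

theorem le_one_of_mem_stateSet {σ : Matrix n n ℂ} (hσ : σ ∈ stateSet n) : σ ≤ 1 := by
  have := le_algebraMap_iff_spectrum_le (A := Matrix n n ℂ) (r := (1 : ℝ)) (a := σ)
    (ha := hσ.1.1)
  rw [map_one] at this
  rw [this]
  intro x hx
  rw [hσ.1.1.spectrum_real_eq_range_eigenvalues] at hx
  obtain ⟨i, rfl⟩ := hx
  have h2 : ∑ j, hσ.1.1.eigenvalues j = 1 := by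
    have := hσ.2.symm.trans hσ.1.1.trace_eq_sum_eigenvalues
    have := congrArg Complex.re this
    simpa using this.symm
  rw [← h2]
  exact Finset.single_le_sum (fun j _ => hσ.1.eigenvalues_nonneg j) (Finset.mem_univ i)

theorem isCompact_stateSet : IsCompact (stateSet n) := by
  have : ProperSpace (Matrix n n ℂ) := FiniteDimensional.proper ℂ _
  refine Metric.isCompact_of_isClosed_isBounded ?_ ?_
  · have : stateSet n = {σ | 0 ≤ σ} ∩ {σ | σ.trace = 1} := by
      ext σ; simp [stateSet, Matrix.nonneg_iff_posSemidef]
    rw [this]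
    exact IsClosed.inter (CStarAlgebra.isClosed_nonneg) (isClosed_eq (by fun_prop) continuous_const)
  · refine (Metric.isBounded_closedBall (x := (0 : Matrix n n ℂ)) (r := 1)).subset fun σ hσ => ?_
    rw [mem_closedBall_zero_iff,
      CStarAlgebra.norm_le_one_iff_of_nonneg σ (Matrix.nonneg_iff_posSemidef.2 hσ.1)]
    exact le_one_of_mem_stateSet hσ

/-- Since `σ + εI ≤ (1 + ‖σ - τ‖ / ε)(τ + εI)`, antitonicity and the scaling law bound the variation
of `F` by `k log (1 + ‖σ - τ‖ / ε)`. Continuity of the functional calculus is never needed. -/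
theorem continuousOn_of_antitone_of_homogeneous {F : Matrix n n ℂ → ℝ} {k : ℝ}
    (hF : ∀ σ σ' : Matrix n n ℂ, σ.PosDef → σ ≤ σ' → F σ' ≤ F σ)
    (hs : ∀ σ : Matrix n n ℂ, σ.PosDef → ∀ c : ℝ, 0 < c → F (c • σ) = F σ - k * Real.log c)
    {ε : ℝ} (hε : 0 < ε) :
    ContinuousOn (fun σ => F (σ + ε • (1 : Matrix n n ℂ))) {σ | 0 ≤ σ} := by
  have key : ∀ σ τ : Matrix n n ℂ, 0 ≤ σ → 0 ≤ τ → F (τ + ε • (1 : Matrix n n ℂ)) -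
      k * Real.log (1 + ‖σ - τ‖ / ε) ≤ F (σ + ε • (1 : Matrix n n ℂ)) := by
    intro σ τ hσ hτ
    have h1 : σ - τ ≤ ‖σ - τ‖ • (1 : Matrix n n ℂ) := by
      have := IsSelfAdjoint.le_algebraMap_norm_self (a := σ - τ)
        ((IsSelfAdjoint.of_nonneg hσ).sub (IsSelfAdjoint.of_nonneg hτ))
      rwa [Algebra.algebraMap_eq_smul_one] at this
    have h2 : σ + ε • (1 : Matrix n n ℂ) ≤ (1 + ‖σ - τ‖ / ε) • (τ + ε • (1 : Matrix n n ℂ)) := by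
      have h3 : 0 ≤ (‖σ - τ‖ / ε) • τ := smul_nonneg (by positivity) hτ
      have h4 : (1 + ‖σ - τ‖ / ε) • (τ + ε • (1 : Matrix n n ℂ)) =
          (τ + ‖σ - τ‖ • (1 : Matrix n n ℂ)) + ε • (1 : Matrix n n ℂ) + (‖σ - τ‖ / ε) • τ := by
        rw [smul_add, smul_smul, add_mul, div_mul_cancel₀ _ hε.ne']
        module
      rw [h4]
      refine le_trans ?_ (le_add_of_nonneg_right h3)
      exact add_le_add (by rw [← sub_le_iff_le_add']; exact h1) le_rfl
    have h5 := hF _ _ (Matrix.posDef_add_smul_one hσ hε) h2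
    rwa [hs _ (Matrix.posDef_add_smul_one hτ hε) _ (by positivity)] at h5
  intro σ hσ
  have ht : Filter.Tendsto (fun τ : Matrix n n ℂ => k * Real.log (1 + ‖σ - τ‖ / ε))
      (nhdsWithin σ {σ | 0 ≤ σ}) (nhds 0) := by
    have hcont : ContinuousAt (fun τ : Matrix n n ℂ => k * Real.log (1 + ‖σ - τ‖ / ε)) σ := by
      refine ContinuousAt.mul continuousAt_const (ContinuousAt.log (by fun_prop) (by simp))
    have := hcont.tendsto
    simp only [sub_self, norm_zero, zero_div, add_zero, Real.log_one, mul_zero] at this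
    exact this.mono_left nhdsWithin_le_nhds
  have ha := (tendsto_const_nhds (x := F (σ + ε • (1 : Matrix n n ℂ)))).sub ht
  have hb := (tendsto_const_nhds (x := F (σ + ε • (1 : Matrix n n ℂ)))).add ht
  rw [sub_zero] at ha
  rw [add_zero] at hb
  refine tendsto_of_tendsto_of_tendsto_of_le_of_le' ha hb ?_ ?_
  · filter_upwards [self_mem_nhdsWithin] with τ hτ
    have := key τ σ hτ hσ
    rwa [norm_sub_rev] at this
  · filter_upwards [self_mem_nhdsWithin] with τ hτ
    have := key σ τ hσ hτ
    linarith

end States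

/-! ### Support projections -/

section SupportProjection

set_option linter.unusedSectionVars false

open scoped MatrixOrder

variable {n : Type*} [Fintype n] [DecidableEq n]

/-- The support projection of a Hermitian matrix. -/
noncomputable def suppProj (σ : Matrix n n ℂ) : Matrix n n ℂ :=
  cfc (fun x : ℝ => if x = 0 then 0 else 1) σ

theorem isHermitian_suppProj (σ : Matrix n n ℂ) : (suppProj σ).IsHermitian :=
  Matrix.isHermitian_cfc _ _

theorem suppProj_mul_self (σ : Matrix n n ℂ) : suppProj σ * suppProj σ = suppProj σ := by
  rw [suppProj, ← Matrix.cfc_mul_fun]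
  exact cfc_congr fun x _ => by by_cases h : x = 0 <;> simp [h]

theorem mul_suppProj {σ : Matrix n n ℂ} (hσ : σ.IsHermitian) : σ * suppProj σ = σ := by
  have := Matrix.cfc_mul_fun (A := σ) (fun x => x) (fun x : ℝ => if x = 0 then 0 else 1)
  rw [Matrix.cfc_id_fun hσ] at this
  rw [suppProj, ← this]
  conv_rhs => rw [← Matrix.cfc_id_fun hσ]
  exact cfc_congr fun x _ => by by_cases h : x = 0 <;> simp [h]

theorem suppProj_mul {σ : Matrix n n ℂ} (hσ : σ.IsHermitian) : suppProj σ * σ = σ := by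
  have := congrArg star (mul_suppProj hσ)
  rwa [star_mul, (isHermitian_suppProj σ).star_eq, hσ.star_eq] at this

theorem suppProj_eq_mul {σ : Matrix n n ℂ} (hσ : σ.IsHermitian) :
    suppProj σ = σ * cfc (fun x : ℝ => x⁻¹) σ := by
  have := Matrix.cfc_mul_fun (A := σ) (fun x => x) (fun x : ℝ => x⁻¹)
  rw [Matrix.cfc_id_fun hσ] at this
  rw [← this]
  exact cfc_congr fun x _ => by by_cases h : x = 0 <;> simp [h]

theorem one_sub_suppProj {σ : Matrix n n ℂ} (hσ : σ.IsHermitian) :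
    1 - suppProj σ = cfc (fun x : ℝ => if x = 0 then 1 else 0) σ := by
  rw [sub_eq_iff_eq_add, suppProj, ← Matrix.cfc_add_fun, ← Matrix.cfc_one_fun hσ]
  exact cfc_congr fun x _ => by by_cases h : x = 0 <;> simp [h]

theorem one_sub_suppProj_nonneg {σ : Matrix n n ℂ} (hσ : σ.IsHermitian) : 0 ≤ 1 - suppProj σ := by
  rw [one_sub_suppProj hσ]
  exact cfc_nonneg fun x _ => by split_ifs <;> norm_num

/-- Filling the kernel gives a positive definite substitute that agrees with `σ` on its support. -/
theorem posDef_add_one_sub_suppProj {σ : Matrix n n ℂ} (hσ : 0 ≤ σ) :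
    (σ + (1 - suppProj σ)).PosDef := by
  have hσ' : σ.IsHermitian := IsSelfAdjoint.of_nonneg hσ
  have := Matrix.cfc_add_fun (A := σ) (fun x => x) (fun x : ℝ => if x = 0 then 1 else 0)
  rw [Matrix.cfc_id_fun hσ', ← one_sub_suppProj hσ'] at this
  rw [← this]
  refine Matrix.posDef_cfc hσ' fun x hx => ?_
  have h0 := Matrix.spectrum_nonneg hσ hx
  by_cases h : x = 0
  · simp [h]
  · simpa [h] using lt_of_le_of_ne h0 (Ne.symm h)

/-- Inclusion of supports becomes an identity that can be multiplied and conjugated. The converse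
uses `x⁻¹` with `0⁻¹ = 0`, which is the pseudo-inverse of `σ`. -/
theorem range_mulVecLin_le_iff {ρ σ : Matrix n n ℂ} (hσ : σ.IsHermitian) :
    LinearMap.range ρ.mulVecLin ≤ LinearMap.range σ.mulVecLin ↔ suppProj σ * ρ = ρ := by
  constructor
  · intro h
    refine Matrix.ext_of_mulVec_single fun i => ?_
    obtain ⟨w, hw⟩ := h (LinearMap.mem_range_self ρ.mulVecLin (Pi.single i 1))
    rw [Matrix.mulVecLin_apply, Matrix.mulVecLin_apply] at hw
    rw [← Matrix.mulVec_mulVec, ← hw, Matrix.mulVec_mulVec, suppProj_mul hσ]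
  · rintro h _ ⟨v, rfl⟩
    refine ⟨(cfc (fun x : ℝ => x⁻¹) σ * ρ).mulVec v, ?_⟩
    rw [Matrix.mulVecLin_apply, Matrix.mulVecLin_apply, Matrix.mulVec_mulVec, ← mul_assoc,
      ← suppProj_eq_mul hσ, h]

theorem mul_suppProj_of_suppProj_mul {ρ σ : Matrix n n ℂ} (hρ : ρ.IsHermitian)
    (h : suppProj σ * ρ = ρ) : ρ * suppProj σ = ρ := by
  have := congrArg star h
  rwa [star_mul, (isHermitian_suppProj σ).star_eq, hρ.star_eq] at this

theorem reTrace_mul_one_sub_suppProj_pos {ρ σ : Matrix n n ℂ} (hρ : 0 ≤ ρ)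
    (h : suppProj σ * ρ ≠ ρ) : 0 < reTrace (ρ * (1 - suppProj σ)) := by
  obtain ⟨C, rfl⟩ := CStarAlgebra.nonneg_iff_eq_star_mul_self.1 hρ
  set Q := 1 - suppProj σ with hQ
  have hQs : star Q = Q := by rw [hQ, star_sub, star_one, (isHermitian_suppProj σ).star_eq]
  have hQQ : Q * Q = Q := by
    rw [hQ, sub_mul, mul_sub, mul_sub, suppProj_mul_self]; simp
  have e : reTrace (star C * C * Q) = reTrace (star (C * Q) * (C * Q)) := by
    rw [star_mul, hQs, mul_assoc Q, reTrace_mul_comm Q]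
    simp only [mul_assoc, hQQ]
  rw [e]
  refine reTrace_pos (star_mul_self_nonneg _) fun h0 => h ?_
  have h1 : C * Q = 0 := by
    rw [Matrix.star_eq_conjTranspose, Matrix.conjTranspose_mul_self_eq_zero] at h0
    exact h0
  have h2 : Q * star C = 0 := by
    have := congrArg star h1
    rwa [star_mul, hQs, star_zero] at this
  have h3 : Q * (star C * C) = 0 := by rw [← mul_assoc, h2, zero_mul]
  rw [hQ, sub_mul, one_mul, sub_eq_zero] at h3
  exact h3.symm

theorem matLog_add_smul_one {σ : Matrix n n ℂ} (hσ : σ.IsHermitian) (ε : ℝ) :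
    matLog (σ + ε • (1 : Matrix n n ℂ)) = cfc (fun x : ℝ => Real.log (x + ε)) σ := by
  have e1 : σ + ε • (1 : Matrix n n ℂ) = cfc (fun x : ℝ => x + ε) σ := by
    rw [Matrix.cfc_add_fun (fun x => x) (fun _ => ε), Matrix.cfc_id_fun hσ,
      cfc_const ε σ hσ.isSelfAdjoint, Algebra.algebraMap_eq_smul_one]
  rw [e1, matLog, ← cfc_comp' _ _ σ ?_ (σ.continuousOn_spectrum _) hσ.isSelfAdjoint]
  exact ((Matrix.finite_real_spectrum (A := σ)).image _).continuousOn _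

/-- On the kernel `log (x + ε) = log ε`; elsewhere `log (x + ε) ≤ x` as `ε ≤ 1`. If `ρ` has weight
on the kernel, the bound tends to `-∞` with `ε`. -/
theorem reTrace_mul_matLog_add_smul_one_le {ρ σ : Matrix n n ℂ} (hρ : 0 ≤ ρ) (hσ : 0 ≤ σ) {ε : ℝ}
    (h0 : 0 < ε) (h1 : ε ≤ 1) : reTrace (ρ * matLog (σ + ε • (1 : Matrix n n ℂ))) ≤
      reTrace (ρ * σ) + Real.log ε * reTrace (ρ * (1 - suppProj σ)) := by
  have hσ' : σ.IsHermitian := IsSelfAdjoint.of_nonneg hσ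
  have h : matLog (σ + ε • (1 : Matrix n n ℂ)) ≤ σ + Real.log ε • (1 - suppProj σ) := by
    have e : σ + Real.log ε • (1 - suppProj σ) =
        cfc (fun x : ℝ => x + Real.log ε * (if x = 0 then 1 else 0)) σ := by
      rw [Matrix.cfc_add_fun (fun x => x), Matrix.cfc_const_mul_fun _ _ (fun x : ℝ =>
        if x = 0 then 1 else 0), Matrix.cfc_id_fun hσ', one_sub_suppProj hσ']
    rw [e, matLog_add_smul_one hσ']
    refine cfc_mono (fun x hx => ?_) (σ.continuousOn_spectrum _) (σ.continuousOn_spectrum _)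
    have hx0 := Matrix.spectrum_nonneg hσ hx
    by_cases hx' : x = 0
    · simp [hx']
    · simp only [hx', if_false, mul_zero, add_zero]
      have := Real.log_le_sub_one_of_pos (by linarith : 0 < x + ε)
      linarith
  have := reTrace_mul_mono_right hρ h
  rwa [mul_add, mul_smul_comm, map_add, map_smul, smul_eq_mul] at this

end SupportProjection

/-! ### Existence and form of the limit defining `Q_α` -/

section RenyiLimit

set_option linter.unusedSectionVars false

open scoped MatrixOrder
open Filter Topology

variable {n : Type*} [Fintype n] [DecidableEq n]

theorem renyiQ_eq_of_tendsto {t : RenyiFamily} {α : ℝ} {ρ σ : Matrix n n ℂ} {L : ENNReal}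
    (h : Tendsto (fun ε : ℝ => ENNReal.ofReal
      (renyiQPosDef t α (ρ + ε • (1 : Matrix n n ℂ)) (σ + ε • (1 : Matrix n n ℂ)))) (𝓝[>] 0)
      (𝓝 L)) : renyiQ t α ρ σ = L := h.limUnder_eq

variable [Nonempty n]

theorem tendsto_renyiQ_of_lt_one {t : RenyiFamily} {α : ℝ} (h0 : 0 < α) (h1 : α < 1)
    (hs : t = RenyiFamily.sandwiched → 1 / 2 ≤ α) {ρ σ : Matrix n n ℂ} (hρ : 0 ≤ ρ) (hσ : 0 ≤ σ) :
    Tendsto (fun ε : ℝ => ENNReal.ofReal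
      (renyiQPosDef t α (ρ + ε • (1 : Matrix n n ℂ)) (σ + ε • (1 : Matrix n n ℂ)))) (𝓝[>] 0)
      (𝓝 (renyiQ t α ρ σ)) ∧
    renyiQ t α ρ σ = sInf ((fun ε : ℝ => ENNReal.ofReal (renyiQPosDef t α
      (ρ + ε • (1 : Matrix n n ℂ)) (σ + ε • (1 : Matrix n n ℂ)))) '' Set.Ioi 0) := by
  have hm : MonotoneOn (fun ε : ℝ => ENNReal.ofReal (renyiQPosDef t α
      (ρ + ε • (1 : Matrix n n ℂ)) (σ + ε • (1 : Matrix n n ℂ)))) (Set.Ioi 0) := by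
    intro ε hε ε' hε' h
    have a1 := Matrix.posDef_add_smul_one hρ hε
    have a2 := Matrix.posDef_add_smul_one hσ hε
    have a3 := Matrix.posDef_add_smul_one hσ hε'
    exact ENNReal.ofReal_le_ofReal
      ((renyiQPosDef_mono_right h0 h1 hs a1 a2 (add_smul_one_mono σ h)).trans
        (renyiQPosDef_mono_left h0 h1 a1 a3 (add_smul_one_mono ρ h)))
  have ht := hm.tendsto_nhdsGT (OrderBot.bddBelow _)
  rw [renyiQ_eq_of_tendsto ht]
  exact ⟨ht, rfl⟩

/-- The limit `lim_{δ ↘ 0} Q_α(ρ + δ I‖σ)` for positive definite `σ`. -/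
noncomputable def renyiQLim (t : RenyiFamily) (α : ℝ) (ρ σ : Matrix n n ℂ) : ℝ :=
  sInf ((fun δ : ℝ => renyiQPosDef t α (ρ + δ • (1 : Matrix n n ℂ)) σ) '' Set.Ioi 0)

theorem tendsto_renyiQLim (t : RenyiFamily) {α : ℝ} (h0 : 0 < α) {ρ σ : Matrix n n ℂ} (hρ : 0 ≤ ρ)
    (hσ : σ.PosDef) : Tendsto (fun δ : ℝ => renyiQPosDef t α (ρ + δ • (1 : Matrix n n ℂ)) σ)
      (𝓝[>] 0) (𝓝 (renyiQLim t α ρ σ)) := by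
  refine MonotoneOn.tendsto_nhdsGT (fun δ hδ δ' _ h =>
    renyiQPosDef_add_smul_one_mono t h0 hρ hσ hδ h) ⟨0, ?_⟩
  rintro _ ⟨δ, hδ, rfl⟩
  exact (renyiQPosDef_pos t α (Matrix.posDef_add_smul_one hρ hδ) hσ).le

theorem renyiQLim_pos (t : RenyiFamily) {α : ℝ} (h1 : 1 < α) {ρ σ : Matrix n n ℂ} (hρ : 0 ≤ ρ)
    (htr : reTrace ρ = 1) (hσ : σ.PosDef) : 0 < renyiQLim t α ρ σ := by
  obtain ⟨κ, hκ, h⟩ := exists_pos_le_renyiQPosDef t h1 hσ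
  refine hκ.trans_le (ge_of_tendsto (tendsto_renyiQLim t (by linarith) hρ hσ) ?_)
  filter_upwards [self_mem_nhdsWithin] with δ hδ
  refine h _ (Matrix.posDef_add_smul_one hρ hδ) ?_
  rw [map_add, map_smul, reTrace_one, htr, smul_eq_mul]
  have : 0 ≤ δ * (Fintype.card n : ℝ) := mul_nonneg (le_of_lt hδ) (Nat.cast_nonneg _)
  linarith

theorem renyiQLim_antitone {t : RenyiFamily} {α : ℝ} (h1 : 1 < α)
    (hp : t = RenyiFamily.petz → α ≤ 2) {ρ σ σ' : Matrix n n ℂ} (hρ : 0 ≤ ρ)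
    (hσ : σ.PosDef) (h : σ ≤ σ') : renyiQLim t α ρ σ' ≤ renyiQLim t α ρ σ := by
  have hσ' := hσ.posDef_of_le h
  refine le_of_tendsto_of_tendsto (tendsto_renyiQLim t (by linarith) hρ hσ')
    (tendsto_renyiQLim t (by linarith) hρ hσ) ?_
  filter_upwards [self_mem_nhdsWithin] with δ hδ
  exact renyiQPosDef_antitone_right h1 hp (Matrix.posDef_add_smul_one hρ hδ) hσ h

theorem renyiQLim_smul (t : RenyiFamily) {α : ℝ} (h0 : 0 < α) {ρ σ : Matrix n n ℂ} (hρ : 0 ≤ ρ)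
    (hσ : σ.PosDef) {c : ℝ} (hc : 0 < c) :
    renyiQLim t α ρ (c • σ) = c ^ (1 - α) * renyiQLim t α ρ σ := by
  refine tendsto_nhds_unique (tendsto_renyiQLim t h0 hρ (hσ.smul hc))
    (((tendsto_renyiQLim t h0 hρ hσ).const_mul (c ^ (1 - α))).congr' ?_)
  filter_upwards [self_mem_nhdsWithin] with δ hδ
  exact (renyiQPosDef_smul_right t h0 (Matrix.posDef_add_smul_one hρ hδ) hσ hc).symm

theorem log_renyiQLim_convex {t : RenyiFamily} {α : ℝ} (h1 : 1 < α)
    (hp : t = RenyiFamily.petz → α ≤ 2) {ρ σ₁ σ₂ : Matrix n n ℂ} (hρ : 0 ≤ ρ)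
    (htr : reTrace ρ = 1)
    (hσ₁ : σ₁.PosDef) (hσ₂ : σ₂.PosDef) {a b : ℝ} (ha : 0 ≤ a) (hb : 0 ≤ b) (hab : a + b = 1) :
    Real.log (renyiQLim t α ρ (a • σ₁ + b • σ₂)) ≤
      a * Real.log (renyiQLim t α ρ σ₁) + b * Real.log (renyiQLim t α ρ σ₂) := by
  have h0 : 0 < α := by linarith
  have hσ := hσ₁.convex_combination hσ₂ ha hb hab
  refine le_of_tendsto_of_tendsto
    ((tendsto_renyiQLim t h0 hρ hσ).log (renyiQLim_pos t h1 hρ htr hσ).ne')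
    ((((tendsto_renyiQLim t h0 hρ hσ₁).log (renyiQLim_pos t h1 hρ htr hσ₁).ne').const_mul a).add
      (((tendsto_renyiQLim t h0 hρ hσ₂).log (renyiQLim_pos t h1 hρ htr hσ₂).ne').const_mul b)) ?_
  filter_upwards [self_mem_nhdsWithin] with δ hδ
  exact log_renyiQPosDef_convex h1 hp (Matrix.posDef_add_smul_one hρ hδ) hσ₁ hσ₂ ha hb hab

/-- Together with `σ ≤ σ + δI` this squeezes the shifted operator between multiples of `σ`;
antitonicity and scaling then give limits as `δ` tends to zero. -/
theorem Matrix.PosDef.exists_add_smul_one_le {σ : Matrix n n ℂ} (hσ : σ.PosDef) :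
    ∃ c : ℝ, 0 < c ∧ ∀ δ : ℝ, 0 ≤ δ → σ + δ • (1 : Matrix n n ℂ) ≤ (1 + δ / c) • σ := by
  obtain ⟨c, hc, h⟩ := hσ.smul_one_le
  refine ⟨c, hc, fun δ hδ => ?_⟩
  have := smul_le_smul_of_nonneg_left h (div_nonneg hδ hc.le)
  rw [smul_smul, div_mul_cancel₀ _ hc.ne'] at this
  rw [add_smul, one_smul]
  exact add_le_add le_rfl this

theorem tendsto_one_add_div_rpow (c p : ℝ) :
    Tendsto (fun δ : ℝ => (1 + δ / c) ^ p) (𝓝[>] 0) (𝓝 1) := by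
  have h : ContinuousAt (fun δ : ℝ => (1 + δ / c) ^ p) 0 :=
    ContinuousAt.rpow_const (by fun_prop) (by simp)
  have := h.tendsto
  simp only [zero_div, add_zero, Real.one_rpow] at this
  exact this.mono_left nhdsWithin_le_nhds

theorem tendsto_renyiQLim_add_smul_one {t : RenyiFamily} {α : ℝ} (h1 : 1 < α)
    (hp : t = RenyiFamily.petz → α ≤ 2) {ρ σ : Matrix n n ℂ} (hρ : 0 ≤ ρ) (hσ : σ.PosDef) :
    Tendsto (fun ε : ℝ => renyiQLim t α ρ (σ + ε • (1 : Matrix n n ℂ))) (𝓝[>] 0)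
      (𝓝 (renyiQLim t α ρ σ)) := by
  have h0 : 0 < α := by linarith
  obtain ⟨c, hc, h⟩ := hσ.exists_add_smul_one_le
  have hl := (tendsto_one_add_div_rpow c (1 - α)).mul_const (renyiQLim t α ρ σ)
  rw [one_mul] at hl
  refine tendsto_of_tendsto_of_tendsto_of_le_of_le' hl tendsto_const_nhds ?_ ?_
  all_goals filter_upwards [self_mem_nhdsWithin] with δ hδ
  · have hδ0 : 0 < δ := hδ
    rw [← renyiQLim_smul t h0 hρ hσ (by positivity)]
    exact renyiQLim_antitone h1 hp hρ (Matrix.posDef_add_smul_one hσ.nonneg hδ) (h δ hδ0.le)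
  · refine renyiQLim_antitone h1 hp hρ hσ (le_add_of_nonneg_right ?_)
    exact smul_nonneg (le_of_lt hδ) zero_le_one

theorem tendsto_renyiQPosDef_add_smul_one {t : RenyiFamily} {α : ℝ} (h1 : 1 < α)
    (hp : t = RenyiFamily.petz → α ≤ 2) {ρ σ : Matrix n n ℂ} (hρ : 0 ≤ ρ) (hσ : σ.PosDef) :
    Tendsto (fun δ : ℝ => renyiQPosDef t α (ρ + δ • (1 : Matrix n n ℂ))
      (σ + δ • (1 : Matrix n n ℂ))) (𝓝[>] 0) (𝓝 (renyiQLim t α ρ σ)) := by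
  have h0 : 0 < α := by linarith
  obtain ⟨c, hc, h⟩ := hσ.exists_add_smul_one_le
  have hl := (tendsto_one_add_div_rpow c (1 - α)).mul (tendsto_renyiQLim t h0 hρ hσ)
  rw [one_mul] at hl
  refine tendsto_of_tendsto_of_tendsto_of_le_of_le' hl (tendsto_renyiQLim t h0 hρ hσ) ?_ ?_
  all_goals filter_upwards [self_mem_nhdsWithin] with δ hδ
  · have hδ0 : 0 < δ := hδ
    have hρ' := Matrix.posDef_add_smul_one hρ hδ
    rw [← renyiQPosDef_smul_right t h0 hρ' hσ (by positivity)]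
    exact renyiQPosDef_antitone_right h1 hp hρ' (Matrix.posDef_add_smul_one hσ.nonneg hδ)
      (h δ hδ0.le)
  · refine renyiQPosDef_antitone_right h1 hp (Matrix.posDef_add_smul_one hρ hδ) hσ
      (le_add_of_nonneg_right ?_)
    exact smul_nonneg (le_of_lt hδ) zero_le_one

theorem neg_reTrace_mul_matLog_le_renyiQLim (t : RenyiFamily) {α : ℝ} (h1 : 1 < α)
    {ρ σ : Matrix n n ℂ} (hρ : 0 ≤ ρ) (hσ : σ.PosDef) :
    -(α - 1) * (reTrace (ρ * matLog σ) + Fintype.card n) ≤ renyiQLim t α ρ σ := by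
  have hl : Tendsto (fun δ : ℝ => -(α - 1) * (reTrace (ρ * matLog σ) +
      δ * reTrace (matLog σ) + Fintype.card n)) (𝓝[>] 0)
      (𝓝 (-(α - 1) * (reTrace (ρ * matLog σ) + Fintype.card n))) := by
    have h : ContinuousAt (fun δ : ℝ => -(α - 1) * (reTrace (ρ * matLog σ) +
      δ * reTrace (matLog σ) + Fintype.card n)) 0 := by fun_prop
    have := h.tendsto
    rw [zero_mul, add_zero] at this
    exact this.mono_left nhdsWithin_le_nhds
  refine le_of_tendsto_of_tendsto hl (tendsto_renyiQLim t (by linarith) hρ hσ) ?_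
  filter_upwards [self_mem_nhdsWithin] with δ hδ
  have := neg_reTrace_mul_matLog_le_renyiQPosDef t h1 (Matrix.posDef_add_smul_one hρ hδ) hσ
  simpa only [add_mul, smul_mul_assoc, one_mul, map_add, map_smul, smul_eq_mul] using this

/-- The shift of `ρ` raises `Q_α` and the shift of `σ` lowers it, so the joint limit is not
monotone. Freezing the shift of `σ` at `ε ≥ δ` gives the lower bound. For nested supports the upper
bound follows by filling the kernel of `σ`, at a cost of at most `δ dim`. -/
theorem tendsto_renyiQ_of_one_lt {t : RenyiFamily} {α : ℝ} (h1 : 1 < α)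
    (hp : t = RenyiFamily.petz → α ≤ 2) {ρ σ : Matrix n n ℂ} (hρ : 0 ≤ ρ) (hσ : 0 ≤ σ) :
    Tendsto (fun ε : ℝ => ENNReal.ofReal
      (renyiQPosDef t α (ρ + ε • (1 : Matrix n n ℂ)) (σ + ε • (1 : Matrix n n ℂ)))) (𝓝[>] 0)
      (𝓝 (⨆ ε : Set.Ioi (0 : ℝ), ENNReal.ofReal
        (renyiQLim t α ρ (σ + (ε : ℝ) • (1 : Matrix n n ℂ))))) := by
  have h0 : 0 < α := by linarith
  have hρ' : ρ.IsHermitian := IsSelfAdjoint.of_nonneg hρ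
  have hσ' : σ.IsHermitian := IsSelfAdjoint.of_nonneg hσ
  refine tendsto_order.2 ⟨fun a ha => ?_, fun b hb => ?_⟩
  · obtain ⟨ε, hε⟩ := lt_iSup_iff.1 ha
    have hε0 : (0 : ℝ) < ε := ε.2
    have hl := ENNReal.tendsto_ofReal
      (tendsto_renyiQLim t h0 hρ (Matrix.posDef_add_smul_one hσ hε0))
    filter_upwards [hl.eventually (lt_mem_nhds hε), self_mem_nhdsWithin,
      mem_nhdsWithin_of_mem_nhds (Iic_mem_nhds hε0)] with δ hδ hδ0 hδε
    exact hδ.trans_le (ENNReal.ofReal_le_ofReal (renyiQPosDef_antitone_right h1 hp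
      (Matrix.posDef_add_smul_one hρ hδ0) (Matrix.posDef_add_smul_one hσ hδ0)
      (add_smul_one_mono σ hδε)))
  · by_cases hsupp : suppProj σ * ρ = ρ
    · have hτ := posDef_add_one_sub_suppProj hσ
      have hQ := one_sub_suppProj_nonneg hσ'
      have hle : ENNReal.ofReal (renyiQLim t α ρ (σ + (1 - suppProj σ))) ≤
          ⨆ ε : Set.Ioi (0 : ℝ), ENNReal.ofReal
            (renyiQLim t α ρ (σ + (ε : ℝ) • (1 : Matrix n n ℂ))) := by
        refine le_of_tendsto (ENNReal.tendsto_ofReal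
          (tendsto_renyiQLim_add_smul_one h1 hp hρ hτ)) ?_
        filter_upwards [self_mem_nhdsWithin] with ε hε
        refine le_trans (ENNReal.ofReal_le_ofReal ?_)
          (le_iSup (fun ε : Set.Ioi (0 : ℝ) => ENNReal.ofReal
            (renyiQLim t α ρ (σ + (ε : ℝ) • (1 : Matrix n n ℂ)))) ⟨ε, hε⟩)
        exact renyiQLim_antitone h1 hp hρ (Matrix.posDef_add_smul_one hσ hε)
          (add_le_add (le_add_of_nonneg_right hQ) le_rfl)
      have hd : Tendsto (fun δ : ℝ => δ * (Fintype.card n : ℝ)) (𝓝[>] 0) (𝓝 0) := by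
        have h : ContinuousAt (fun δ : ℝ => δ * (Fintype.card n : ℝ)) 0 := by fun_prop
        have := h.tendsto
        rw [zero_mul] at this
        exact this.mono_left nhdsWithin_le_nhds
      have hl := (tendsto_renyiQPosDef_add_smul_one h1 hp hρ hτ).add hd
      rw [add_zero] at hl
      filter_upwards [(ENNReal.tendsto_ofReal hl).eventually (gt_mem_nhds (hle.trans_lt hb)),
        self_mem_nhdsWithin] with δ hδ hδ0
      refine lt_of_le_of_lt (ENNReal.ofReal_le_ofReal ?_) hδ
      exact renyiQPosDef_le_of_projection t h0 hρ hσ (isHermitian_suppProj σ)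
        (suppProj_mul_self σ) (mul_suppProj_of_suppProj_mul hρ' hsupp) hsupp (mul_suppProj hσ')
        (suppProj_mul hσ') hδ0
    -- Without nested supports the supremum is `+∞`: the entropy bound grows like `-(α - 1) p log ε`
    -- with `p > 0`.
    · exfalso
      refine absurd hb (not_lt.2 (le_of_le_of_eq le_top (Eq.symm ?_)))
      have hpos := reTrace_mul_one_sub_suppProj_pos hρ hsupp
      rw [iSup_eq_top]
      intro b hb
      lift b to NNReal using hb.ne
      set p := reTrace (ρ * (1 - suppProj σ))
      set M := reTrace (ρ * σ) + Fintype.card n with hM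
      have hlim : Tendsto (fun ε : ℝ => -(α - 1) * (M + Real.log ε * p)) (𝓝[>] 0) atTop := by
        have h2 : Tendsto (fun ε : ℝ => M + Real.log ε * p) (𝓝[>] 0) atBot :=
          tendsto_atBot_add_const_left _ _ (Real.tendsto_log_nhdsGT_zero.atBot_mul_const hpos)
        exact h2.const_mul_atBot_of_neg (by linarith)
      have hev : ∀ᶠ ε : ℝ in 𝓝[>] 0, (b : ℝ) < -(α - 1) * (M + Real.log ε * p) ∧
          ε ∈ Set.Ioi 0 ∧ ε ∈ Set.Iic 1 := by
        filter_upwards [hlim.eventually (eventually_gt_atTop (b : ℝ)), self_mem_nhdsWithin,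
          mem_nhdsWithin_of_mem_nhds (Iic_mem_nhds one_pos)] with ε h2 h3 h4
        exact ⟨h2, h3, h4⟩
      obtain ⟨ε, hε, hε0, hε1⟩ := hev.exists
      refine ⟨⟨ε, hε0⟩, ?_⟩
      rw [← ENNReal.ofReal_coe_nnreal]
      have hε0' : 0 < ε := hε0
      have k1 := neg_reTrace_mul_matLog_le_renyiQLim t h1 hρ (Matrix.posDef_add_smul_one hσ hε0')
      have k2 := reTrace_mul_matLog_add_smul_one_le hρ hσ hε0' hε1
      have k3 : (b : ℝ) < renyiQLim t α ρ (σ + ε • (1 : Matrix n n ℂ)) := by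
        refine hε.trans_le (le_trans ?_ k1)
        rw [hM]
        have := mul_le_mul_of_nonneg_left k2 (by linarith : 0 ≤ α - 1)
        linarith
      exact (ENNReal.ofReal_lt_ofReal_iff (b.2.trans_lt k3)).2 k3

end RenyiLimit

/-! ### Thresholds for `k⁻¹ log Q` in the extended reals -/

section ScaledLog

theorem coe_lt_mul_log_iff_of_pos {k : ℝ} (hk : 0 < k) (c : ℝ) (Q : ENNReal) :
    (c : EReal) < ((k⁻¹ : ℝ) : EReal) * ENNReal.log Q ↔ ENNReal.ofReal (Real.exp (k * c)) < Q := by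
  have hk' : 0 < k⁻¹ := inv_pos.2 hk
  rcases eq_or_ne Q 0 with rfl | h0
  · simp [EReal.coe_mul_bot_of_pos hk']
  rcases eq_or_ne Q ⊤ with rfl | hT
  · simp [EReal.coe_mul_top_of_pos hk']
  have hq : 0 < Q.toReal := ENNReal.toReal_pos h0 hT
  rw [← ENNReal.ofReal_toReal hT, ENNReal.log_ofReal_of_pos hq, ← EReal.coe_mul, EReal.coe_lt_coe_iff,
    ENNReal.ofReal_lt_ofReal_iff hq, ← Real.lt_log_iff_exp_lt hq, ← div_eq_inv_mul,
    lt_div_iff₀' hk]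

theorem coe_lt_mul_log_iff_of_neg {k : ℝ} (hk : k < 0) (c : ℝ) (Q : ENNReal) :
    (c : EReal) < ((k⁻¹ : ℝ) : EReal) * ENNReal.log Q ↔ Q < ENNReal.ofReal (Real.exp (k * c)) := by
  have hk' : k⁻¹ < 0 := inv_lt_zero.2 hk
  rcases eq_or_ne Q 0 with rfl | h0
  · simp [EReal.coe_mul_bot_of_neg hk', Real.exp_pos]
  rcases eq_or_ne Q ⊤ with rfl | hT
  · simp [EReal.coe_mul_top_of_neg hk']
  have hq : 0 < Q.toReal := ENNReal.toReal_pos h0 hT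
  rw [← ENNReal.ofReal_toReal hT, ENNReal.log_ofReal_of_pos hq, ← EReal.coe_mul, EReal.coe_lt_coe_iff,
    ENNReal.ofReal_lt_ofReal_iff (Real.exp_pos _), ← Real.log_lt_iff_lt_exp hq, ← div_eq_inv_mul,
    lt_div_iff_of_neg' hk]

theorem coe_le_mul_log_of_neg {k : ℝ} (hk : k < 0) (c : ℝ) {Q : ENNReal}
    (h : Q ≤ ENNReal.ofReal (Real.exp (k * c))) :
    (c : EReal) ≤ ((k⁻¹ : ℝ) : EReal) * ENNReal.log Q := by
  refine EReal.ge_of_forall_gt_iff_ge.1 fun z hz => le_of_lt ?_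
  rw [coe_lt_mul_log_iff_of_neg hk]
  refine h.trans_lt ((ENNReal.ofReal_lt_ofReal_iff (Real.exp_pos _)).2 (Real.exp_lt_exp.2 ?_))
  exact mul_lt_mul_of_neg_left (EReal.coe_lt_coe_iff.1 hz) hk

end ScaledLog

/-! ### The radius for `α ≥ 1` -/

section RadiusData

set_option linter.unusedSectionVars false

open scoped MatrixOrder Matrix.Norms.L2Operator
open Filter Topology

variable {n : Type*} [Fintype n] [DecidableEq n] [Nonempty n]

/-- The properties of a divergence `D = D(ρ‖·)`, finite and equal to `F` on positive definite
operators, that determine its minimax behaviour for `α ≥ 1`. -/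
structure IsConvexDivergence (D : Matrix n n ℂ → EReal) (F : Matrix n n ℂ → ℝ) : Prop where
  antitone : ∀ σ σ' : Matrix n n ℂ, σ.PosDef → σ ≤ σ' → F σ' ≤ F σ
  smul : ∀ σ : Matrix n n ℂ, σ.PosDef → ∀ c : ℝ, 0 < c → F (c • σ) = F σ - 1 * Real.log c
  convex : ∀ σ τ : Matrix n n ℂ, σ.PosDef → τ.PosDef → ∀ a b : ℝ, 0 ≤ a → 0 ≤ b → a + b = 1 →
    F (a • σ + b • τ) ≤ a * F σ + b * F τ
  eq_coe : ∀ σ : Matrix n n ℂ, σ.PosDef → D σ = F σ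
  eq_iSup : ∀ σ : Matrix n n ℂ, 0 ≤ σ →
    D σ = ⨆ ε : Set.Ioi (0 : ℝ), (F (σ + (ε : ℝ) • (1 : Matrix n n ℂ)) : EReal)

theorem renyiDiv_eq_of_ne_one (t : RenyiFamily) {α : ℝ} (h1 : α ≠ 1) {ρ : Matrix n n ℂ}
    (htr : reTrace ρ = 1) (σ : Matrix n n ℂ) :
    renyiDiv t α ρ σ = (((α - 1)⁻¹ : ℝ) : EReal) * ENNReal.log (renyiQ t α ρ σ) := by
  rw [reTrace_apply] at htr
  rw [renyiDiv, if_neg h1, htr, ENNReal.ofReal_one, ENNReal.log_one, sub_zero]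

theorem isConvexDivergence_renyiDiv_of_one_lt {t : RenyiFamily} {α : ℝ} (h1 : 1 < α)
    (hp : t = RenyiFamily.petz → α ≤ 2) {ρ : Matrix n n ℂ} (hρ : 0 ≤ ρ) (htr : reTrace ρ = 1) :
    IsConvexDivergence (renyiDiv t α ρ) fun σ => (α - 1)⁻¹ * Real.log (renyiQLim t α ρ σ) := by
  have h0 : 0 < α := by linarith
  have hk : 0 < α - 1 := by linarith
  have hpos := fun σ (hσ : σ.PosDef) => renyiQLim_pos t h1 hρ htr (σ := σ) hσ
  refine ⟨fun σ σ' hσ h => ?_, fun σ hσ c hc => ?_, fun σ τ hσ hτ a b ha hb hab => ?_,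
    fun σ hσ => ?_, fun σ hσ => ?_⟩
  · exact mul_le_mul_of_nonneg_left (Real.log_le_log (hpos _ (hσ.posDef_of_le h))
      (renyiQLim_antitone h1 hp hρ hσ h)) (inv_pos.2 hk).le
  · rw [renyiQLim_smul t h0 hρ hσ hc, Real.log_mul (Real.rpow_pos_of_pos hc _).ne' (hpos σ hσ).ne',
      Real.log_rpow hc]
    field_simp
    ring
  · have := mul_le_mul_of_nonneg_left (log_renyiQLim_convex h1 hp hρ htr hσ hτ ha hb hab)
      (inv_pos.2 hk).le
    linarith
  · rw [renyiDiv_eq_of_ne_one t h1.ne' htr, renyiQ_eq_of_tendsto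
      (ENNReal.tendsto_ofReal (tendsto_renyiQPosDef_add_smul_one h1 hp hρ hσ)),
      ENNReal.log_ofReal_of_pos (hpos σ hσ), ← EReal.coe_mul]
  · rw [renyiDiv_eq_of_ne_one t h1.ne' htr,
      renyiQ_eq_of_tendsto (tendsto_renyiQ_of_one_lt h1 hp hρ hσ)]
    -- Comparing real thresholds moves the scaled logarithm inside the supremum.
    have key : ∀ c : ℝ, (c : EReal) < (((α - 1)⁻¹ : ℝ) : EReal) * ENNReal.log
        (⨆ ε : Set.Ioi (0 : ℝ), ENNReal.ofReal
          (renyiQLim t α ρ (σ + (ε : ℝ) • (1 : Matrix n n ℂ)))) ↔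
        (c : EReal) < ⨆ ε : Set.Ioi (0 : ℝ), (((α - 1)⁻¹ *
          Real.log (renyiQLim t α ρ (σ + (ε : ℝ) • (1 : Matrix n n ℂ))) : ℝ) : EReal) := by
      intro c
      rw [coe_lt_mul_log_iff_of_pos hk, lt_iSup_iff, lt_iSup_iff]
      refine exists_congr fun ε => ?_
      have := hpos _ (Matrix.posDef_add_smul_one hσ ε.2)
      rw [← coe_lt_mul_log_iff_of_pos hk, ENNReal.log_ofReal_of_pos this, ← EReal.coe_mul]
    refine le_antisymm ?_ ?_
    · exact EReal.ge_of_forall_gt_iff_ge.1 fun z hz => ((key z).1 hz).le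
    · exact EReal.ge_of_forall_gt_iff_ge.1 fun z hz => ((key z).2 hz).le

/-- The support projection intertwines the two shifted operators, and `ρ` lives on its range. -/
theorem reTrace_mul_matLog_suppProj {ρ σ : Matrix n n ℂ} (hρ : 0 ≤ ρ) (hσ : 0 ≤ σ)
    (h : suppProj σ * ρ = ρ) (ε : ℝ) :
    reTrace (ρ * matLog (σ + ε • (1 : Matrix n n ℂ))) =
      reTrace (ρ * matLog (σ + (1 - suppProj σ) + ε • (1 : Matrix n n ℂ))) := by
  have hρ' : ρ.IsHermitian := IsSelfAdjoint.of_nonneg hρ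
  have hσ' : σ.IsHermitian := IsSelfAdjoint.of_nonneg hσ
  have d1 : (ε • (1 : Matrix n n ℂ)).IsHermitian := by
    rw [Matrix.IsHermitian, Matrix.conjTranspose_smul, Matrix.conjTranspose_one]; simp
  have hP := isHermitian_suppProj σ
  have hi := cfc_intertwine (A := σ + ε • (1 : Matrix n n ℂ))
    (B := σ + (1 - suppProj σ) + ε • (1 : Matrix n n ℂ)) (X := suppProj σ)
    (hσ'.add d1) ((hσ'.add (Matrix.isHermitian_one.sub hP)).add d1)
    (by simp only [add_mul, mul_add, mul_suppProj hσ', suppProj_mul hσ', smul_mul_assoc,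
          mul_smul_comm, one_mul, mul_one, mul_sub, suppProj_mul_self, sub_self, add_zero])
    Real.log
  change matLog _ * _ = _ * matLog _ at hi
  have h2 := mul_suppProj_of_suppProj_mul hρ' h
  have e1 : reTrace (ρ * matLog (σ + ε • (1 : Matrix n n ℂ))) =
      reTrace (ρ * (matLog (σ + ε • (1 : Matrix n n ℂ)) * suppProj σ)) := by
    conv_lhs => rw [← h, mul_assoc, reTrace_mul_comm]
    rw [mul_assoc]
  rw [e1, hi, ← mul_assoc, h2]

theorem isConvexDivergence_renyiDiv_one (t : RenyiFamily) {ρ : Matrix n n ℂ} (hρ : 0 ≤ ρ)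
    (htr : reTrace ρ = 1) :
    IsConvexDivergence (renyiDiv t 1 ρ)
      fun σ => reTrace (ρ * matLog ρ) - reTrace (ρ * matLog σ) := by
  have htr' : ρ.trace.re = 1 := htr
  have hD : ∀ σ : Matrix n n ℂ, σ.IsHermitian → renyiDiv t 1 ρ σ = if suppProj σ * ρ = ρ then
      ((reTrace (ρ * matLog ρ) - reTrace (ρ * matLog σ) : ℝ) : EReal) else ⊤ := by
    intro σ hσ
    rw [renyiDiv, if_pos rfl, htr', inv_one, EReal.coe_one, one_mul, relEntropy]
    simp only [range_mulVecLin_le_iff hσ]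
    rw [← map_sub, ← mul_sub, reTrace_apply]
  refine ⟨fun σ σ' hσ h => ?_, fun σ hσ c hc => ?_, fun σ τ hσ hτ a b ha hb hab => ?_,
    fun σ hσ => ?_, fun σ hσ => ?_⟩
  · exact sub_le_sub_left (reTrace_mul_mono_right hρ (matLog_le_matLog hσ h)) _
  · rw [matLog_smul hσ hc, mul_add, mul_smul_comm, mul_one, map_add, map_smul, smul_eq_mul, htr]
    ring
  · have := reTrace_mul_mono_right hρ (matLog_concave hσ hτ ha hb hab)
    simp only [mul_add, mul_smul_comm, map_add, map_smul, smul_eq_mul] at this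
    have e : reTrace (ρ * matLog ρ) = a * reTrace (ρ * matLog ρ) + b * reTrace (ρ * matLog ρ) := by
      rw [← add_mul, hab, one_mul]
    linarith
  · rw [hD σ hσ.1, if_pos]
    have : suppProj σ = 1 := by
      rw [suppProj, ← Matrix.cfc_one_fun hσ.1]
      exact cfc_congr fun x hx => by simp [(hσ.spectrum_pos hx).ne']
    rw [this, one_mul]
  · have hσ' : σ.IsHermitian := IsSelfAdjoint.of_nonneg hσ
    rw [hD σ hσ']
    split_ifs with h
    · have hτ := posDef_add_one_sub_suppProj hσ
      -- The value `ε = 0` is legitimate: the convention `log 0 = 0` only affects the kernel of `σ`,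
      -- which `ρ` does not see.
      have e0 := reTrace_mul_matLog_suppProj hρ hσ h 0
      rw [zero_smul, add_zero, add_zero] at e0
      rw [e0]
      simp only [reTrace_mul_matLog_suppProj hρ hσ h]
      set τ := σ + (1 - suppProj σ)
      refine le_antisymm ?_ (iSup_le fun ε => EReal.coe_le_coe_iff.2 (sub_le_sub_left
        (reTrace_mul_mono_right hρ (matLog_le_matLog hτ (le_add_of_nonneg_right
          (smul_nonneg (le_of_lt ε.2) zero_le_one)))) _))
      obtain ⟨c, hc, hle⟩ := hτ.exists_add_smul_one_le
      refine EReal.ge_of_forall_gt_iff_ge.1 fun z hz => ?_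
      rw [EReal.coe_lt_coe_iff] at hz
      have hl : Tendsto (fun δ : ℝ => reTrace (ρ * matLog ρ) -
          (Real.log (1 + δ / c) + reTrace (ρ * matLog τ))) (𝓝[>] 0)
          (𝓝 (reTrace (ρ * matLog ρ) - reTrace (ρ * matLog τ))) := by
        have h : ContinuousAt (fun δ : ℝ => reTrace (ρ * matLog ρ) -
            (Real.log (1 + δ / c) + reTrace (ρ * matLog τ))) 0 :=
          ContinuousAt.sub continuousAt_const (ContinuousAt.add
            (ContinuousAt.log (by fun_prop) (by simp)) continuousAt_const)
        have := h.tendsto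
        simp only [zero_div, add_zero, Real.log_one, zero_add] at this
        exact this.mono_left nhdsWithin_le_nhds
      obtain ⟨ε, hε, hε0⟩ := ((hl.eventually (lt_mem_nhds hz)).and
        (eventually_mem_nhdsWithin (a := (0 : ℝ)) (s := Set.Ioi 0))).exists
      have hε0' : 0 < ε := hε0
      refine le_trans (EReal.coe_le_coe_iff.2 (hε.le.trans (sub_le_sub_left ?_ _)))
        (le_iSup (fun ε : Set.Ioi (0 : ℝ) => ((reTrace (ρ * matLog ρ) -
          reTrace (ρ * matLog (τ + (ε : ℝ) • (1 : Matrix n n ℂ))) : ℝ) : EReal)) ⟨ε, hε0⟩)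
      have := reTrace_mul_mono_right hρ (matLog_le_matLog
        (Matrix.posDef_add_smul_one hτ.nonneg hε0') (hle ε hε0'.le))
      rwa [matLog_smul hτ (by positivity), mul_add, mul_smul_comm, mul_one, map_add, map_smul,
        smul_eq_mul, htr, mul_one] at this
    · symm
      rw [iSup_eq_top]
      intro b hb
      have hpos := reTrace_mul_one_sub_suppProj_pos hρ h
      set p := reTrace (ρ * (1 - suppProj σ))
      obtain ⟨z, hz, -⟩ := EReal.lt_iff_exists_real_btwn.1 hb
      have hlim : Tendsto (fun ε : ℝ => reTrace (ρ * matLog ρ) - (reTrace (ρ * σ) +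
          Real.log ε * p)) (𝓝[>] 0) atTop := by
        have h2 : Tendsto (fun ε : ℝ => reTrace (ρ * σ) + Real.log ε * p) (𝓝[>] 0) atBot :=
          tendsto_atBot_add_const_left _ _ (Real.tendsto_log_nhdsGT_zero.atBot_mul_const hpos)
        simp only [sub_eq_add_neg]
        exact tendsto_atTop_add_const_left _ _ (tendsto_neg_atBot_atTop.comp h2)
      have hev : ∀ᶠ ε : ℝ in 𝓝[>] 0, z < reTrace (ρ * matLog ρ) - (reTrace (ρ * σ) +
          Real.log ε * p) ∧ ε ∈ Set.Ioi 0 ∧ ε ∈ Set.Iic 1 := by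
        filter_upwards [hlim.eventually (eventually_gt_atTop z), self_mem_nhdsWithin,
          mem_nhdsWithin_of_mem_nhds (Iic_mem_nhds one_pos)] with ε h2 h3 h4
        exact ⟨h2, h3, h4⟩
      obtain ⟨ε, hε, hε0, hε1⟩ := hev.exists
      refine ⟨⟨ε, hε0⟩, hz.trans (EReal.coe_lt_coe_iff.2 (hε.trans_le (sub_le_sub_left ?_ _)))⟩
      exact reTrace_mul_matLog_add_smul_one_le hρ hσ hε0 hε1

theorem FinProb.prob_pos {X : Type*} (P : FinProb X) {x : X} (hx : x ∈ P.supp) : 0 < P.prob x :=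
  lt_of_le_of_ne (P.2.1 x) (Ne.symm (Finsupp.mem_support_iff.1 hx))

theorem FinProb.sum_prob {X : Type*} (P : FinProb X) : ∑ x ∈ P.supp, P.prob x = 1 := P.2.2

theorem EReal.coe_sum_mul {X : Type*} (s : Finset X) (f g : X → ℝ) :
    ((∑ x ∈ s, f x * g x : ℝ) : EReal) = ∑ x ∈ s, (f x : EReal) * (g x : EReal) := by
  classical
  induction s using Finset.induction_on with
  | empty => simp
  | insert a s ha ih => rw [Finset.sum_insert ha, Finset.sum_insert ha, EReal.coe_add, ih,
      EReal.coe_mul]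

theorem DensityMatrix.mem_stateSet (σ : DensityMatrix n) : σ.mat ∈ stateSet n := σ.2

theorem DensityMatrix.nonneg (σ : DensityMatrix n) : 0 ≤ σ.mat :=
  Matrix.nonneg_iff_posSemidef.2 σ.2.1

theorem DensityMatrix.reTrace_eq_one (σ : DensityMatrix n) : reTrace σ.mat = 1 := by
  rw [reTrace_apply]
  have : σ.mat.trace = 1 := σ.2.2
  rw [this, Complex.one_re]

theorem convexOn_add_smul_one {F : Matrix n n ℂ → ℝ}
    (hF : ∀ σ τ : Matrix n n ℂ, σ.PosDef → τ.PosDef → ∀ a b : ℝ, 0 ≤ a → 0 ≤ b → a + b = 1 →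
      F (a • σ + b • τ) ≤ a * F σ + b * F τ) {ε : ℝ} (hε : 0 < ε) :
    ConvexOn ℝ (stateSet n) fun σ => F (σ + ε • (1 : Matrix n n ℂ)) := by
  refine ⟨convex_stateSet, fun σ hσ τ hτ a b ha hb hab => ?_⟩
  have h3 := hF _ _ (Matrix.posDef_add_smul_one (Matrix.nonneg_iff_posSemidef.2 hσ.1) hε)
    (Matrix.posDef_add_smul_one (Matrix.nonneg_iff_posSemidef.2 hτ.1) hε) a b ha hb hab
  have e : a • σ + b • τ + ε • (1 : Matrix n n ℂ) =
      a • (σ + ε • (1 : Matrix n n ℂ)) + b • (τ + ε • (1 : Matrix n n ℂ)) := by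
    rw [smul_add, smul_add, add_add_add_comm, ← add_smul, hab, one_smul]
  simp only [e]
  exact h3

variable {X : Type*} {D : X → Matrix n n ℂ → EReal} {F : X → Matrix n n ℂ → ℝ}

theorem exists_finset_of_lt_radius (h : ∀ x, IsConvexDivergence (D x) (F x)) {c : ℝ}
    (hc : (c : EReal) < ⨅ σ : DensityMatrix n, ⨆ x : X, D x σ.mat) :
    ∃ ε : ℝ, ε > 0 ∧ ∃ S : Finset X, ∀ σ ∈ stateSet n, ∃ x ∈ S, c < F x (σ + ε • (1 : Matrix n n ℂ)) := by
  refine exists_finset_of_forall_exists_lt isCompact_stateSet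
    (g := fun x ε σ => F x (σ + ε • (1 : Matrix n n ℂ))) (fun x ε hε => ?_)
    (fun x σ hσ ε ε' hε hεε' => ?_) (fun σ hσ => ?_)
  · exact (continuousOn_of_antitone_of_homogeneous (h x).antitone (h x).smul hε).mono
      fun σ hσ => Matrix.nonneg_iff_posSemidef.2 hσ.1
  · exact (h x).antitone _ _ (Matrix.posDef_add_smul_one (Matrix.nonneg_iff_posSemidef.2 hσ.1) hε)
      (add_smul_one_mono σ hεε')
  · have h1 := hc.trans_le (iInf_le _ (⟨σ, hσ⟩ : DensityMatrix n))
    obtain ⟨x, hx⟩ := lt_iSup_iff.1 h1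
    change (c : EReal) < D x σ at hx
    rw [(h x).eq_iSup _ (Matrix.nonneg_iff_posSemidef.2 hσ.1)] at hx
    obtain ⟨ε, hε⟩ := lt_iSup_iff.1 hx
    exact ⟨x, ε, ε.2, EReal.coe_lt_coe_iff.1 hε⟩

theorem IsConvexDivergence.coe_le {D : Matrix n n ℂ → EReal} {F : Matrix n n ℂ → ℝ}
    (h : IsConvexDivergence D F) {σ : Matrix n n ℂ} (hσ : 0 ≤ σ) {ε : ℝ} (hε : 0 < ε) :
    (F (σ + ε • (1 : Matrix n n ℂ)) : EReal) ≤ D σ := by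
  rw [h.eq_iSup σ hσ]
  exact le_iSup (fun ε : Set.Ioi (0 : ℝ) => (F (σ + (ε : ℝ) • (1 : Matrix n n ℂ)) : EReal)) ⟨ε, hε⟩

/-- The nontrivial inequality needs only the uniform `ε` from compactness; the other holds because
the shift lowers each divergence. -/
theorem radius_eq_iSup_add_smul_one (h : ∀ x, IsConvexDivergence (D x) (F x)) :
    ⨅ σ : DensityMatrix n, ⨆ x : X, D x σ.mat =
      ⨆ ε : Set.Ioi (0 : ℝ), ⨅ σ : DensityMatrix n, ⨆ x : X,
        D x (σ.mat + (ε : ℝ) • (1 : Matrix n n ℂ)) := by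
  refine le_antisymm (EReal.ge_of_forall_gt_iff_ge.1 fun c hc => ?_)
    (iSup_le fun ε => iInf_mono fun σ => iSup_mono fun x => ?_)
  · obtain ⟨ε, hε, S, hS⟩ := exists_finset_of_lt_radius h hc
    refine le_trans (le_iInf fun σ => ?_) (le_iSup (fun ε : Set.Ioi (0 : ℝ) =>
      ⨅ σ : DensityMatrix n, ⨆ x : X, D x (σ.mat + (ε : ℝ) • (1 : Matrix n n ℂ))) ⟨ε, hε⟩)
    obtain ⟨x, -, hx⟩ := hS σ.mat σ.mem_stateSet
    refine le_trans ?_ (le_iSup _ x)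
    rw [(h x).eq_coe _ (Matrix.posDef_add_smul_one σ.nonneg hε)]
    exact EReal.coe_le_coe_iff.2 hx.le
  · rw [(h x).eq_coe _ (Matrix.posDef_add_smul_one σ.nonneg ε.2)]
    exact (h x).coe_le σ.nonneg ε.2

/-- The weights are found for the regularised functions, which are finite, continuous and convex;
since these lie below `D`, the same weights work for `D`. -/
theorem radius_le_iSup_iInf_sum (h : ∀ x, IsConvexDivergence (D x) (F x)) :
    ⨅ σ : DensityMatrix n, ⨆ x : X, D x σ.mat ≤
      ⨆ P : FinProb X, ⨅ σ : DensityMatrix n, ∑ x ∈ P.supp, (P.prob x : EReal) * D x σ.mat := by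
  refine EReal.ge_of_forall_gt_iff_ge.1 fun c hc => ?_
  obtain ⟨ε, hε, S, hS⟩ := exists_finset_of_lt_radius h hc
  obtain ⟨P, hP⟩ := exists_finProb_of_forall_exists_lt convex_stateSet stateSet_nonempty
    (g := fun x σ => F x (σ + ε • (1 : Matrix n n ℂ)))
    (fun x => convexOn_add_smul_one (h x).convex hε) hS
  refine le_trans (le_iInf fun σ => ?_) (le_iSup (fun P : FinProb X => ⨅ σ : DensityMatrix n,
    ∑ x ∈ P.supp, (P.prob x : EReal) * D x σ.mat) P)
  refine (EReal.coe_le_coe_iff.2 (hP σ.mat σ.mem_stateSet)).trans ?_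
  rw [EReal.coe_sum_mul]
  exact Finset.sum_le_sum fun x hx => mul_le_mul_of_nonneg_left ((h x).coe_le σ.nonneg hε)
    (EReal.coe_nonneg.2 (P.prob_pos hx).le)

end RadiusData

/-! ### The radius for `α < 1` -/

section RadiusLtOne

set_option linter.unusedSectionVars false

open scoped MatrixOrder Matrix.Norms.L2Operator
open Filter Topology

variable {n : Type*} [Fintype n] [DecidableEq n] [Nonempty n]
variable {X : Type*} {t : RenyiFamily} {α : ℝ}

theorem renyiQ_le_of_lt_one (h0 : 0 < α) (h1 : α < 1)
    (hs : t = RenyiFamily.sandwiched → 1 / 2 ≤ α) {ρ σ : Matrix n n ℂ} (hρ : 0 ≤ ρ) (hσ : 0 ≤ σ)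
    {δ : ℝ} (hδ : 0 < δ) : renyiQ t α ρ σ ≤ ENNReal.ofReal
      (renyiQPosDef t α (ρ + δ • (1 : Matrix n n ℂ)) (σ + δ • (1 : Matrix n n ℂ))) := by
  rw [(tendsto_renyiQ_of_lt_one h0 h1 hs hρ hσ).2]
  exact sInf_le ⟨δ, hδ, rfl⟩

theorem renyiQ_mono_right_of_lt_one (h0 : 0 < α) (h1 : α < 1)
    (hs : t = RenyiFamily.sandwiched → 1 / 2 ≤ α) {ρ σ σ' : Matrix n n ℂ} (hρ : 0 ≤ ρ)
    (hσ : 0 ≤ σ) (h : σ ≤ σ') : renyiQ t α ρ σ ≤ renyiQ t α ρ σ' := by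
  rw [(tendsto_renyiQ_of_lt_one h0 h1 hs hρ (hσ.trans h)).2]
  refine le_sInf ?_
  rintro _ ⟨δ, hδ, rfl⟩
  refine (renyiQ_le_of_lt_one h0 h1 hs hρ hσ hδ).trans (ENNReal.ofReal_le_ofReal ?_)
  exact renyiQPosDef_mono_right h0 h1 hs (Matrix.posDef_add_smul_one hρ hδ)
    (Matrix.posDef_add_smul_one hσ hδ) (add_le_add h le_rfl)

theorem renyiQ_lt_top_of_lt_one (h0 : 0 < α) (h1 : α < 1)
    (hs : t = RenyiFamily.sandwiched → 1 / 2 ≤ α) {ρ σ : Matrix n n ℂ} (hρ : 0 ≤ ρ)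
    (hσ : 0 ≤ σ) : renyiQ t α ρ σ < ⊤ :=
  (renyiQ_le_of_lt_one h0 h1 hs hρ hσ one_pos).trans_lt ENNReal.ofReal_lt_top

theorem renyiQPosDef_add_smul_one_mono_of_lt_one (h0 : 0 < α) (h1 : α < 1)
    (hs : t = RenyiFamily.sandwiched → 1 / 2 ≤ α) {ρ σ : Matrix n n ℂ} (hρ : 0 ≤ ρ) (hσ : 0 ≤ σ)
    {δ δ' : ℝ} (hδ : 0 < δ) (h : δ ≤ δ') :
    renyiQPosDef t α (ρ + δ • (1 : Matrix n n ℂ)) (σ + δ • (1 : Matrix n n ℂ)) ≤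
      renyiQPosDef t α (ρ + δ' • (1 : Matrix n n ℂ)) (σ + δ' • (1 : Matrix n n ℂ)) :=
  (renyiQPosDef_mono_left h0 h1 (Matrix.posDef_add_smul_one hρ hδ)
    (Matrix.posDef_add_smul_one hσ hδ) (add_smul_one_mono ρ h)).trans
  (renyiQPosDef_mono_right h0 h1 hs (Matrix.posDef_add_smul_one hρ (hδ.trans_le h))
    (Matrix.posDef_add_smul_one hσ hδ) (add_smul_one_mono σ h))

/-- The order argument is applied to `-log Q_α`, which is antitone with scaling constant `1 - α`. -/
theorem continuousOn_renyiQPosDef_add_smul_one (h0 : 0 < α) (h1 : α < 1)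
    (hs : t = RenyiFamily.sandwiched → 1 / 2 ≤ α) {ρ : Matrix n n ℂ} (hρ : ρ.PosDef) {δ : ℝ}
    (hδ : 0 < δ) :
    ContinuousOn (fun σ => renyiQPosDef t α ρ (σ + δ • (1 : Matrix n n ℂ))) {σ | 0 ≤ σ} := by
  have hpos := fun (σ : Matrix n n ℂ) (hσ : σ.PosDef) => renyiQPosDef_pos t α hρ hσ
  have h := continuousOn_of_antitone_of_homogeneous (n := n) (k := 1 - α)
    (F := fun σ => -Real.log (renyiQPosDef t α ρ σ))
    (fun σ σ' hσ h => neg_le_neg (Real.log_le_log (hpos σ hσ)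
      (renyiQPosDef_mono_right h0 h1 hs hρ hσ h)))
    (fun σ hσ c hc => by
      rw [renyiQPosDef_smul_right t h0 hρ hσ hc, Real.log_mul (Real.rpow_pos_of_pos hc _).ne'
        (hpos σ hσ).ne', Real.log_rpow hc]
      ring) hδ
  refine (Real.continuous_exp.comp_continuousOn h.neg).congr fun σ hσ => ?_
  simp [Real.exp_log (hpos _ (Matrix.posDef_add_smul_one hσ hδ))]

/-- Because `α - 1 < 0`, the threshold `c` for the divergence becomes the upper threshold `exp ((α -
1) c)` for `Q_α`; working with `-Q_α` turns its concavity into the convexity wanted later. -/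
theorem exists_finset_of_lt_radius_of_lt_one (h0 : 0 < α) (h1 : α < 1)
    (hs : t = RenyiFamily.sandwiched → 1 / 2 ≤ α) (W : X → DensityMatrix n) {c : ℝ}
    (hc : (c : EReal) < renyiRadius t α W) :
    ∃ δ : ℝ, δ > 0 ∧ ∃ S : Finset X, ∀ σ ∈ stateSet n, ∃ x ∈ S,
      -Real.exp ((α - 1) * c) < -renyiQPosDef t α ((W x).mat + δ • (1 : Matrix n n ℂ))
        (σ + δ • (1 : Matrix n n ℂ)) := by
  refine exists_finset_of_forall_exists_lt isCompact_stateSet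
    (g := fun x δ σ => -renyiQPosDef t α ((W x).mat + δ • (1 : Matrix n n ℂ))
        (σ + δ • (1 : Matrix n n ℂ))) (fun x δ hδ => ?_)
    (fun x σ hσ δ δ' hδ hδδ' => ?_) (fun σ hσ => ?_)
  · exact ((continuousOn_renyiQPosDef_add_smul_one h0 h1 hs
      (Matrix.posDef_add_smul_one (W x).nonneg hδ) hδ).neg).mono
      fun σ hσ => Matrix.nonneg_iff_posSemidef.2 hσ.1
  · exact neg_le_neg (renyiQPosDef_add_smul_one_mono_of_lt_one h0 h1 hs (W x).nonneg
      (Matrix.nonneg_iff_posSemidef.2 hσ.1) hδ hδδ')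
  · obtain ⟨x, hx⟩ := lt_iSup_iff.1 (hc.trans_le (iInf_le _ (⟨σ, hσ⟩ : DensityMatrix n)))
    change (c : EReal) < renyiDiv t α (W x).mat σ at hx
    rw [renyiDiv_eq_of_ne_one t h1.ne (W x).reTrace_eq_one,
      coe_lt_mul_log_iff_of_neg (by linarith),
      (tendsto_renyiQ_of_lt_one h0 h1 hs (W x).nonneg (Matrix.nonneg_iff_posSemidef.2 hσ.1)).2] at hx
    obtain ⟨_, ⟨δ, hδ, rfl⟩, hlt⟩ := sInf_lt_iff.1 hx
    exact ⟨x, δ, hδ, neg_lt_neg ((ENNReal.ofReal_lt_ofReal_iff (Real.exp_pos _)).1 hlt)⟩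

theorem renyiRadius_eq_iSup_add_smul_one_of_lt_one (h0 : 0 < α) (h1 : α < 1)
    (hs : t = RenyiFamily.sandwiched → 1 / 2 ≤ α) (W : X → DensityMatrix n) :
    renyiRadius t α W = ⨆ ε : Set.Ioi (0 : ℝ), ⨅ σ : DensityMatrix n, ⨆ x : X,
      renyiDiv t α (W x).mat (σ.mat + (ε : ℝ) • (1 : Matrix n n ℂ)) := by
  have hk : α - 1 < 0 := by linarith
  refine le_antisymm (EReal.ge_of_forall_gt_iff_ge.1 fun c hc => ?_)
    (iSup_le fun ε => iInf_mono fun σ => iSup_mono fun x => ?_)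
  · obtain ⟨δ, hδ, S, hS⟩ := exists_finset_of_lt_radius_of_lt_one h0 h1 hs W hc
    -- Half of `δ` is the explicit shift of `σ`; the other half is the regularisation inside `Q_α`,
    -- and together they restore `σ + δI`.
    have hδ2 : 0 < δ / 2 := by linarith
    refine le_trans (le_iInf fun σ => ?_) (le_iSup (fun ε : Set.Ioi (0 : ℝ) =>
      ⨅ σ : DensityMatrix n, ⨆ x : X,
        renyiDiv t α (W x).mat (σ.mat + (ε : ℝ) • (1 : Matrix n n ℂ))) ⟨δ / 2, hδ2⟩)
    obtain ⟨x, -, hx⟩ := hS σ.mat σ.mem_stateSet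
    refine le_trans ?_ (le_iSup _ x)
    rw [renyiDiv_eq_of_ne_one t h1.ne (W x).reTrace_eq_one]
    refine coe_le_mul_log_of_neg hk c ?_
    have hσ := (Matrix.posDef_add_smul_one σ.nonneg hδ2).nonneg
    refine (renyiQ_le_of_lt_one h0 h1 hs (W x).nonneg hσ hδ2).trans (ENNReal.ofReal_le_ofReal ?_)
    rw [add_assoc σ.mat, ← add_smul, add_halves]
    exact (renyiQPosDef_mono_left h0 h1 (Matrix.posDef_add_smul_one (W x).nonneg hδ2)
      (Matrix.posDef_add_smul_one σ.nonneg hδ) (add_smul_one_mono _ (by linarith))).trans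
      (neg_lt_neg_iff.1 hx).le
  · rw [renyiDiv_eq_of_ne_one t h1.ne (W x).reTrace_eq_one,
      renyiDiv_eq_of_ne_one t h1.ne (W x).reTrace_eq_one]
    refine EReal.ge_of_forall_gt_iff_ge.1 fun z hz => le_of_lt ?_
    rw [coe_lt_mul_log_iff_of_neg hk] at hz ⊢
    exact (renyiQ_mono_right_of_lt_one h0 h1 hs (W x).nonneg σ.nonneg (le_add_of_nonneg_right
      (smul_nonneg (le_of_lt ε.2) zero_le_one))).trans_lt hz

theorem renyiRadius_le_iSup_of_lt_one (h0 : 0 < α) (h1 : α < 1)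
    (hs : t = RenyiFamily.sandwiched → 1 / 2 ≤ α) (W : X → DensityMatrix n) :
    renyiRadius t α W ≤ ⨆ P : FinProb X, ⨅ σ : DensityMatrix n, (((α - 1)⁻¹ : ℝ) : EReal) *
      ENNReal.log (∑ x ∈ P.supp, ENNReal.ofReal (P.prob x) * renyiQ t α (W x).mat σ.mat) := by
  have hk : α - 1 < 0 := by linarith
  refine EReal.ge_of_forall_gt_iff_ge.1 fun c hc => ?_
  obtain ⟨δ, hδ, S, hS⟩ := exists_finset_of_lt_radius_of_lt_one h0 h1 hs W hc
  obtain ⟨P, hP⟩ := exists_finProb_of_forall_exists_lt convex_stateSet stateSet_nonempty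
    (g := fun x σ => -renyiQPosDef t α ((W x).mat + δ • (1 : Matrix n n ℂ))
        (σ + δ • (1 : Matrix n n ℂ)))
    (fun x => convexOn_add_smul_one (F := fun σ => -renyiQPosDef t α
      ((W x).mat + δ • (1 : Matrix n n ℂ)) σ) (fun σ τ hσ hτ a b ha hb hab => by
        have := renyiQPosDef_concave h0 h1 hs (Matrix.posDef_add_smul_one (W x).nonneg hδ) hσ hτ
          ha hb hab
        linarith) hδ) hS
  refine le_trans (le_iInf fun σ => coe_le_mul_log_of_neg hk c ?_) (le_iSup (fun P : FinProb X =>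
    ⨅ σ : DensityMatrix n, (((α - 1)⁻¹ : ℝ) : EReal) * ENNReal.log (∑ x ∈ P.supp,
      ENNReal.ofReal (P.prob x) * renyiQ t α (W x).mat σ.mat)) P)
  have h := hP σ.mat σ.mem_stateSet
  simp only [mul_neg, Finset.sum_neg_distrib, neg_le_neg_iff] at h
  refine le_trans ?_ (ENNReal.ofReal_le_ofReal h)
  rw [ENNReal.ofReal_sum_of_nonneg fun x hx => mul_nonneg (P.prob_pos hx).le
    (renyiQPosDef_pos t α (Matrix.posDef_add_smul_one (W x).nonneg hδ)
      (Matrix.posDef_add_smul_one σ.nonneg hδ)).le]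
  refine Finset.sum_le_sum fun x hx => ?_
  rw [ENNReal.ofReal_mul (P.prob_pos hx).le]
  exact mul_le_mul_right (renyiQ_le_of_lt_one h0 h1 hs (W x).nonneg σ.nonneg hδ) _

end RadiusLtOne

/-! ### Classical-quantum states as direct sums -/

section DirectSum

set_option linter.unusedSectionVars false

open scoped MatrixOrder
open Filter Topology

variable {ι n : Type*} [Fintype ι] [DecidableEq ι] [Fintype n] [DecidableEq n]

/-- The block diagonal operator `∑ i, |i⟩⟨i| ⊗ A i`. -/
def directSum (A : ι → Matrix n n ℂ) : Matrix (ι × n) (ι × n) ℂ :=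
  Matrix.of fun p q => if p.1 = q.1 then A p.1 p.2 q.2 else 0

/-- The isometry `|i⟩ ⊗ I` onto the `i`-th block. -/
def blockIncl (n : Type*) [DecidableEq n] (i : ι) : Matrix (ι × n) n ℂ :=
  Matrix.of fun p b => if p.1 = i then (1 : Matrix n n ℂ) p.2 b else 0

theorem mul_blockIncl_apply (G : Matrix (ι × n) (ι × n) ℂ) (i : ι) (p : ι × n) (b : n) :
    (G * blockIncl n i) p b = G p (i, b) := by
  simp [Matrix.mul_apply, blockIncl, Fintype.sum_prod_type, Matrix.one_apply]

theorem blockIncl_mul_apply (B : Matrix n n ℂ) (i : ι) (p : ι × n) (b : n) :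
    (blockIncl n i * B) p b = if p.1 = i then B p.2 b else 0 := by
  by_cases h : p.1 = i <;> simp [Matrix.mul_apply, blockIncl, h, Matrix.one_apply]

theorem directSum_mul_blockIncl (A : ι → Matrix n n ℂ) (i : ι) :
    directSum A * blockIncl n i = blockIncl n i * A i := by
  ext p b
  rw [mul_blockIncl_apply, blockIncl_mul_apply]
  by_cases h : p.1 = i
  · simp [directSum, h]
  · simp [directSum, h]

/-- A block diagonal matrix is recognised by its relations with the block inclusions, so any
construction preserving intertwiners acts blockwise. -/
theorem eq_directSum_of_mul_blockIncl {G : Matrix (ι × n) (ι × n) ℂ} {A : ι → Matrix n n ℂ}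
    (h : ∀ i, G * blockIncl n i = blockIncl n i * A i) : G = directSum A := by
  ext p q
  have := congrFun (congrFun (h q.1) p) q.2
  rwa [← directSum_mul_blockIncl, mul_blockIncl_apply, mul_blockIncl_apply] at this

theorem directSum_injective : Function.Injective (directSum : (ι → Matrix n n ℂ) → _) := by
  intro A B h
  ext i a b
  simpa [directSum] using congrFun (congrFun h (i, a)) (i, b)

theorem directSum_mul (A B : ι → Matrix n n ℂ) :
    directSum A * directSum B = directSum fun i => A i * B i :=
  eq_directSum_of_mul_blockIncl fun i => by
    rw [Matrix.mul_assoc, directSum_mul_blockIncl, ← Matrix.mul_assoc, directSum_mul_blockIncl,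
      Matrix.mul_assoc]

theorem directSum_sub (A B : ι → Matrix n n ℂ) :
    directSum A - directSum B = directSum fun i => A i - B i :=
  eq_directSum_of_mul_blockIncl fun i => by
    rw [Matrix.sub_mul, directSum_mul_blockIncl, directSum_mul_blockIncl, Matrix.mul_sub]

theorem directSum_add_smul_one (A : ι → Matrix n n ℂ) (ε : ℝ) :
    directSum A + ε • (1 : Matrix (ι × n) (ι × n) ℂ) =
      directSum fun i => A i + ε • (1 : Matrix n n ℂ) :=
  eq_directSum_of_mul_blockIncl fun i => by
    rw [Matrix.add_mul, directSum_mul_blockIncl, Matrix.mul_add, Matrix.smul_mul, Matrix.one_mul,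
      Matrix.mul_smul, Matrix.mul_one]

theorem isHermitian_directSum {A : ι → Matrix n n ℂ} (hA : ∀ i, (A i).IsHermitian) :
    (directSum A).IsHermitian := by
  ext p q
  rcases p with ⟨i, a⟩
  rcases q with ⟨j, b⟩
  by_cases h : i = j
  · subst h
    simpa [directSum] using (hA i).apply a b
  · simp [directSum, h, Ne.symm h]

theorem reTrace_directSum (A : ι → Matrix n n ℂ) :
    reTrace (directSum A) = ∑ i, reTrace (A i) := by
  simp [reTrace_apply, Matrix.trace, directSum, Fintype.sum_prod_type]

theorem cfc_directSum {A : ι → Matrix n n ℂ} (hA : ∀ i, (A i).IsHermitian) (f : ℝ → ℝ) :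
    cfc f (directSum A) = directSum fun i => cfc f (A i) :=
  eq_directSum_of_mul_blockIncl fun i =>
    cfc_intertwine (isHermitian_directSum hA) (hA i) (directSum_mul_blockIncl A i) f

theorem renyiQPosDef_directSum (t : RenyiFamily) (α : ℝ) {A B : ι → Matrix n n ℂ}
    (hA : ∀ i, (A i).IsHermitian) (hB : ∀ i, (B i).IsHermitian) :
    renyiQPosDef t α (directSum A) (directSum B) = ∑ i, renyiQPosDef t α (A i) (B i) := by
  have h : renyiMat t α (directSum A) (directSum B) = directSum fun i => renyiMat t α (A i) (B i) :=
    eq_directSum_of_mul_blockIncl fun i =>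
      renyiMat_intertwine t α (isHermitian_directSum hA) (isHermitian_directSum hB) (hA i) (hB i)
        (directSum_mul_blockIncl A i) (directSum_mul_blockIncl B i)
  simp only [renyiQPosDef_eq, h, reTrace_directSum]

/-- Shifting `p A` by `ε` is `p` times shifting `A` by `ε / p`, and `Q_α` is jointly homogeneous of
degree one. Each block thus has its own parameter, which is why existence of the blockwise limits is
assumed. -/
theorem renyiQ_directSum_smul [Nonempty n] {t : RenyiFamily} {α : ℝ} (h0 : 0 < α)
    {A B : ι → Matrix n n ℂ} {p : ι → ℝ} (hp : ∀ i, 0 < p i) (hA : ∀ i, 0 ≤ A i)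
    (hB : ∀ i, 0 ≤ B i)
    (h : ∀ i, Tendsto (fun ε : ℝ => ENNReal.ofReal
      (renyiQPosDef t α (A i + ε • (1 : Matrix n n ℂ)) (B i + ε • (1 : Matrix n n ℂ)))) (𝓝[>] 0)
      (𝓝 (renyiQ t α (A i) (B i)))) :
    renyiQ t α (directSum fun i => p i • A i) (directSum fun i => p i • B i) =
      ∑ i, ENNReal.ofReal (p i) * renyiQ t α (A i) (B i) := by
  refine renyiQ_eq_of_tendsto ?_
  have hdiv : ∀ i, Tendsto (fun ε : ℝ => ε / p i) (𝓝[>] 0) (𝓝[>] 0) := fun i => by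
    refine tendsto_nhdsWithin_iff.2 ⟨?_, ?_⟩
    · have : Tendsto (fun ε : ℝ => ε / p i) (𝓝 0) (𝓝 (0 / p i)) :=
        tendsto_id.div_const _
      rw [zero_div] at this
      exact this.mono_left nhdsWithin_le_nhds
    · filter_upwards [self_mem_nhdsWithin] with ε hε
      exact div_pos hε (hp i)
  refine (tendsto_finsetSum Finset.univ fun i _ => ENNReal.Tendsto.const_mul
    ((h i).comp (hdiv i)) (Or.inr ENNReal.ofReal_ne_top)).congr' ?_
  filter_upwards [self_mem_nhdsWithin] with ε hε
  have hs : ∀ i (C : Matrix n n ℂ), p i • C + ε • (1 : Matrix n n ℂ) =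
      p i • (C + (ε / p i) • (1 : Matrix n n ℂ)) := fun i C => by
    rw [smul_add, smul_smul, mul_div_cancel₀ _ (hp i).ne']
  have hA' := fun i => Matrix.posDef_add_smul_one (hA i) (div_pos hε (hp i))
  have hB' := fun i => Matrix.posDef_add_smul_one (hB i) (div_pos hε (hp i))
  rw [directSum_add_smul_one, directSum_add_smul_one]
  simp only [hs]
  rw [renyiQPosDef_directSum t α (fun i => ((hA' i).smul (hp i)).1)
    (fun i => ((hB' i).smul (hp i)).1), ENNReal.ofReal_sum_of_nonneg fun i _ =>
      (renyiQPosDef_pos t α ((hA' i).smul (hp i)) ((hB' i).smul (hp i))).le]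
  refine Finset.sum_congr rfl fun i _ => ?_
  rw [renyiQPosDef_smul t h0 (hA' i) (hB' i) (hp i), ENNReal.ofReal_mul (hp i).le]
  rfl

theorem cfc_smul_arg {A : Matrix n n ℂ} (hA : A.IsHermitian) (c : ℝ) (f : ℝ → ℝ) :
    cfc f (c • A) = cfc (fun x => f (c * x)) A :=
  (cfc_comp_smul c f A (((Matrix.finite_real_spectrum (A := A)).image _).continuousOn _)
    hA.isSelfAdjoint).symm

theorem suppProj_smul {A : Matrix n n ℂ} (hA : A.IsHermitian) {c : ℝ} (hc : 0 < c) :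
    suppProj (c • A) = suppProj A := by
  rw [suppProj, cfc_smul_arg hA]
  simp [suppProj, hc.ne']

/-- With `log 0 = 0` the rule `log (c x) = log c + log x` fails at zero, hence the support
projection in place of the identity. -/
theorem matLog_smul_eq_suppProj_add {A : Matrix n n ℂ} (hA : A.IsHermitian) {c : ℝ} (hc : 0 < c) :
    matLog (c • A) = Real.log c • suppProj A + matLog A := by
  rw [matLog, cfc_smul_arg hA, suppProj, matLog, ← Matrix.cfc_const_mul_fun,
    ← Matrix.cfc_add_fun]
  refine cfc_congr fun x _ => ?_
  by_cases h : x = 0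
  · simp [h]
  · simp [h, Real.log_mul hc.ne' h]

theorem mul_matLog_smul_sub {ρ σ : Matrix n n ℂ} (hρ : ρ.IsHermitian) (hσ : σ.IsHermitian)
    (h : suppProj σ * ρ = ρ) {c : ℝ} (hc : 0 < c) :
    (c • ρ) * (matLog (c • ρ) - matLog (c • σ)) = c • (ρ * (matLog ρ - matLog σ)) := by
  rw [matLog_smul_eq_suppProj_add hρ hc, matLog_smul_eq_suppProj_add hσ hc, smul_mul_assoc]
  simp only [mul_sub, mul_add, mul_smul_comm, mul_suppProj hρ, mul_suppProj_of_suppProj_mul hρ h,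
    add_sub_add_left_eq_sub]

open scoped Classical in
theorem relEntropy_eq_ite {ρ σ : Matrix n n ℂ} (hσ : σ.IsHermitian) :
    relEntropy ρ σ = if suppProj σ * ρ = ρ then
      ((reTrace (ρ * (matLog ρ - matLog σ)) : ℝ) : EReal) else ⊤ := by
  rw [relEntropy]
  simp only [range_mulVecLin_le_iff hσ]
  rfl

open scoped Classical in
theorem relEntropy_directSum_smul {A B : ι → Matrix n n ℂ} {p : ι → ℝ} (hp : ∀ i, 0 < p i)
    (hA : ∀ i, (A i).IsHermitian) (hB : ∀ i, (B i).IsHermitian) :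
    relEntropy (directSum fun i => p i • A i) (directSum fun i => p i • B i) =
      if ∀ i, suppProj (B i) * A i = A i then
        ((∑ i, p i * reTrace (A i * (matLog (A i) - matLog (B i))) : ℝ) : EReal) else ⊤ := by
  have hsm : ∀ (c : ℝ) (C : Matrix n n ℂ), C.IsHermitian → (c • C).IsHermitian :=
    fun c C hC => by rw [Matrix.IsHermitian, Matrix.conjTranspose_smul, hC.eq]; simp
  have hA' := fun i => hsm (p i) _ (hA i)
  have hB' := fun i => hsm (p i) _ (hB i)
  have e : (suppProj (directSum fun i => p i • B i) * directSum (fun i => p i • A i) =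
      directSum fun i => p i • A i) ↔ ∀ i, suppProj (B i) * A i = A i := by
    rw [suppProj, cfc_directSum hB', directSum_mul, directSum_injective.eq_iff, funext_iff]
    refine forall_congr' fun i => ?_
    change suppProj (p i • B i) * (p i • A i) = p i • A i ↔ _
    rw [suppProj_smul (hB i) (hp i), mul_smul_comm]
    exact (smul_right_injective _ (hp i).ne').eq_iff
  rw [relEntropy_eq_ite (isHermitian_directSum hB')]
  by_cases h : ∀ i, suppProj (B i) * A i = A i
  · rw [if_pos h, if_pos (e.2 h), matLog, matLog, cfc_directSum hA', cfc_directSum hB', directSum_sub, directSum_mul,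
      reTrace_directSum]
    congr 1
    refine Finset.sum_congr rfl fun i _ => ?_
    have := congrArg reTrace (mul_matLog_smul_sub (hA i) (hB i) (h i) (hp i))
    rwa [map_smul, smul_eq_mul] at this
  · rw [if_neg h, if_neg (mt e.1 h)]

variable {X : Type*}

open scoped Classical in
theorem liftedState_eq_directSum (W : X → DensityMatrix n) (P : FinProb X) :
    liftedState W P = directSum fun x : P.supp => P.prob x • (W x).mat := by
  ext p q
  rcases p with ⟨i, a⟩
  rcases q with ⟨j, b⟩
  simp only [liftedState, Matrix.sum_apply, Matrix.smul_apply, Matrix.kroneckerMap_apply,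
    Matrix.single_apply, directSum, Matrix.of_apply]
  by_cases h : i = j
  · subst h
    simp
  · rw [if_neg h]
    refine Finset.sum_eq_zero fun x _ => ?_
    have : ¬(x = i ∧ x = j) := fun hx => h (hx.1.symm.trans hx.2)
    simp [this]

open scoped Classical in
theorem inputState_kronecker (P : FinProb X) (σ : Matrix n n ℂ) :
    inputState P ⊗ₖ σ = directSum fun x : P.supp => P.prob x • σ := by
  ext p q
  rcases p with ⟨i, a⟩
  rcases q with ⟨j, b⟩
  simp only [inputState, Matrix.sum_apply, Matrix.smul_apply, Matrix.kroneckerMap_apply,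
    Matrix.single_apply, directSum, Matrix.of_apply]
  by_cases h : i = j
  · subst h
    simp
  · rw [if_neg h, Finset.sum_eq_zero, zero_mul]
    intro x _
    have : ¬(x = i ∧ x = j) := fun hx => h (hx.1.symm.trans hx.2)
    simp [this]

end DirectSum

/-! ### Averages and Jensen's inequality with infinite values -/

section ExtendedReals

theorem EReal.sum_ne_bot {X : Type*} {s : Finset X} {f : X → EReal} (h : ∀ x ∈ s, f x ≠ ⊥) :
    ∑ x ∈ s, f x ≠ ⊥ := by
  classical
  induction s using Finset.induction_on with
  | empty => simp
  | insert a s ha ih =>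
    rw [Finset.sum_insert ha]
    exact EReal.add_ne_bot_iff.2 ⟨h a (Finset.mem_insert_self a s),
      ih fun x hx => h x (Finset.mem_insert_of_mem hx)⟩

/-- The value `⊥` has to be excluded because `⊤ + ⊥ = ⊥` in `EReal`. -/
theorem EReal.sum_eq_top {X : Type*} {s : Finset X} {f : X → EReal} (h : ∀ x ∈ s, f x ≠ ⊥) {a : X}
    (ha : a ∈ s) (hT : f a = ⊤) : ∑ x ∈ s, f x = ⊤ := by
  classical
  rw [← Finset.add_sum_erase s f ha, hT]
  exact EReal.top_add_of_ne_bot (EReal.sum_ne_bot fun x hx => h x (Finset.mem_of_mem_erase hx))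

theorem EReal.coe_mul_ne_bot {p : ℝ} (hp : 0 < p) {d : EReal} (hd : d ≠ ⊥) : (p : EReal) * d ≠ ⊥ := by
  induction d with
  | bot => exact absurd rfl hd
  | top => simp [EReal.coe_mul_top_of_pos hp]
  | coe d => rw [← EReal.coe_mul]; exact EReal.coe_ne_bot _

variable {X : Type*} (P : FinProb X)

theorem FinProb.exists_mem_supp : ∃ x, x ∈ P.supp := by
  by_contra h
  push Not at h
  have := P.sum_prob
  rw [Finset.eq_empty_of_forall_notMem h, Finset.sum_empty] at this
  exact zero_ne_one this

theorem FinProb.sum_ofReal_prob : ∑ x ∈ P.supp, ENNReal.ofReal (P.prob x) = 1 := by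
  rw [← ENNReal.ofReal_sum_of_nonneg fun _ hx => (P.prob_pos hx).le, P.sum_prob,
    ENNReal.ofReal_one]

theorem FinProb.sum_mul_eq_top {d : X → EReal} (hd : ∀ x, d x ≠ ⊥) {a : X} (ha : a ∈ P.supp)
    (hT : d a = ⊤) : ∑ x ∈ P.supp, (P.prob x : EReal) * d x = ⊤ :=
  EReal.sum_eq_top (fun x hx => EReal.coe_mul_ne_bot (P.prob_pos hx) (hd x)) ha
    (by rw [hT, EReal.coe_mul_top_of_pos (P.prob_pos ha)])

theorem FinProb.sum_mul_le_iSup {d : X → EReal} (hd : ∀ x, d x ≠ ⊥) :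
    ∑ x ∈ P.supp, (P.prob x : EReal) * d x ≤ ⨆ x, d x := by
  rcases eq_or_ne (⨆ x, d x) ⊤ with hT | hT
  · rw [hT]; exact le_top
  obtain ⟨a, -⟩ := P.exists_mem_supp
  have hB : (⨆ x, d x) ≠ ⊥ := fun h => hd a (le_bot_iff.1 (h ▸ le_iSup d a))
  obtain ⟨r, hr⟩ : ∃ r : ℝ, (r : EReal) = ⨆ x, d x := ⟨_, EReal.coe_toReal hT hB⟩
  have hle : ∀ x, d x ≤ r := fun x => hr ▸ le_iSup d x
  rw [← hr]
  calc ∑ x ∈ P.supp, (P.prob x : EReal) * d x ≤ ∑ x ∈ P.supp, (P.prob x : EReal) * (r : EReal) :=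
        Finset.sum_le_sum fun x hx => mul_le_mul_of_nonneg_left (hle x)
          (EReal.coe_nonneg.2 (P.prob_pos hx).le)
    _ = (r : EReal) := by
        rw [← EReal.coe_sum_mul P.supp P.prob fun _ => r, ← Finset.sum_mul, P.sum_prob, one_mul]

theorem FinProb.sum_mul_log_le {q : X → ℝ} (hq : ∀ x ∈ P.supp, 0 < q x) :
    ∑ x ∈ P.supp, P.prob x * Real.log (q x) ≤ Real.log (∑ x ∈ P.supp, P.prob x * q x) :=
  strictConcaveOn_log_Ioi.concaveOn.le_map_sum (fun _ hx => (P.prob_pos hx).le) P.sum_prob hq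

theorem mul_log_sum_eq {k : ℝ} {Q : X → ENNReal} (h0 : ∀ x ∈ P.supp, Q x ≠ 0)
    (hT : ∀ x ∈ P.supp, Q x ≠ ⊤) :
    (((k⁻¹ : ℝ) : EReal) * ENNReal.log (∑ x ∈ P.supp, ENNReal.ofReal (P.prob x) * Q x) =
      ((k⁻¹ * Real.log (∑ x ∈ P.supp, P.prob x * (Q x).toReal) : ℝ) : EReal)) ∧
    ∑ x ∈ P.supp, (P.prob x : EReal) * (((k⁻¹ : ℝ) : EReal) * ENNReal.log (Q x)) =
      ((k⁻¹ * ∑ x ∈ P.supp, P.prob x * Real.log (Q x).toReal : ℝ) : EReal) := by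
  have hq : ∀ x ∈ P.supp, 0 < (Q x).toReal := fun x hx => ENNReal.toReal_pos (h0 x hx) (hT x hx)
  constructor
  · have hpos : 0 < ∑ x ∈ P.supp, P.prob x * (Q x).toReal :=
      Finset.sum_pos (fun x hx => mul_pos (P.prob_pos hx) (hq x hx)) P.exists_mem_supp
    have e : ∑ x ∈ P.supp, ENNReal.ofReal (P.prob x) * Q x =
        ENNReal.ofReal (∑ x ∈ P.supp, P.prob x * (Q x).toReal) := by
      rw [ENNReal.ofReal_sum_of_nonneg fun x hx => (mul_pos (P.prob_pos hx) (hq x hx)).le]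
      refine Finset.sum_congr rfl fun x hx => ?_
      rw [ENNReal.ofReal_mul (P.prob_pos hx).le, ENNReal.ofReal_toReal (hT x hx)]
    rw [e, ENNReal.log_ofReal_of_pos hpos, ← EReal.coe_mul]
  · rw [Finset.mul_sum]
    have e : ∑ x ∈ P.supp, k⁻¹ * (P.prob x * Real.log (Q x).toReal) =
        ∑ x ∈ P.supp, P.prob x * (k⁻¹ * Real.log (Q x).toReal) :=
      Finset.sum_congr rfl fun x _ => by ring
    rw [e, EReal.coe_sum_mul]
    refine Finset.sum_congr rfl fun x hx => ?_
    rw [EReal.coe_mul k⁻¹, ← ENNReal.log_ofReal_of_pos (hq x hx), ENNReal.ofReal_toReal (hT x hx)]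

theorem sum_mul_log_le_of_pos {k : ℝ} (hk : 0 < k) {Q : X → ENNReal} (h0 : ∀ x, Q x ≠ 0) :
    ∑ x ∈ P.supp, (P.prob x : EReal) * (((k⁻¹ : ℝ) : EReal) * ENNReal.log (Q x)) ≤
      ((k⁻¹ : ℝ) : EReal) * ENNReal.log (∑ x ∈ P.supp, ENNReal.ofReal (P.prob x) * Q x) := by
  by_cases hT : ∀ x ∈ P.supp, Q x ≠ ⊤
  · have h := mul_log_sum_eq P (k := k) (fun x _ => h0 x) hT
    rw [h.1, h.2]
    exact EReal.coe_le_coe_iff.2 (mul_le_mul_of_nonneg_left (P.sum_mul_log_le fun x hx =>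
      ENNReal.toReal_pos (h0 x) (hT x hx)) (inv_pos.2 hk).le)
  · push Not at hT
    obtain ⟨a, ha, hQ⟩ := hT
    have : ∑ x ∈ P.supp, ENNReal.ofReal (P.prob x) * Q x = ⊤ :=
      ENNReal.sum_eq_top.2 ⟨a, ha, by
        rw [hQ, ENNReal.mul_top (ENNReal.ofReal_pos.2 (P.prob_pos ha)).ne']⟩
    rw [this, ENNReal.log_top, EReal.coe_mul_top_of_pos (inv_pos.2 hk)]
    exact le_top

theorem coe_mul_log_ne_bot_of_neg {k : ℝ} (hk : k < 0) {Q : ENNReal} (hT : Q ≠ ⊤) :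
    ((k⁻¹ : ℝ) : EReal) * ENNReal.log Q ≠ ⊥ := by
  rcases eq_or_ne Q 0 with rfl | h0
  · simp [EReal.coe_mul_bot_of_neg (inv_lt_zero.2 hk)]
  · rw [← ENNReal.ofReal_toReal hT, ENNReal.log_ofReal_of_pos (ENNReal.toReal_pos h0 hT),
      ← EReal.coe_mul]
    exact EReal.coe_ne_bot _

/-- Jensen for the logarithm, reversed by the negative factor; a vanishing `Q x` makes the right
side `⊤`. -/
theorem mul_log_sum_le_of_neg {k : ℝ} (hk : k < 0) {Q : X → ENNReal} (hT : ∀ x, Q x ≠ ⊤) :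
    ((k⁻¹ : ℝ) : EReal) * ENNReal.log (∑ x ∈ P.supp, ENNReal.ofReal (P.prob x) * Q x) ≤
      ∑ x ∈ P.supp, (P.prob x : EReal) * (((k⁻¹ : ℝ) : EReal) * ENNReal.log (Q x)) := by
  by_cases h0 : ∀ x ∈ P.supp, Q x ≠ 0
  · have h := mul_log_sum_eq P (k := k) h0 fun x _ => hT x
    rw [h.1, h.2]
    exact EReal.coe_le_coe_iff.2 (mul_le_mul_of_nonpos_left (P.sum_mul_log_le fun x hx =>
      ENNReal.toReal_pos (h0 x hx) (hT x)) (inv_lt_zero.2 hk).le)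
  · push Not at h0
    obtain ⟨a, ha, hQ⟩ := h0
    rw [P.sum_mul_eq_top (fun x => coe_mul_log_ne_bot_of_neg hk (hT x)) ha
      (by rw [hQ, ENNReal.log_zero, EReal.coe_mul_bot_of_neg (inv_lt_zero.2 hk)])]
    exact le_top

theorem mul_log_sum_le_iSup_of_pos {k : ℝ} (hk : 0 < k) (Q : X → ENNReal) :
    ((k⁻¹ : ℝ) : EReal) * ENNReal.log (∑ x ∈ P.supp, ENNReal.ofReal (P.prob x) * Q x) ≤
      ⨆ x, ((k⁻¹ : ℝ) : EReal) * ENNReal.log (Q x) := by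
  refine EReal.ge_of_forall_gt_iff_ge.1 fun c hc => ?_
  rw [coe_lt_mul_log_iff_of_pos hk] at hc
  obtain ⟨x, hx⟩ : ∃ x, ENNReal.ofReal (Real.exp (k * c)) < Q x := by
    by_contra! h
    refine absurd hc (not_lt.2 ?_)
    calc ∑ x ∈ P.supp, ENNReal.ofReal (P.prob x) * Q x
        ≤ ∑ x ∈ P.supp, ENNReal.ofReal (P.prob x) * ENNReal.ofReal (Real.exp (k * c)) :=
          Finset.sum_le_sum fun x _ => mul_le_mul_right (h x) _
      _ = ENNReal.ofReal (Real.exp (k * c)) := by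
          rw [← Finset.sum_mul, P.sum_ofReal_prob, one_mul]
  exact ((coe_lt_mul_log_iff_of_pos hk c (Q x)).2 hx).le.trans
    (le_iSup (fun x => ((k⁻¹ : ℝ) : EReal) * ENNReal.log (Q x)) x)

end ExtendedReals

/-! ### Holevo quantities and the final chains of inequalities -/

section Holevo

set_option linter.unusedSectionVars false

open scoped MatrixOrder Matrix.Norms.L2Operator
open Filter Topology

variable {n : Type*} [Fintype n] [DecidableEq n] [Nonempty n]
variable {X : Type*} {t : RenyiFamily} {α : ℝ}

theorem reTrace_liftedState (W : X → DensityMatrix n) (P : FinProb X) :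
    (liftedState W P).trace.re = 1 := by
  classical
  have h : reTrace (liftedState W P) = 1 := by
    rw [liftedState_eq_directSum, reTrace_directSum]
    simp only [map_smul, DensityMatrix.reTrace_eq_one, smul_eq_mul, mul_one]
    rw [Finset.sum_coe_sort P.supp P.prob, P.sum_prob]
  exact h

theorem chiOne_eq_of_tendsto (h0 : 0 < α) (h1 : α ≠ 1) (W : X → DensityMatrix n)
    (h : ∀ x (σ : DensityMatrix n), Tendsto (fun ε : ℝ => ENNReal.ofReal
      (renyiQPosDef t α ((W x).mat + ε • (1 : Matrix n n ℂ)) (σ.mat + ε • (1 : Matrix n n ℂ))))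
      (𝓝[>] 0) (𝓝 (renyiQ t α (W x).mat σ.mat))) (P : FinProb X) :
    chiOne t α W P = ⨅ σ : DensityMatrix n, (((α - 1)⁻¹ : ℝ) : EReal) *
      ENNReal.log (∑ x ∈ P.supp, ENNReal.ofReal (P.prob x) * renyiQ t α (W x).mat σ.mat) := by
  classical
  refine iInf_congr fun σ => ?_
  rw [renyiDiv, if_neg h1, reTrace_liftedState, ENNReal.ofReal_one, ENNReal.log_one, sub_zero,
    liftedState_eq_directSum, inputState_kronecker,
    renyiQ_directSum_smul (ι := P.supp) h0 (fun x => P.prob_pos x.2) (fun x => (W x).nonneg)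
      (fun _ => σ.nonneg) (fun x => h x σ),
    Finset.sum_coe_sort P.supp fun x => ENNReal.ofReal (P.prob x) * renyiQ t α (W x).mat σ.mat]

/-- For each `σ` the relative entropy of the block diagonal states is the average of the blockwise
ones: the terms in `log P(x)` cancel on the supports, and both sides are `⊤` if one support is not
nested. -/
theorem chiOne_one_eq_chiTwo (t : RenyiFamily) (W : X → DensityMatrix n) (P : FinProb X) :
    chiOne t 1 W P = chiTwo t 1 W P := by
  classical
  refine iInf_congr fun σ => ?_
  have hD : ∀ x, renyiDiv t 1 (W x).mat σ.mat = relEntropy (W x).mat σ.mat := fun x => by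
    have h : (W x).mat.trace.re = 1 := (W x).reTrace_eq_one
    rw [renyiDiv, if_pos rfl, h, inv_one, EReal.coe_one, one_mul]
  have hσ : σ.mat.IsHermitian := σ.2.1.1
  simp only [hD]
  rw [renyiDiv, if_pos rfl, reTrace_liftedState, inv_one, EReal.coe_one, one_mul,
    liftedState_eq_directSum, inputState_kronecker,
    relEntropy_directSum_smul (ι := P.supp) (A := fun x => (W x).mat) (B := fun _ => σ.mat)
      (fun x => P.prob_pos x.2) (fun x => (W x).2.1.1) (fun _ => hσ)]
  split_ifs with h
  · rw [Finset.sum_coe_sort P.supp fun x => P.prob x *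
      reTrace ((W x).mat * (matLog (W x).mat - matLog σ.mat)), EReal.coe_sum_mul]
    refine Finset.sum_congr rfl fun x hx => ?_
    rw [relEntropy_eq_ite hσ, if_pos (h ⟨x, hx⟩)]
  · push Not at h
    obtain ⟨x, hx⟩ := h
    refine (P.sum_mul_eq_top (fun y => ?_) x.2 ?_).symm
    · rw [relEntropy_eq_ite hσ]
      split_ifs <;> simp
    · rw [relEntropy_eq_ite hσ, if_neg hx]

theorem chiTwo_le_radius (W : X → DensityMatrix n) (P : FinProb X)
    (h : ∀ x (σ : DensityMatrix n), renyiDiv t α (W x).mat σ.mat ≠ ⊥) :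
    chiTwo t α W P ≤ renyiRadius t α W :=
  iInf_mono fun σ => P.sum_mul_le_iSup fun x => h x σ

theorem tendsto_renyiQ_nhds_of_one_lt (h1 : 1 < α) (hp : t = RenyiFamily.petz → α ≤ 2)
    {ρ σ : Matrix n n ℂ} (hρ : 0 ≤ ρ) (hσ : 0 ≤ σ) :
    Tendsto (fun ε : ℝ => ENNReal.ofReal
      (renyiQPosDef t α (ρ + ε • (1 : Matrix n n ℂ)) (σ + ε • (1 : Matrix n n ℂ)))) (𝓝[>] 0)
      (𝓝 (renyiQ t α ρ σ)) := by
  have h := tendsto_renyiQ_of_one_lt h1 hp hρ hσ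
  rwa [← renyiQ_eq_of_tendsto h] at h

theorem chiOne_le_chiTwo_of_lt_one (h0 : 0 < α) (h1 : α < 1)
    (hs : t = RenyiFamily.sandwiched → 1 / 2 ≤ α) (W : X → DensityMatrix n) (P : FinProb X) :
    chiOne t α W P ≤ chiTwo t α W P := by
  rw [chiOne_eq_of_tendsto h0 h1.ne W
    (fun x σ => (tendsto_renyiQ_of_lt_one h0 h1 hs (W x).nonneg σ.nonneg).1)]
  refine iInf_mono fun σ => ?_
  simp only [renyiDiv_eq_of_ne_one t h1.ne (W _).reTrace_eq_one]
  exact mul_log_sum_le_of_neg P (by linarith) fun x =>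
    (renyiQ_lt_top_of_lt_one h0 h1 hs (W x).nonneg σ.nonneg).ne

/-- The chain is `χ₁ ≤ χ₂ ≤ R ≤ sup χ₁`, the last step being minimax for the concave `Q_α`. -/
theorem radius_chain_of_lt_one (h0 : 0 < α) (h1 : α < 1)
    (hs : t = RenyiFamily.sandwiched → 1 / 2 ≤ α) (W : X → DensityMatrix n) :
    renyiRadius t α W = (⨆ P : FinProb X, chiTwo t α W P) ∧
      renyiRadius t α W = ⨆ P : FinProb X, chiOne t α W P := by
  have h12 : (⨆ P : FinProb X, chiOne t α W P) ≤ ⨆ P : FinProb X, chiTwo t α W P :=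
    iSup_mono fun P => chiOne_le_chiTwo_of_lt_one h0 h1 hs W P
  have h2R : (⨆ P : FinProb X, chiTwo t α W P) ≤ renyiRadius t α W :=
    iSup_le fun P => chiTwo_le_radius W P fun x σ => by
      rw [renyiDiv_eq_of_ne_one t h1.ne (W x).reTrace_eq_one]
      exact coe_mul_log_ne_bot_of_neg (by linarith)
        (renyiQ_lt_top_of_lt_one h0 h1 hs (W x).nonneg σ.nonneg).ne
  have hR1 : renyiRadius t α W ≤ ⨆ P : FinProb X, chiOne t α W P := by
    refine (renyiRadius_le_iSup_of_lt_one h0 h1 hs W).trans_eq (iSup_congr fun P => ?_)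
    rw [chiOne_eq_of_tendsto h0 h1.ne W
      (fun x σ => (tendsto_renyiQ_of_lt_one h0 h1 hs (W x).nonneg σ.nonneg).1)]
  exact ⟨le_antisymm (hR1.trans h12) h2R, le_antisymm hR1 (h12.trans h2R)⟩

/-- The chain is `χ₂ ≤ χ₁ ≤ R ≤ sup χ₂`, the last step being minimax for the convex `D_α`. -/
theorem radius_chain_of_one_lt (h1 : 1 < α) (hp : t = RenyiFamily.petz → α ≤ 2)
    (W : X → DensityMatrix n) :
    renyiRadius t α W = (⨆ P : FinProb X, chiTwo t α W P) ∧
      renyiRadius t α W = ⨆ P : FinProb X, chiOne t α W P := by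
  have hk : 0 < α - 1 := by linarith
  have hconv := fun x => isConvexDivergence_renyiDiv_of_one_lt h1 hp (W x).nonneg
    (W x).reTrace_eq_one
  have hχ := chiOne_eq_of_tendsto (by linarith) h1.ne' W
    (fun x σ => tendsto_renyiQ_nhds_of_one_lt h1 hp (W x).nonneg σ.nonneg)
  have hR2 : renyiRadius t α W ≤ ⨆ P : FinProb X, chiTwo t α W P :=
    radius_le_iSup_iInf_sum hconv
  have h21 : (⨆ P : FinProb X, chiTwo t α W P) ≤ ⨆ P : FinProb X, chiOne t α W P := by
    refine iSup_mono fun P => ?_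
    rw [hχ]
    refine iInf_mono fun σ => ?_
    have hD := fun x => renyiDiv_eq_of_ne_one t h1.ne' (W x).reTrace_eq_one σ.mat
    simp only [hD]
    refine sum_mul_log_le_of_pos P hk fun x hQ => ?_
    have h := (hconv x).coe_le σ.nonneg one_pos
    rw [hD, hQ, ENNReal.log_zero, EReal.coe_mul_bot_of_pos (inv_pos.2 hk)] at h
    exact EReal.coe_ne_bot _ (le_bot_iff.1 h)
  have h1R : (⨆ P : FinProb X, chiOne t α W P) ≤ renyiRadius t α W := by
    refine iSup_le fun P => ?_
    rw [hχ]
    refine iInf_mono fun σ => ?_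
    simp only [renyiDiv_eq_of_ne_one t h1.ne' (W _).reTrace_eq_one]
    exact mul_log_sum_le_iSup_of_pos P hk _
  exact ⟨le_antisymm hR2 (h21.trans h1R), le_antisymm (hR2.trans h21) h1R⟩

theorem radius_chain_one (t : RenyiFamily) (W : X → DensityMatrix n) :
    renyiRadius t 1 W = (⨆ P : FinProb X, chiTwo t 1 W P) ∧
      renyiRadius t 1 W = ⨆ P : FinProb X, chiOne t 1 W P := by
  have hconv := fun x => isConvexDivergence_renyiDiv_one t (W x).nonneg (W x).reTrace_eq_one
  simp only [chiOne_one_eq_chiTwo, and_self]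
  refine le_antisymm (radius_le_iSup_iInf_sum hconv)
    (iSup_le fun P => chiTwo_le_radius W P fun x σ hb => ?_)
  have h := (hconv x).coe_le σ.nonneg one_pos
  rw [hb] at h
  exact EReal.coe_ne_bot _ (le_bot_iff.1 h)

theorem renyiRadius_eq_of_admissible (h0 : 0 < α) (hp : t = RenyiFamily.petz → α ≤ 2)
    (hs : t = RenyiFamily.sandwiched → 1 / 2 ≤ α) (W : X → DensityMatrix n) :
    renyiRadius t α W = (⨆ ε : Set.Ioi (0 : ℝ), ⨅ σ : DensityMatrix n, ⨆ x : X,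
        renyiDiv t α (W x).mat (σ.mat + (ε : ℝ) • (1 : Matrix n n ℂ))) ∧
      renyiRadius t α W = (⨆ P : FinProb X, chiTwo t α W P) ∧
      renyiRadius t α W = ⨆ P : FinProb X, chiOne t α W P := by
  rcases lt_trichotomy α 1 with h1 | rfl | h1
  · exact ⟨renyiRadius_eq_iSup_add_smul_one_of_lt_one h0 h1 hs W, radius_chain_of_lt_one h0 h1 hs W⟩
  · exact ⟨radius_eq_iSup_add_smul_one fun x =>
      isConvexDivergence_renyiDiv_one t (W x).nonneg (W x).reTrace_eq_one, radius_chain_one t W⟩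
  · exact ⟨radius_eq_iSup_add_smul_one fun x =>
      isConvexDivergence_renyiDiv_of_one_lt h1 hp (W x).nonneg (W x).reTrace_eq_one,
      radius_chain_of_one_lt h1 hp W⟩

end Holevo

theorem mainTheorem9 {X n : Type*} [Fintype n] [DecidableEq n] [Nonempty n]
    (W : X → DensityMatrix n) :
    (∀ (t : RenyiFamily) (α : ℝ),
      ((t = RenyiFamily.petz ∧ 0 < α ∧ α ≤ 2) ∨
        (t = RenyiFamily.sandwiched ∧ 1 / 2 ≤ α) ∨
        (t = RenyiFamily.flat ∧ 1 < α)) →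
      renyiRadius t α W =
          (⨆ ε : Set.Ioi (0 : ℝ), ⨅ σ : DensityMatrix n, ⨆ x : X,
            renyiDiv t α (W x).mat (σ.mat + (ε : ℝ) • (1 : Matrix n n ℂ))) ∧
        renyiRadius t α W = (⨆ P : FinProb X, chiTwo t α W P) ∧
        renyiRadius t α W = (⨆ P : FinProb X, chiOne t α W P) ∧
        renyiRadius t α W = renyiCapacity t α W) ∧
    (∀ α : ℝ, 0 < α → α < 1 →
      (⨆ P : FinProb X, chiTwo RenyiFamily.flat α W P) =
        ⨆ P : FinProb X, chiOne RenyiFamily.flat α W P) := by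
  refine ⟨fun t α h => ?_, fun α h0 h1 => ?_⟩
  · suffices hh : 0 < α ∧ (t = RenyiFamily.petz → α ≤ 2) ∧
        (t = RenyiFamily.sandwiched → 1 / 2 ≤ α) by
      obtain ⟨hε, h2, h1⟩ := renyiRadius_eq_of_admissible hh.1 hh.2.1 hh.2.2 W
      -- The capacity is by definition the supremum of `chiOne`, so `h1` serves twice.
      exact ⟨hε, h2, h1, h1⟩
    rcases h with ⟨rfl, h0, h2⟩ | ⟨rfl, h⟩ | ⟨rfl, h⟩
    · exact ⟨h0, fun _ => h2, nofun⟩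
    · exact ⟨by linarith, nofun, fun _ => h⟩
    · exact ⟨by linarith, nofun, nofun⟩
  -- The flat version needs no lower bound on `α` beyond positivity, so both suprema equal its
  -- radius.
  · have h := radius_chain_of_lt_one (t := RenyiFamily.flat) h0 h1 nofun W
    exact h.1.symm.trans h.2
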